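/- \textbf{Setting.} Let $d\ge 1$, let $\mathcal X\subseteq\mathbb R^{d}$ be open with compact closure $\overline{\mathcal X}$, and let $B\subseteq\mathbb R^d$ be open with $\overline{\mathcal X}\subseteq B$. Let $\Delta$ be a real function of class $C^1$ on $B$, with gradient $\partial\Delta$. Let $\mu$ be a probability measure on $B$ having a density $\mu'\ge 0$ with respect to Lebesgue measure that is continuous on $B$ and vanishes on $B\setminus\mathcal X$. A real number $\delta$ is a regular value of $\Delta$ on $\overline{\mathcal X}$ if $\partial\Delta(x)\neq0$ for every $x\in\overline{\mathcal X}$ with $\Delta(x)=\delta$. Put $\mathcal M_\Delta(\delta)=\{x\in\mathcal X:\Delta(x)=\delta\}$, and assume that for every regular value $\delta$ of $\Delta$ on $\overline{\mathcal X}$ the closure of $\mathcal M_\Delta(\delta)$ has finitely many path components. Let $\mathrm{Vol}$ be the $(d-1)$-dimensional volume (Hausdorff) measure. Let $\mathbb F$ be the linear space of continuous functions on $B$, with the topology of the sup-norm distance (uniform convergence on $B$), and $\mathbb F_0\subseteq\mathbb F$ the subspace of uniformly continuous functions. Let $\mathcal F\subseteq\mathbb F$ be a set containing $\Delta$, let $\mathcal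 V\subseteq\mathbb R$, and let $\mathcal G=\{1\{f\le\delta\}:f\in\mathcal F,\ \delta\in\mathcal V\}$. Let $\mathbb H$ be the space of all bounded linear operators $H:\mathcal G\to\mathbb R$ (restrictions to $\mathcal G$ of linear functionals on its span) that are uniformly continuous for the $L^2(\mu)$ distance, with norm $\|H\|_{\mathcal G}=\sup_{g\in\mathcal G}|H(g)|$; the measure $\mu$ is identified with $g\mapsto\int g\,d\mu$, which is in $\mathbb H$. Put $\mathbb D=\mathbb F\times\mathbb H$, $\mathbb D_0=\mathbb F_0\times\mathbb H$, $\mathbb D_\phi=\mathcal F\times\mathbb H$, and for $(f,H)\in\mathbb D_\phi$ define $$F_{f,H}(\delta)=H(1\{f\le\delta\})\quad(\delta\in\mathcal V),\qquad f^*_H(u)=\inf\{\delta\in\mathcal V: F_{f,H}(\delta)\ge u\}.$$ For the measure $\mu$ itself put $F_{\Delta,\mu}(\delta)=\mu\{\Delta\le\delta\}$ for all $\delta\in\mathbb R$ and $\Delta^*_\mu(u)=\inf\{\delta\in\mathbb R:F_{\Delta,\mu}(\delta)\ge u\}\in[-\infty,\infty]$. Maps $\phi_\theta:\mathbb D_\phi\to\mathbb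 R$, $\theta\in\Theta$, are called Hadamard differentiable uniformly in $\theta\in\Theta$ at $x\in\mathbb D_\phi$ tangentially to $\mathbb D_0$, with derivatives $\partial\phi_\theta$, if each $\partial\phi_\theta:\mathbb D_0\to\mathbb R$ is continuous and linear, $(\theta,h)\mapsto\partial\phi_\theta[h]$ is continuous on $\Theta\times\mathbb D_0$, and for all real $t_n\to0$, $t_n\ne0$, and all $h_n\to h\in\mathbb D_0$ in $\mathbb D$ with $x+t_nh_n\in\mathbb D_\phi$ for every $n$, $$\sup_{\theta\in\Theta}\Big|\frac{\phi_\theta(x+t_nh_n)-\phi_\theta(x)}{t_n}-\partial\phi_\theta[h]\Big|\to0.$$ \textbf{Statement.} Let $\mathcal D\subseteq\mathcal V$ be a compact set of regular values of $\Delta$ on $\overline{\mathcal X}$. For every $\delta\in\mathcal D$ and $G\in\mathbb F_0$ the function $G\mu'/\|\partial\Delta\|$ is integrable on $\mathcal M_\Delta(\delta)$ with respect to $\mathrm{Vol}$, and $F_{\Delta,\mu}$ is differentiable at $\delta$ with derivative $$f_{\Delta,\mu}(\delta):=\int_{\mathcal M_\Delta(\delta)}\frac{\mu'(x)}{\|\partial\Delta(x)\|}\,d\mathrm{Vol}.$$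 (a) The map $(f,H)\mapsto F_{f,H}(\delta)$ is Hadamard differentiable uniformly in $\delta\in\mathcal D$ at $(\Delta,\mu)$ tangentially to $\mathbb D_0$, with derivative $$\partial_{\Delta,\mu}F_{\Delta,\mu}(\delta)[G,H]=-\int_{\mathcal M_\Delta(\delta)}\frac{G(x)\mu'(x)}{\|\partial\Delta(x)\|}\,d\mathrm{Vol}+H(1\{\Delta\le\delta\}).$$ (b) Suppose moreover that $\mathcal D$ is contained in the interior of $\mathcal V$, let $\varepsilon>0$, and put $\mathcal U=\{u\in[0,1]:\Delta^*_\mu(u)\in\mathcal D,\ f_{\Delta,\mu}(\Delta^*_\mu(u))>\varepsilon\}$. On $\mathcal U$ the infimum over $\mathcal V$ that defines the sorting operator at $(\Delta,\mu)$ equals $\Delta^*_\mu(u)$; along every sequence $(\Delta,\mu)+t_nh_n$ as above, for all large $n$ and all $u\in\mathcal U$ the infimum defining the operator is over a non-empty set that is bounded below; and the map $(f,H)\mapsto f^*_H(u)$ is Hadamard differentiable uniformly in $u\in\mathcal U$ at $(\Delta,\mu)$ tangentially to $\mathbb D_0$, with derivative $$\partial_{\Delta,\mu}\Delta^*_\mu(u)[G,H]=-\frac{\partial_{\Delta,\mu}F_{\Delta,\mu}(\Delta^*_\mu(u))[G,H]}{f_{\Delta,\mu}(\Delta^*_\mu(u))}.$$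 -/

import Mathlib

open MeasureTheory Set Filter Topology
open scoped ENNReal UniformConvergence

namespace SortedEffects

noncomputable section

/-! ### Hadamard differentiability, uniformly in an index -/

/-- `t n → 0`, `t n ≠ 0`, `h n → h₀ ∈ D₀`, and `f + t n • h n` stays in the domain `Dφ`. -/
structure IsTangentSeq {D : Type*} [AddCommGroup D] [Module ℝ D] [TopologicalSpace D]
    (Dφ : Set D) (D₀ : Submodule ℝ D) (f : D) (t : ℕ → ℝ) (h : ℕ → D) (h₀ : D) : Prop where
  ne_zero : ∀ n, t n ≠ 0
  tendsto_zero : Tendsto t atTop (𝓝 0)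
  tendsto_dir : Tendsto h atTop (𝓝 h₀)
  mem_tangent : h₀ ∈ D₀
  mem_domain : ∀ n, f + t n • h n ∈ Dφ

/-- The maps `φ θ : Dφ ⊆ D → ℝ` are Hadamard differentiable at `f ∈ Dφ` tangentially to `D₀`,
uniformly in `θ ∈ Θ`, with derivative maps `φ' θ` (only the values of `φ' θ` on `D₀` matter). -/
def HasHadamardDerivUniformlyOn {T D : Type*} [TopologicalSpace T] [AddCommGroup D] [Module ℝ D]
    [TopologicalSpace D] (φ φ' : T → D → ℝ) (Θ : Set T) (Dφ : Set D) (D₀ : Submodule ℝ D)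
    (f : D) : Prop :=
  f ∈ Dφ ∧
  (∀ θ ∈ Θ, ∃ L : D₀ →L[ℝ] ℝ, ∀ h : D₀, L h = φ' θ h) ∧
  ContinuousOn (fun q : T × D => φ' q.1 q.2) (Θ ×ˢ (D₀ : Set D)) ∧
  ∀ (t : ℕ → ℝ) (h : ℕ → D) (h₀ : D), IsTangentSeq Dφ D₀ f t h h₀ →
    TendstoUniformlyOn (fun n θ => (φ θ (f + t n • h n) - φ θ f) / t n)
      (fun θ => φ' θ h₀) atTop Θ

/-! ### Function spaces -/

section Spaces

variable {d : ℕ} (B : Set (EuclideanSpace ℝ (Fin d)))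

/-- The linear space `𝔽` of continuous functions on `B`; its topology is that of uniform
convergence on `B`, i.e. of the sup-norm distance. -/
def contSpace : Submodule ℝ (B →ᵤ ℝ) where
  carrier := {f | Continuous (UniformFun.toFun f)}
  add_mem' := fun hf hg => Continuous.add hf hg
  zero_mem' := continuous_const (y := (0 : ℝ))
  smul_mem' := fun c _ hf => Continuous.const_smul hf c

/-- The underlying function of an element of `𝔽`. -/
abbrev toFn {B : Set (EuclideanSpace ℝ (Fin d))} (f : contSpace B) : B → ℝ :=
  UniformFun.toFun (f : B →ᵤ ℝ)

/-- The subspace `𝔽₀` of uniformly continuous functions. -/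
def unifContSpace : Submodule ℝ (contSpace B) where
  carrier := {f | UniformContinuous (toFn f)}
  add_mem' := fun hf hg => UniformContinuous.add hf hg
  zero_mem' := uniformContinuous_const (b := (0 : ℝ))
  smul_mem' := fun c _ hf => UniformContinuous.const_smul hf c

variable {B}

/-- Restriction to `B`, as an element of `𝔽`. -/
def restr (Δ : EuclideanSpace ℝ (Fin d) → ℝ) (hΔ : ContinuousOn Δ B) : contSpace B :=
  ⟨UniformFun.ofFun (B.domRestrict Δ), hΔ.domRestrict⟩

/-- `g_{f,δ} = 1{f ≤ δ}`. -/
def ind (f : B → ℝ) (δ : ℝ) : B → ℝ := {x | f x ≤ δ}.indicator 1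

/-- `𝒢 = {1{f ≤ δ} : f ∈ ℱ, δ ∈ 𝒱}`. -/
def indClass (ℱ : Set (contSpace B)) (𝒱 : Set ℝ) : Set (B → ℝ) :=
  {g | ∃ f ∈ ℱ, ∃ δ ∈ 𝒱, g = ind (toFn f) δ}

/-- The space `ℍ` of bounded linear operators on `𝒢` (restrictions to `𝒢` of linear functionals on
the linear span of `𝒢`) that are uniformly continuous for the `L²(μ)` distance. The topology is
that of uniform convergence on `𝒢`, i.e. of the norm `sup_{g ∈ 𝒢} |H g|`. -/
def opSpace (μ : Measure B) (𝒢 : Set (B → ℝ)) : Submodule ℝ (𝒢 →ᵤ ℝ) where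
  carrier := {H |
    (∃ C : ℝ, ∀ g : 𝒢, |UniformFun.toFun H g| ≤ C) ∧
    (∃ L : Submodule.span ℝ 𝒢 →ₗ[ℝ] ℝ,
      ∀ g : 𝒢, UniformFun.toFun H g = L ⟨g.1, Submodule.subset_span g.2⟩) ∧
    (∀ e : ℝ, 0 < e → ∃ r : ℝ, 0 < r ∧ ∀ g₁ g₂ : 𝒢,
      eLpNorm (g₁.1 - g₂.1) 2 μ < ENNReal.ofReal r →
        |UniformFun.toFun H g₁ - UniformFun.toFun H g₂| < e)}
  add_mem' := by
    rintro H K ⟨⟨C, hC⟩, ⟨L, hL⟩, hu⟩ ⟨⟨C', hC'⟩, ⟨L', hL'⟩, hu'⟩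
    refine ⟨⟨C + C', fun g => (abs_add_le _ _).trans (add_le_add (hC g) (hC' g))⟩,
      ⟨L + L', fun g => ?_⟩, fun e he => ?_⟩
    · simp only [LinearMap.add_apply, ← hL, ← hL']; rfl
    · obtain ⟨r, hr, h⟩ := hu (e / 2) (half_pos he)
      obtain ⟨r', hr', h'⟩ := hu' (e / 2) (half_pos he)
      refine ⟨min r r', lt_min hr hr', fun g₁ g₂ hg => ?_⟩
      have h1 := h g₁ g₂ (hg.trans_le (ENNReal.ofReal_le_ofReal (min_le_left _ _)))
      have h2 := h' g₁ g₂ (hg.trans_le (ENNReal.ofReal_le_ofReal (min_le_right _ _)))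
      have e1 : UniformFun.toFun (H + K) g₁ - UniformFun.toFun (H + K) g₂ =
        (UniformFun.toFun H g₁ - UniformFun.toFun H g₂) +
          (UniformFun.toFun K g₁ - UniformFun.toFun K g₂) := by
        simp only [UniformFun.toFun_add, Pi.add_apply]; ring
      rw [e1]
      exact (abs_add_le _ _).trans_lt (by linarith)
  zero_mem' := ⟨⟨0, fun g => by simp⟩, ⟨0, fun g => by simp⟩,
    fun e he => ⟨1, one_pos, fun g₁ g₂ _ => by simpa using he⟩⟩
  smul_mem' := by
    rintro c H ⟨⟨C, hC⟩, ⟨L, hL⟩, hu⟩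
    refine ⟨⟨|c| * C, fun g => ?_⟩, ⟨c • L, fun g => ?_⟩, fun e he => ?_⟩
    · simp only [UniformFun.toFun_smul, Pi.smul_apply, smul_eq_mul, abs_mul]
      exact mul_le_mul_of_nonneg_left (hC g) (abs_nonneg c)
    · simp only [LinearMap.smul_apply, ← hL]; rfl
    · have hc : 0 < |c| + 1 := by positivity
      obtain ⟨r, hr, h⟩ := hu (e / (|c| + 1)) (div_pos he hc)
      refine ⟨r, hr, fun g₁ g₂ hg => ?_⟩
      have h1 := h g₁ g₂ hg
      simp only [UniformFun.toFun_smul, Pi.smul_apply, smul_eq_mul]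
      rw [← mul_sub, abs_mul]
      rw [lt_div_iff₀ hc] at h1
      nlinarith [abs_nonneg (UniformFun.toFun H g₁ - UniformFun.toFun H g₂)]

lemma memLp_of_mem_indClass (μ : Measure B) [IsProbabilityMeasure μ] (ℱ : Set (contSpace B))
    (𝒱 : Set ℝ) {g : B → ℝ} (hg : g ∈ indClass ℱ 𝒱) (q : ℝ≥0∞) : MemLp g q μ := by
  obtain ⟨f, -, δ, -, rfl⟩ := hg
  have hm : MeasurableSet {x : B | (toFn f) x ≤ δ} :=
    (isClosed_le f.2 continuous_const).measurableSet
  exact (memLp_const (1 : ℝ)).indicator hm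

/-- A probability measure `μ` on `B`, identified with the operator `g ↦ ∫ g dμ`, is in `ℍ`. -/
def measureOp (μ : Measure B) [IsProbabilityMeasure μ] (ℱ : Set (contSpace B)) (𝒱 : Set ℝ) :
    opSpace μ (indClass ℱ 𝒱) :=
  ⟨UniformFun.ofFun fun g => ∫ x, g.1 x ∂μ, by
    have hspan : ∀ g ∈ Submodule.span ℝ (indClass ℱ 𝒱), Integrable g μ := fun g hg => by
      induction hg using Submodule.span_induction with
      | mem g hg => exact memLp_one_iff_integrable.1 (memLp_of_mem_indClass μ ℱ 𝒱 hg 1)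
      | zero => exact integrable_zero _ _ _
      | add _ _ _ _ h1 h2 => exact h1.add h2
      | smul c _ _ h => exact h.smul c
    refine ⟨⟨1, fun g => ?_⟩, ⟨⟨⟨fun g => ∫ x, g.1 x ∂μ, fun g₁ g₂ => ?_⟩, fun c g => ?_⟩,
      fun g => rfl⟩, fun e he => ⟨e, he, fun g₁ g₂ h => ?_⟩⟩
    · have hb : ∀ x, ‖g.1 x‖ ≤ 1 := fun x => by
        obtain ⟨f, -, δ, -, h⟩ := g.2
        rw [h, ind]
        exact (norm_indicator_le_norm_self _ _).trans (by simp)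
      simpa using norm_integral_le_of_norm_le_const (μ := μ) (Eventually.of_forall hb)
    · exact integral_add (hspan _ g₁.2) (hspan _ g₂.2)
    · exact integral_const_mul c _
    · have m1 := memLp_of_mem_indClass μ ℱ 𝒱 g₁.2
      have m2 := memLp_of_mem_indClass μ ℱ 𝒱 g₂.2
      have i1 := memLp_one_iff_integrable.1 (m1 1)
      have i2 := memLp_one_iff_integrable.1 (m2 1)
      change |∫ x, g₁.1 x ∂μ - ∫ x, g₂.1 x ∂μ| < e
      rw [← integral_sub i1 i2, ← Real.norm_eq_abs, ← ENNReal.ofReal_lt_ofReal_iff he]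
      calc ENNReal.ofReal ‖∫ x, (g₁.1 x - g₂.1 x) ∂μ‖
          ≤ ∫⁻ x, ‖g₁.1 x - g₂.1 x‖ₑ ∂μ := by
            rw [ofReal_norm]; exact enorm_integral_le_lintegral_enorm _
        _ = eLpNorm (g₁.1 - g₂.1) 1 μ := by rw [eLpNorm_one_eq_lintegral_enorm]; rfl
        _ ≤ eLpNorm (g₁.1 - g₂.1) 2 μ :=
            eLpNorm_le_eLpNorm_of_exponent_le (by norm_num)
              (i1.aestronglyMeasurable.sub i2.aestronglyMeasurable)
        _ < ENNReal.ofReal e := h⟩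

/-- `𝔻 = 𝔽 × ℍ`. -/
abbrev DSpace (μ : Measure B) (ℱ : Set (contSpace B)) (𝒱 : Set ℝ) : Type :=
  contSpace B × opSpace μ (indClass ℱ 𝒱)

/-- The elements `(f, H)` of `𝔻` at which `H(1{f ≤ δ})` is defined for `δ ∈ 𝒱`: `f ∈ ℱ`. -/
def domain (μ : Measure B) (ℱ : Set (contSpace B)) (𝒱 : Set ℝ) : Set (DSpace μ ℱ 𝒱) :=
  {D | D.1 ∈ ℱ}

/-- `𝔻₀ = 𝔽₀ × ℍ`. -/
def tangentSpace (μ : Measure B) (ℱ : Set (contSpace B)) (𝒱 : Set ℝ) :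
    Submodule ℝ (DSpace μ ℱ 𝒱) :=
  (unifContSpace B).prod ⊤

open Classical in
/-- `H(g)`; every use below has `g ∈ 𝒢`. -/
def evalOp {μ : Measure B} {𝒢 : Set (B → ℝ)} (H : opSpace μ 𝒢) (g : B → ℝ) : ℝ :=
  if hg : g ∈ 𝒢 then UniformFun.toFun (H : 𝒢 →ᵤ ℝ) ⟨g, hg⟩ else 0

/-- `F_{f,H}(δ) = H(1{f ≤ δ})`, for `f ∈ ℱ` and `δ ∈ 𝒱`. -/
def cdfOp {μ : Measure B} {ℱ : Set (contSpace B)} {𝒱 : Set ℝ} (δ : ℝ) (D : DSpace μ ℱ 𝒱) : ℝ :=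
  evalOp D.2 (ind (toFn D.1) δ)

/-- `{δ ∈ 𝒱 : F_{f,H}(δ) ≥ u}`. -/
def upperSet {μ : Measure B} {ℱ : Set (contSpace B)} {𝒱 : Set ℝ} (u : ℝ) (D : DSpace μ ℱ 𝒱) :
    Set ℝ :=
  {δ | δ ∈ 𝒱 ∧ u ≤ cdfOp δ D}

/-- The sorting operator: the left inverse of `δ ↦ F_{f,H}(δ)` at `u`. -/
def sortOp {μ : Measure B} {ℱ : Set (contSpace B)} {𝒱 : Set ℝ} (u : ℝ) (D : DSpace μ ℱ 𝒱) : ℝ :=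
  sInf (upperSet u D)

/-- `F_{Δ,μ}(δ) = μ{Δ ≤ δ}` for the measure `μ` itself, at every real `δ`. -/
def cdf (μ : Measure B) (Δ : EuclideanSpace ℝ (Fin d) → ℝ) (δ : ℝ) : ℝ :=
  μ.real {x : B | Δ x ≤ δ}

/-- `Δ*_μ(u) = inf {δ ∈ ℝ : F_{Δ,μ}(δ) ≥ u}` for the measure `μ` itself. -/
def sorted (μ : Measure B) (Δ : EuclideanSpace ℝ (Fin d) → ℝ) (u : ℝ) : ℝ :=
  sInf {δ | u ≤ cdf μ Δ δ}

end Spaces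

/-! ### Level sets and integrals over them -/

section Level

variable {d : ℕ} {B : Set (EuclideanSpace ℝ (Fin d))}

/-- `δ` is a regular value of `Δ` on `K`. -/
def IsRegularValueOn (Δ : EuclideanSpace ℝ (Fin d) → ℝ) (K : Set (EuclideanSpace ℝ (Fin d)))
    (δ : ℝ) : Prop :=
  ∀ x ∈ K, Δ x = δ → gradient Δ x ≠ 0

/-- `M_Δ(δ) = {x ∈ X : Δ x = δ}`. -/
def levelSet (X : Set (EuclideanSpace ℝ (Fin d))) (Δ : EuclideanSpace ℝ (Fin d) → ℝ) (δ : ℝ) :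
    Set (EuclideanSpace ℝ (Fin d)) :=
  {x | x ∈ X ∧ Δ x = δ}

/-- The volume on `(d-1)`-dimensional submanifolds contained in `B`: the `(d-1)`-dimensional
Hausdorff measure, in the normalisation that agrees with Lebesgue measure on `ℝ^(d-1)`. -/
def surfaceVol (B : Set (EuclideanSpace ℝ (Fin d))) : Measure B :=
  Measure.euclideanHausdorffMeasure (d - 1)

/-- `∫_{M_Δ(δ)} G μ' / ‖∂Δ‖ dVol`. -/
def levelIntegral (X : Set (EuclideanSpace ℝ (Fin d))) (Δ : EuclideanSpace ℝ (Fin d) → ℝ)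
    (p G : B → ℝ) (δ : ℝ) : ℝ :=
  ∫ x in {x : B | x.1 ∈ levelSet X Δ δ}, G x * p x / ‖gradient Δ x.1‖ ∂(surfaceVol B)

/-- The density `f_{Δ,μ}(δ) = ∫_{M_Δ(δ)} μ' / ‖∂Δ‖ dVol`. -/
def density (X : Set (EuclideanSpace ℝ (Fin d))) (Δ : EuclideanSpace ℝ (Fin d) → ℝ)
    (p : B → ℝ) (δ : ℝ) : ℝ :=
  levelIntegral X Δ p (fun _ => 1) δ

/-- `𝒰 = {u ∈ [0,1] : Δ*_μ(u) ∈ 𝒟, f_{Δ,μ}(Δ*_μ(u)) > ε}`. Boundedness below excludes `u = 0`,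
where the infimum defining `Δ*_μ(u)` is `-∞`, so that it is not in `𝒟`. -/
def quantileIndices (X : Set (EuclideanSpace ℝ (Fin d))) (Δ : EuclideanSpace ℝ (Fin d) → ℝ)
    (μ : Measure B) (p : B → ℝ) (𝒟 : Set ℝ) (ε : ℝ) : Set ℝ :=
  {u | u ∈ Icc (0 : ℝ) 1 ∧ BddBelow {δ | u ≤ cdf μ Δ δ} ∧
    sorted μ Δ u ∈ 𝒟 ∧ ε < density X Δ p (sorted μ Δ u)}

/-- `(G, H) ↦ -∫_{M_Δ(δ)} G μ' / ‖∂Δ‖ dVol + H(1{Δ ≤ δ})`. -/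
def cdfDeriv (X : Set (EuclideanSpace ℝ (Fin d))) (Δ : EuclideanSpace ℝ (Fin d) → ℝ)
    (p : B → ℝ) {μ : Measure B} {ℱ : Set (contSpace B)} {𝒱 : Set ℝ} (δ : ℝ)
    (h : DSpace μ ℱ 𝒱) : ℝ :=
  -levelIntegral X Δ p (toFn h.1) δ + evalOp h.2 (ind (B.domRestrict Δ) δ)

/-- `(G, H) ↦ -∂F_{Δ,μ}(Δ*_μ(u))[G, H] / f_{Δ,μ}(Δ*_μ(u))`. -/
def sortDeriv (X : Set (EuclideanSpace ℝ (Fin d))) (Δ : EuclideanSpace ℝ (Fin d) → ℝ)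
    (p : B → ℝ) {μ : Measure B} {ℱ : Set (contSpace B)} {𝒱 : Set ℝ} (u : ℝ)
    (h : DSpace μ ℱ 𝒱) : ℝ :=
  -(cdfDeriv X Δ p (sorted μ Δ u) h / density X Δ p (sorted μ Δ u))

end Level

end

end SortedEffects

/-! Everything rests on one derivative: for continuous `f` with compact support, the integral of `f`
over `{Δ ≤ δ}` has derivative `∫ f / ‖∂Δ‖` over `{Δ = δ}` at a regular value. Near a regular point,
`exists_chart` straightens `Δ` into a linear function by a map that is bi-Lipschitz with constant
`K` close to one. For a linear function the claim is Fubini (`hasDerivAt_setIntegral_inner_le`).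
Hausdorff integrals, Jacobians and gradients are distorted only by powers of `K`, so a local
derivative exists and equals the surface integral up to a factor `κ`. A partition of unity makes
this global, and since derivatives are unique, `κ → 1` gives equality without an area formula for
submanifolds. Continuity of the level integral in `δ` comes along.

For (a), linearity in `H` splits the perturbed value into `μ{Δ + t Gₙ ≤ δ}` plus `t Hₙ(1{Δ + t Gₙ ≤
δ})`. In the first term (`eventually_abs_lowerIntegral_sub_le`) a partition of unity makes `G`
almost constant on each piece, where the perturbed sublevel set lies between two unperturbed ones at
levels shifted by about `-t G`; the derivative above then applies, uniformly on compact sets. In the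
second, indicators that differ only where `Δ` is close to `δ` are close in `L²(μ)`, and `H` is
uniformly continuous there (`exists_evalOp_modulus`).

For (b), `eventually_sInf_expansion` inverts the expansion of (a) on a compact neighbourhood of `𝒟`:
as the slope exceeds `ε`, the level `u` is crossed within `o(t)` of the predicted point. A crude
bound valid on all of `𝒱` (`exists_eventually_cdfOp_le`) excludes earlier crossings. -/

namespace SortedEffects

/-! ### Slicing by parallel hyperplanes -/

section Slicing

open Module

lemma inner_smul_add_orthogonal {V : Type*} [NormedAddCommGroup V] [InnerProductSpace ℝ V]
    {v : V} (hv : ‖v‖ = 1) (s : ℝ) (w : (ℝ ∙ v)ᗮ) :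
    inner ℝ v (s • v + (w : V)) = s := by
  have hw : inner ℝ v (w : V) = 0 := Submodule.mem_orthogonal_singleton_iff_inner_right.1 w.2
  rw [inner_add_right, inner_smul_right, real_inner_self_eq_norm_sq, hv, hw]; ring

/-- By Pythagoras `w` is no longer than `s • v + w`, so one radius serves every height `s`. -/
lemma exists_forall_notMem_closedBall_eq_zero {V : Type*} [NormedAddCommGroup V]
    [InnerProductSpace ℝ V] (v : V) {h : V → ℝ}
    (hs : HasCompactSupport h) :
    ∃ R : ℝ, ∀ s : ℝ, ∀ w : (ℝ ∙ v)ᗮ, w ∉ Metric.closedBall 0 R → h (s • v + (w : V)) = 0 := by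
  obtain ⟨R, hR⟩ := hs.isCompact.isBounded.subset_closedBall 0
  refine ⟨R, fun s w hw => by_contra fun hne => hw ?_⟩
  have h1 := hR (subset_tsupport _ hne)
  have h0 : inner ℝ v (w : V) = 0 := Submodule.mem_orthogonal_singleton_iff_inner_right.1 w.2
  have h2 : ‖s • v + (w : V)‖ * ‖s • v + (w : V)‖ = ‖s • v‖ * ‖s • v‖ + ‖(w : V)‖ * ‖(w : V)‖ :=
    norm_add_sq_eq_norm_sq_add_norm_sq_of_inner_eq_zero _ _ (by rw [inner_smul_left, h0, mul_zero])
  rw [mem_closedBall_zero_iff] at h1 ⊢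
  have h3 : ‖(w : V)‖ ≤ ‖s • v + (w : V)‖ :=
    abs_le_of_sq_le_sq' (by nlinarith [mul_self_nonneg ‖s • v‖]) (norm_nonneg _) |>.2
  exact h3.trans h1

variable {V : Type*} [NormedAddCommGroup V] [InnerProductSpace ℝ V] [FiniteDimensional ℝ V]
  [MeasurableSpace V] [BorelSpace V]

/-- The integral of `h` over the hyperplane at height `s` in the direction `v`. -/
noncomputable def sliceIntegral (v : V) (h : V → ℝ) (s : ℝ) : ℝ :=
  ∫ w : (ℝ ∙ v)ᗮ, h (s • v + (w : V))

/-- The orthogonal splitting of `V` preserves volume, and a unit vector identifies its line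
isometrically with `ℝ`. -/
lemma measurePreserving_smul_add {v : V} (hv : ‖v‖ = 1) :
    MeasurePreserving (fun q : ℝ × (ℝ ∙ v)ᗮ => q.1 • v + (q.2 : V)) volume volume := by
  have h1 := (Submodule.measurePreserving_measurableEquivProd (ℝ ∙ v) (0 : V)).symm
  rw [InnerProductSpace.euclideanHausdorffMeasure_eq_volume] at h1
  have h2 : MeasurePreserving (LinearIsometryEquiv.toSpanUnitSingleton v hv) volume volume :=
    LinearIsometryEquiv.measurePreserving _
  have h3 := h2.prod (MeasurePreserving.id (volume : Measure (ℝ ∙ v)ᗮ))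
  convert! h1.comp h3 using 1
  ext q
  simp

lemma measurableEmbedding_smul_add {v : V} (hv : ‖v‖ = 1) :
    MeasurableEmbedding (fun q : ℝ × (ℝ ∙ v)ᗮ => q.1 • v + (q.2 : V)) := by
  have h : Continuous (fun q : ℝ × (ℝ ∙ v)ᗮ => q.1 • v + (q.2 : V)) := by fun_prop
  refine h.measurableEmbedding fun q q' hq => ?_
  have h1 := congrArg (inner ℝ v) hq
  simp only [inner_smul_add_orthogonal hv] at h1
  have h2 : q.1 • v + (q.2 : V) = q'.1 • v + (q'.2 : V) := hq
  rw [h1, add_right_inj] at h2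
  exact Prod.ext h1 (Subtype.ext h2)

/-- All slices can be integrated over the same compact ball, where continuous dependence on the
parameter is standard. -/
lemma continuous_sliceIntegral (v : V) {h : V → ℝ} (hc : Continuous h)
    (hs : HasCompactSupport h) : Continuous (sliceIntegral v h) := by
  obtain ⟨R, hR⟩ := exists_forall_notMem_closedBall_eq_zero v hs
  have h1 : sliceIntegral v h =
      fun s => ∫ w in Metric.closedBall (0 : (ℝ ∙ v)ᗮ) R, h (s • v + (w : V)) := by
    ext s
    exact (setIntegral_eq_integral_of_forall_compl_eq_zero fun w hw => hR s w hw).symm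
  rw [h1]
  exact continuous_parametric_integral_of_continuous (by fun_prop) (isCompact_closedBall _ _)

/-- In the coordinates `s • v + w` the half-space is a product, so Fubini leaves a one-variable
integral of the continuous slice function and the fundamental theorem of calculus applies. -/
lemma hasDerivAt_setIntegral_inner_le {v : V} (hv : ‖v‖ = 1) {h : V → ℝ} (hc : Continuous h)
    (hs : HasCompactSupport h) (s : ℝ) :
    HasDerivAt (fun s => ∫ z in {z | inner ℝ v z ≤ s}, h z) (sliceIntegral v h s) s := by
  have hmp := measurePreserving_smul_add hv
  have hme := measurableEmbedding_smul_add hv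
  have hint : Integrable (fun q : ℝ × (ℝ ∙ v)ᗮ => h (q.1 • v + (q.2 : V)))
      (volume.prod volume) :=
    (hmp.integrable_comp_emb hme).2 (hc.integrable_of_hasCompactSupport hs)
  have key : ∀ s, ∫ z in {z | inner ℝ v z ≤ s}, h z = ∫ t in Iic s, sliceIntegral v h t := by
    intro s
    rw [← hmp.setIntegral_preimage_emb hme]
    have : (fun q : ℝ × (ℝ ∙ v)ᗮ => q.1 • v + (q.2 : V)) ⁻¹' {z | inner ℝ v z ≤ s} =
        Iic s ×ˢ univ := by
      ext q
      simp [inner_smul_add_orthogonal hv]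
    rw [this, Measure.volume_eq_prod, setIntegral_prod _ hint.integrableOn]
    simp [sliceIntegral]
  have hJ : Integrable (sliceIntegral v h) := hint.integral_prod_left
  have hJc := continuous_sliceIntegral v hc hs
  simp only [key]
  have h2 : (fun s => ∫ t in Iic s, sliceIntegral v h t) =
      fun s => (∫ t in Iic (0 : ℝ), sliceIntegral v h t) + ∫ t in (0 : ℝ)..s, sliceIntegral v h t := by
    ext s
    rw [← intervalIntegral.integral_Iic_sub_Iic hJ.integrableOn hJ.integrableOn]; ring
  rw [h2]
  exact (intervalIntegral.integral_hasDerivAt_right (hJc.intervalIntegrable _ _)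
    (hJc.stronglyMeasurableAtFilter _ _) hJc.continuousAt).const_add _

/-- The hyperplane is an isometric copy of `(ℝ ∙ v)ᗮ`, on which the normalised Hausdorff measure is
Lebesgue measure. This identifies the derivative in the linear model with a surface integral. -/
lemma lintegral_inner_eq {v : V} (hv : ‖v‖ = 1) {h : V → ℝ} (hc : Continuous h)
    (hs : HasCompactSupport h) (h0 : ∀ x, 0 ≤ h x) (s : ℝ) :
    ∫⁻ z in {z | inner ℝ v z = s}, ENNReal.ofReal (h z) ∂μHE[finrank ℝ V - 1] =
      ENNReal.ofReal (sliceIntegral v h s) := by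
  have hi : Isometry (fun w : (ℝ ∙ v)ᗮ => s • v + (w : V)) :=
    (IsometryEquiv.addLeft (s • v)).isometry.comp (Submodule.subtypeₗᵢ _).isometry
  have hrange : range (fun w : (ℝ ∙ v)ᗮ => s • v + (w : V)) = {z | inner ℝ v z = s} := by
    ext z
    constructor
    · rintro ⟨w, rfl⟩
      exact inner_smul_add_orthogonal hv s w
    · intro hz
      refine ⟨⟨z - s • v, Submodule.mem_orthogonal_singleton_iff_inner_right.2 ?_⟩, by simp⟩
      rw [inner_sub_right, inner_smul_right, real_inner_self_eq_norm_sq, hv, hz]; ring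
  have hrank : finrank ℝ (ℝ ∙ v)ᗮ = finrank ℝ V - 1 := by
    have h1 := (ℝ ∙ v).finrank_add_finrank_orthogonal
    have hv0 : v ≠ 0 := fun h => by simp [h] at hv
    rw [finrank_span_singleton hv0] at h1
    omega
  have hme : MeasurableEmbedding (fun w : (ℝ ∙ v)ᗮ => s • v + (w : V)) :=
    hi.continuous.measurableEmbedding hi.injective
  rw [← hrange, ← hi.map_euclideanHausdorffMeasure, hme.lintegral_map, ← hrank,
    InnerProductSpace.euclideanHausdorffMeasure_eq_volume, sliceIntegral,
    ofReal_integral_eq_lintegral_ofReal]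
  · obtain ⟨R, hR⟩ := exists_forall_notMem_closedBall_eq_zero v hs
    refine Continuous.integrable_of_hasCompactSupport (hc.comp hi.continuous) ?_
    exact HasCompactSupport.intro (isCompact_closedBall 0 R) fun w hw => hR s w hw
  · exact Eventually.of_forall fun w => h0 _

end Slicing

/-! ### Hausdorff integrals under Lipschitz maps -/

section Lipschitz

variable {Y Z : Type*} [EMetricSpace Y] [MeasurableSpace Y] [BorelSpace Y]
  [EMetricSpace Z] [MeasurableSpace Z] [BorelSpace Z]

/-- The normalising constant depends only on `m`, not on the space, so the bound for the
unnormalised measure carries over. -/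
lemma _root_.LipschitzOnWith.euclideanHausdorffMeasure_image_le {K : NNReal} {Φ : Y → Z}
    {S : Set Y} (h : LipschitzOnWith K Φ S) (m : ℕ) :
    μHE[m] (Φ '' S) ≤ (K : ℝ≥0∞) ^ m * μHE[m] S := by
  simp only [Measure.euclideanHausdorffMeasure_def, Measure.smul_apply]
  have h1 := h.hausdorffMeasure_image_le (d := (m : ℝ)) (by positivity)
  rw [ENNReal.rpow_natCast] at h1
  rw [ENNReal.smul_def, ENNReal.smul_def, smul_eq_mul, smul_eq_mul, mul_left_comm]
  gcongr

/-- Measures of images bound the restricted measure by `K ^ m` times a pushforward. Only an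
inequality is needed when integrating against the pushforward, so `k` need not be measurable. -/
lemma _root_.LipschitzOnWith.lintegral_image_euclideanHausdorffMeasure_le {K : NNReal} {Φ : Y → Z}
    {S : Set Y} (h : LipschitzOnWith K Φ S) (hS : MeasurableSet S) [SecondCountableTopologyEither Y Z]
    [TopologicalSpace.PseudoMetrizableSpace Z]
    (m : ℕ) (k : Z → ℝ≥0∞) :
    ∫⁻ z in Φ '' S, k z ∂μHE[m] ≤ (K : ℝ≥0∞) ^ m * ∫⁻ x in S, k (Φ x) ∂μHE[m] := by
  have hae : AEMeasurable Φ ((μHE[m] : Measure Y).restrict S) := h.continuousOn.aemeasurable hS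
  have hle : (μHE[m] : Measure Z).restrict (Φ '' S) ≤
      (K : ℝ≥0∞) ^ m • Measure.map Φ ((μHE[m] : Measure Y).restrict S) := by
    refine Measure.le_iff.2 fun A hA => ?_
    rw [Measure.restrict_apply hA, Measure.smul_apply, smul_eq_mul,
      Measure.map_apply_of_aemeasurable hae hA, Measure.restrict_apply' hS]
    have : A ∩ Φ '' S = Φ '' (Φ ⁻¹' A ∩ S) := by
      rw [inter_comm, inter_comm _ S, image_inter_preimage]
    rw [this]
    exact (h.mono inter_subset_right).euclideanHausdorffMeasure_image_le m
  calc ∫⁻ z in Φ '' S, k z ∂μHE[m]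
      ≤ ∫⁻ z, k z ∂((K : ℝ≥0∞) ^ m • Measure.map Φ ((μHE[m] : Measure Y).restrict S)) :=
        lintegral_mono' hle le_rfl
    _ = (K : ℝ≥0∞) ^ m * ∫⁻ z, k z ∂(Measure.map Φ ((μHE[m] : Measure Y).restrict S)) := by
        rw [lintegral_smul_measure, smul_eq_mul]
    _ ≤ _ := by
        gcongr
        exact lintegral_map_le _ _
end Lipschitz

/-! ### Almost isometric charts that straighten `Δ` -/

section Chart

variable {V : Type*} [NormedAddCommGroup V] [InnerProductSpace ℝ V] [FiniteDimensional ℝ V]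

lemma norm_gradient (Δ : V → ℝ) (x : V) : ‖gradient Δ x‖ = ‖fderiv ℝ Δ x‖ := by
  simp [gradient]

lemma continuousOn_norm_gradient {B : Set V} (hB : IsOpen B) {Δ : V → ℝ}
    (hΔ : ContDiffOn ℝ 1 Δ B) : ContinuousOn (fun x => ‖gradient Δ x‖) B := by
  simp only [norm_gradient]
  exact (hΔ.continuousOn_fderiv_of_isOpen hB le_rfl).norm

/-- Near a point where the gradient of `Δ` does not vanish, `Δ` is a linear function in a chart
that is, together with its inverse, Lipschitz with a constant close to one. -/
lemma exists_chart {B : Set V} (hB : IsOpen B) {Δ : V → ℝ} (hΔ : ContDiffOn ℝ 1 Δ B) {x₀ : V}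
    (hx₀ : x₀ ∈ B) (hg : gradient Δ x₀ ≠ 0) {K : NNReal} (hK : 1 < K) :
    ∃ (Φ : OpenPartialHomeomorph V V) (v : V) (Φ' : V → V →L[ℝ] V),
      ‖v‖ = 1 ∧ x₀ ∈ Φ.source ∧ Φ.source ⊆ B ∧
      (∀ x ∈ Φ.source, inner ℝ v (Φ x) * ‖gradient Δ x₀‖ = Δ x) ∧
      LipschitzOnWith K Φ Φ.source ∧ LipschitzOnWith K Φ.symm Φ.target ∧
      ContinuousOn Φ' Φ.source ∧
      ∀ x ∈ Φ.source, HasFDerivAt Φ (Φ' x) x ∧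
        1 ≤ K * |(Φ' x).det| ∧ |(Φ' x).det| ≤ K ∧
        ‖gradient Δ x‖ ≤ K * ‖gradient Δ x₀‖ ∧ ‖gradient Δ x₀‖ ≤ K * ‖gradient Δ x‖ := by
  have hnt : Nontrivial V := ⟨⟨_, _, hg⟩⟩
  set n := gradient Δ x₀ with hn
  set a := ‖n‖ with ha
  have ha0 : 0 < a := norm_pos_iff.2 hg
  set v : V := a⁻¹ • n with hv
  have hvn : ‖v‖ = 1 := by
    rw [hv, norm_smul, norm_inv, Real.norm_of_nonneg ha0.le, ← ha, inv_mul_cancel₀ ha0.ne']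
  have hvi : ∀ x, inner ℝ n x = a * inner ℝ v x := fun x => by
    rw [hv, real_inner_smul_left, mul_inv_cancel_left₀ ha0.ne']
  have hKr : (1 : ℝ) < K := by exact_mod_cast hK
  -- The identity is corrected along `v` by the nonlinear part of `Δ`. This makes `⟨v, φ x⟩ = Δ x /
  -- a` exactly, while the derivative at `x₀` is still the identity.
  set φ : V → V := fun x => x + (a⁻¹ * (Δ x - inner ℝ n x)) • v with hφ
  set φ' : V → V →L[ℝ] V := fun x =>
    ContinuousLinearMap.id ℝ V + (a⁻¹ • (fderiv ℝ Δ x - innerSL ℝ n)).smulRight v with hφ'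
  have hcd : ∀ x ∈ B, ContDiffAt ℝ 1 Δ x := fun x hx => hΔ.contDiffAt (hB.mem_nhds hx)
  have hstrict : ∀ x ∈ B, HasStrictFDerivAt φ (φ' x) x := by
    intro x hx
    have h1 : HasStrictFDerivAt Δ (fderiv ℝ Δ x) x := (hcd x hx).hasStrictFDerivAt one_ne_zero
    have h2 : HasStrictFDerivAt (fun x => inner ℝ n x) (innerSL ℝ n) x :=
      (innerSL ℝ n).hasStrictFDerivAt
    exact (hasStrictFDerivAt_id x).add (((h1.sub h2).const_mul a⁻¹).smul_const v)
  have hid : φ' x₀ = ContinuousLinearMap.id ℝ V := by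
    have : fderiv ℝ Δ x₀ - innerSL ℝ n = 0 := by
      ext x
      simp [hn, gradient]
    rw [hφ']
    simp only [this]
    ext; simp
  have hφ'c : ContinuousOn φ' B := by
    have h1 : ContinuousOn (fderiv ℝ Δ) B := hΔ.continuousOn_fderiv_of_isOpen hB le_rfl
    have h2 : ContinuousOn (fun x => a⁻¹ • (fderiv ℝ Δ x - innerSL ℝ n)) B :=
      ContinuousOn.const_smul (g := fun x => fderiv ℝ Δ x - innerSL ℝ n)
        (h1.sub continuousOn_const) a⁻¹
    have h3 : Continuous fun L : V →L[ℝ] ℝ => L.smulRight v :=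
      ((ContinuousLinearMap.smulRightL ℝ V V).flip v).continuous
    exact continuousOn_const.add (h3.comp_continuousOn h2)
  -- With this `c` the inverse has Lipschitz constant `(1 - c)⁻¹ = K`, and the map itself `1 + c = 2
  -- - K⁻¹ ≤ K`, which is `(K - 1)² ≥ 0`.
  set c : NNReal := 1 - K⁻¹ with hc
  have hKi : K⁻¹ < 1 := inv_lt_one_of_one_lt₀ hK
  have hK0 : K ≠ 0 := (zero_lt_one.trans hK).ne'
  have hc0 : 0 < c := tsub_pos_of_lt hKi
  have hstrict₀ : HasStrictFDerivAt φ
      ((ContinuousLinearEquiv.refl ℝ V : V ≃L[ℝ] V) : V →L[ℝ] V) x₀ := by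
    have := hstrict x₀ hx₀
    rwa [hid] at this
  obtain ⟨s, hs, happ⟩ := hstrict₀.approximates_deriv_on_nhds (Or.inr hc0)
  have hdetc : ContinuousAt (fun x => |(φ' x).det|) x₀ :=
    (ContinuousLinearMap.continuous_det.continuousAt.comp
      (hφ'c.continuousAt (hB.mem_nhds hx₀))).abs
  have hdet₀ : |(φ' x₀).det| = 1 := by
    rw [hid]; simp [ContinuousLinearMap.det]
  have hgc : ContinuousAt (fun x => ‖gradient Δ x‖) x₀ :=
    (continuousOn_norm_gradient hB hΔ).continuousAt (hB.mem_nhds hx₀)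
  have e1 : ∀ᶠ x in 𝓝 x₀, 1 < K * |(φ' x).det| :=
    (hdetc.const_mul (K : ℝ)).eventually_const_lt (by simpa only [hdet₀, mul_one] using hKr)
  have e2 : ∀ᶠ x in 𝓝 x₀, |(φ' x).det| < K := hdetc.eventually_lt_const (by simpa only [hdet₀] using hKr)
  have e3 : ∀ᶠ x in 𝓝 x₀, ‖gradient Δ x‖ < K * a :=
    hgc.eventually_lt_const (lt_mul_of_one_lt_left ha0 hKr)
  have e4 : ∀ᶠ x in 𝓝 x₀, a < K * ‖gradient Δ x‖ :=
    (hgc.const_mul (K : ℝ)).eventually_const_lt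
      (lt_mul_of_one_lt_left ha0 hKr)
  obtain ⟨U, hU, hUo, hxU⟩ := mem_nhds_iff.1 (inter_mem (inter_mem hs (hB.mem_nhds hx₀))
    (e1.and (e2.and (e3.and e4))))
  have happU := happ.mono_set (t := s) (s := U) fun x hx => (hU hx).1.1
  have hcN : Subsingleton V ∨ c <
      ‖((ContinuousLinearEquiv.refl ℝ V).symm : V →L[ℝ] V)‖₊⁻¹ := by
    right
    have : ‖((ContinuousLinearEquiv.refl ℝ V).symm : V →L[ℝ] V)‖₊ = 1 := by
      ext; exact ContinuousLinearMap.norm_id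
    rw [this, inv_one]
    exact tsub_lt_self one_pos (by positivity)
  refine ⟨happU.toOpenPartialHomeomorph φ U hcN hUo, v, φ', hvn, hxU, fun x hx => (hU hx).1.2,
    fun x hx => ?_, ?_, ?_, hφ'c.mono fun x hx => (hU hx).1.2, fun x hx => ⟨?_, ?_⟩⟩
  · have : φ x = x + (a⁻¹ * (Δ x - inner ℝ n x)) • v := rfl
    rw [ApproximatesLinearOn.toOpenPartialHomeomorph_coe, this, inner_add_right,
      inner_smul_right, real_inner_self_eq_norm_sq, hvn, hvi]
    field_simp
    ring
  · have h1 := happU.lipschitz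
    rw [← lipschitzOnWith_iff_restrict] at h1
    refine h1.weaken ?_
    have : ‖((ContinuousLinearEquiv.refl ℝ V) : V →L[ℝ] V)‖₊ = 1 := by
      ext; exact ContinuousLinearMap.norm_id
    rw [this, ← NNReal.coe_le_coe, hc, NNReal.coe_add, NNReal.coe_sub hKi.le, NNReal.coe_inv,
      NNReal.coe_one]
    have : (K : ℝ) * (K : ℝ)⁻¹ = 1 := mul_inv_cancel₀ (by positivity)
    have h3 : (0 : ℝ) < (K : ℝ)⁻¹ := by positivity
    nlinarith [mul_nonneg h3.le (sq_nonneg ((K : ℝ) - 1))]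
  · have h1 := happU.antilipschitz hcN
    have h2 : (‖((ContinuousLinearEquiv.refl ℝ V).symm : V →L[ℝ] V)‖₊⁻¹ - c)⁻¹ = K := by
      have : ‖((ContinuousLinearEquiv.refl ℝ V).symm : V →L[ℝ] V)‖₊ = 1 := by
        ext; exact ContinuousLinearMap.norm_id
      rw [this, inv_one, hc, tsub_tsub_cancel_of_le hKi.le, inv_inv]
    rw [h2] at h1
    refine LipschitzOnWith.of_dist_le_mul fun y hy z hz => ?_
    set Φ := happU.toOpenPartialHomeomorph φ U hcN hUo
    have h3 := h1.le_mul_dist ⟨Φ.symm y, Φ.map_target hy⟩ ⟨Φ.symm z, Φ.map_target hz⟩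
    have hy' : φ (Φ.symm y) = y := Φ.right_inv hy
    have hz' : φ (Φ.symm z) = z := Φ.right_inv hz
    simpa only [Subtype.dist_eq, domRestrict_apply, hy', hz'] using h3
  · exact (hstrict x (hU hx).1.2).hasFDerivAt
  · obtain ⟨h1, h2, h3, h4⟩ := (hU hx).2
    exact ⟨h1.le, h2.le, h3.le, h4.le⟩

end Chart
-- Measurability of level sets and transport of functions through a chart
lemma measurableSet_setOf_mem_and_le {V : Type*} [TopologicalSpace V] [MeasurableSpace V]
    [BorelSpace V] {B : Set V} (hB : IsOpen B) {g : V → ℝ}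
    (hg : ContinuousOn g B) (δ : ℝ) : MeasurableSet {x | x ∈ B ∧ g x ≤ δ} := by
  obtain ⟨C, hC, h⟩ := (continuousOn_iff_isClosed.1 hg) (Iic δ) isClosed_Iic
  have : {x | x ∈ B ∧ g x ≤ δ} = C ∩ B := by
    rw [← h]; ext x; simp [and_comm]
  rw [this]
  exact hC.measurableSet.inter hB.measurableSet

lemma measurableSet_setOf_mem_and_eq {V : Type*} [TopologicalSpace V] [MeasurableSpace V]
    [BorelSpace V] {B : Set V} (hB : IsOpen B) {g : V → ℝ}
    (hg : ContinuousOn g B) (δ : ℝ) : MeasurableSet {x | x ∈ B ∧ g x = δ} := by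
  obtain ⟨C, hC, h⟩ := (continuousOn_iff_isClosed.1 hg) {δ} isClosed_singleton
  have : {x | x ∈ B ∧ g x = δ} = C ∩ B := by
    rw [← h]; ext x; simp [and_comm]
  rw [this]
  exact hC.measurableSet.inter hB.measurableSet

/-- The transport of `f` to the target of a chart, extended by zero. -/
lemma exists_continuous_extension {V : Type*} [TopologicalSpace V] [T2Space V]
    {Φ : OpenPartialHomeomorph V V} {f : V → ℝ}
    (hf : ContinuousOn f Φ.source) {C : Set V} (hC : IsCompact C) (hCs : C ⊆ Φ.source)
    (hfC : ∀ x ∈ Φ.source, x ∉ C → f x = 0) :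
    ∃ h : V → ℝ, Continuous h ∧ HasCompactSupport h ∧ (∀ x ∈ Φ.source, h (Φ x) = f x) ∧
      ∀ z ∉ Φ.target, h z = 0 := by
  classical
  have hCc : IsCompact (Φ '' C) := hC.image_of_continuousOn (Φ.continuousOn.mono hCs)
  have hsub : Φ '' C ⊆ Φ.target := by
    rintro _ ⟨x, hx, rfl⟩
    exact Φ.map_source (hCs hx)
  set h : V → ℝ := fun z => if z ∈ Φ.target then f (Φ.symm z) else 0 with hh
  have h0 : ∀ z ∉ Φ '' C, h z = 0 := by
    intro z hz
    by_cases hzt : z ∈ Φ.target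
    · rw [hh]
      simp only [if_pos hzt]
      exact hfC _ (Φ.map_target hzt) fun hc => hz ⟨_, hc, Φ.right_inv hzt⟩
    · simp [hh, hzt]
  refine ⟨h, ?_, HasCompactSupport.intro hCc h0, fun x hx => ?_, fun z hz => by simp [hh, hz]⟩
  · refine continuous_iff_continuousAt.2 fun z => ?_
    -- Two open sets cover the space: the target, where `h` is a composition of continuous maps, and
    -- the complement of the compact set `Φ '' C`, where `h` is zero.
    by_cases hz : z ∈ Φ '' C
    · have hzt := hsub hz
      have h1 : ContinuousOn (fun z => f (Φ.symm z)) Φ.target :=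
        hf.comp Φ.continuousOn_symm fun y hy => Φ.map_target hy
      refine (h1.continuousAt (Φ.open_target.mem_nhds hzt)).congr ?_
      filter_upwards [Φ.open_target.mem_nhds hzt] with y hy
      simp [hh, hy]
    · refine (continuousAt_const (y := (0 : ℝ))).congr ?_
      filter_upwards [hCc.isClosed.isOpen_compl.mem_nhds hz] with y hy
      exact (h0 y hy).symm
  · simp [hh, Φ.map_source hx, Φ.left_inv hx]

/-! ### The derivative near a regular point, up to a factor -/

section LevelIntegrals

open Module

variable {V : Type*} [NormedAddCommGroup V] [InnerProductSpace ℝ V] [FiniteDimensional ℝ V]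
  [MeasurableSpace V] [BorelSpace V]

/-- The integral of `f` over `{x ∈ B : Δ x ≤ δ}`. -/
noncomputable def lowerIntegral (B : Set V) (Δ f : V → ℝ) (δ : ℝ) : ℝ :=
  ∫ x in {x | x ∈ B ∧ Δ x ≤ δ}, f x

/-- The integral of `f / ‖∂Δ‖` over the level set `{x ∈ B : Δ x = δ}`. -/
noncomputable def levelLIntegral (B : Set V) (Δ f : V → ℝ) (δ : ℝ) : ℝ≥0∞ :=
  ∫⁻ x in {x | x ∈ B ∧ Δ x = δ}, ENNReal.ofReal (f x / ‖gradient Δ x‖) ∂μHE[finrank ℝ V - 1]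

/-- Near a regular point, the distribution function of `f` along `Δ` is differentiable, and its
derivative is the integral over the level set, up to a factor close to one. -/
lemma exists_hasDerivAt_lowerIntegral_near {B : Set V} (hB : IsOpen B) {Δ : V → ℝ}
    (hΔ : ContDiffOn ℝ 1 Δ B) {x₀ : V} (hx₀ : x₀ ∈ B) (hg : gradient Δ x₀ ≠ 0) {κ : NNReal}
    (hκ : 1 < κ) :
    ∃ U : Set V, IsOpen U ∧ x₀ ∈ U ∧ ∀ f : V → ℝ, Continuous f → HasCompactSupport f →
      tsupport f ⊆ U → (∀ x, 0 ≤ f x) → ∃ J : ℝ → ℝ, Continuous J ∧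
        ∀ δ, 0 ≤ J δ ∧ HasDerivAt (lowerIntegral B Δ f) (J δ) δ ∧
          levelLIntegral B Δ f δ ≤ κ * ENNReal.ofReal (J δ) ∧
          ENNReal.ofReal (J δ) ≤ κ * levelLIntegral B Δ f δ := by
  set m := finrank ℝ V - 1 with hm
  -- The chart costs `K ^ m` in surface measure, one factor `K` in the Jacobian and one in the
  -- gradient.
  obtain ⟨K, hK1, hKκ⟩ : ∃ K : NNReal, 1 < K ∧ K ^ (m + 2) ≤ κ := by
    have hc : ContinuousAt (fun K : NNReal => K ^ (m + 2)) 1 := by fun_prop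
    have h1 : ∀ᶠ K in 𝓝 (1 : NNReal), K ^ (m + 2) < κ :=
      hc.eventually_lt_const (by simpa using hκ)
    obtain ⟨K, h2, h3⟩ := ((h1.filter_mono nhdsWithin_le_nhds).and
      (self_mem_nhdsWithin : Ioi (1 : NNReal) ∈ 𝓝[>] 1)).exists
    exact ⟨K, h3, h2.le⟩
  obtain ⟨Φ, v, Φ', hv, hxs, hsB, hΦΔ, hL1, hL2, hΦ'c, hΦ'⟩ := exists_chart hB hΔ hx₀ hg hK1
  have hK0 : (0 : ℝ) < K := zero_lt_one.trans (by exact_mod_cast hK1)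
  set a := ‖gradient Δ x₀‖ with ha
  have ha0 : 0 < a := norm_pos_iff.2 hg
  refine ⟨Φ.source, Φ.open_source, hxs, fun f hf hfc hfs hf0 => ?_⟩
  have hdet0 : ∀ x ∈ Φ.source, 0 < |(Φ' x).det| := fun x hx => by
    have := (hΦ' x hx).2.1
    exact pos_of_mul_pos_right (one_pos.trans_le this) hK0.le
  have hgr0 : ∀ x ∈ Φ.source, 0 < ‖gradient Δ x‖ := fun x hx => by
    have := (hΦ' x hx).2.2.2.2
    exact pos_of_mul_pos_right (ha0.trans_le this) hK0.le
  have hf00 : ∀ x ∉ Φ.source, f x = 0 := fun x hx =>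
    image_eq_zero_of_notMem_tsupport fun h => hx (hfs h)
  -- Dividing by the Jacobian beforehand makes the change of variables carry `f` exactly to `h`.
  have hfd : ContinuousOn (fun x => f x / |(Φ' x).det|) Φ.source :=
    hf.continuousOn.div (ContinuousLinearMap.continuous_det.comp_continuousOn hΦ'c).abs
      fun x hx => (hdet0 x hx).ne'
  obtain ⟨h, hhc, hhs, hhf, hh0⟩ := exists_continuous_extension hfd hfc hfs
    fun x _ hx => by rw [image_eq_zero_of_notMem_tsupport hx, zero_div]
  have hhn : ∀ z, 0 ≤ h z := fun z => by
    by_cases hz : z ∈ Φ.target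
    · rw [← Φ.right_inv hz, hhf _ (Φ.map_target hz)]
      exact div_nonneg (hf0 _) (abs_nonneg _)
    · rw [hh0 z hz]
  have hΔa : ∀ x ∈ Φ.source, inner ℝ v (Φ x) = Δ x / a := fun x hx => by
    rw [← hΦΔ x hx, mul_div_cancel_right₀ _ ha0.ne']
  -- Both integrands vanish off the chart domains, so the change of variables there yields the
  -- linear model exactly; factors of `K` enter only in the surface integrals.
  have hlow : ∀ δ, lowerIntegral B Δ f δ = ∫ z in {z | inner ℝ v z ≤ δ / a}, h z := by
    intro δ
    have hmB := measurableSet_setOf_mem_and_le hB hΔ.continuousOn δ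
    have hmv : MeasurableSet {z : V | inner ℝ v z ≤ δ / a} :=
      (isClosed_le (by fun_prop) continuous_const).measurableSet
    rw [lowerIntegral, ← integral_indicator hmB, ← integral_indicator hmv]
    rw [← setIntegral_eq_integral_of_forall_compl_eq_zero (s := Φ.source)
        (f := {x | x ∈ B ∧ Δ x ≤ δ}.indicator f),
      ← setIntegral_eq_integral_of_forall_compl_eq_zero (s := Φ.target)
        (f := {z | inner ℝ v z ≤ δ / a}.indicator h),
      ← Φ.image_source_eq_target,
      integral_image_eq_integral_abs_det_fderiv_smul volume Φ.open_source.measurableSet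
        (fun x hx => (hΦ' x hx).1.hasFDerivWithinAt) Φ.injOn]
    · refine setIntegral_congr_fun Φ.open_source.measurableSet fun x hx => ?_
      have hx1 : (x ∈ B ∧ Δ x ≤ δ) ↔ inner ℝ v (Φ x) ≤ δ / a := by
        rw [hΔa x hx, div_le_div_iff_of_pos_right ha0]
        exact and_iff_right (hsB hx)
      by_cases hx2 : inner ℝ v (Φ x) ≤ δ / a
      · rw [indicator_of_mem (show x ∈ {x | x ∈ B ∧ Δ x ≤ δ} from hx1.2 hx2),
          indicator_of_mem (show Φ x ∈ {z | inner ℝ v z ≤ δ / a} from hx2), hhf x hx, smul_eq_mul,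
          mul_div_cancel₀ _ (hdet0 x hx).ne']
      · rw [indicator_of_notMem (show x ∉ {x | x ∈ B ∧ Δ x ≤ δ} from fun h => hx2 (hx1.1 h)),
          indicator_of_notMem (show Φ x ∉ {z | inner ℝ v z ≤ δ / a} from hx2), smul_zero]
    · intro z hz
      rw [indicator_apply_eq_zero]
      exact fun _ => hh0 z hz
    · intro x hx
      rw [indicator_apply_eq_zero]
      exact fun _ => hf00 x hx
  refine ⟨fun δ => sliceIntegral v h (δ / a) / a,
    ((continuous_sliceIntegral v hhc hhs).comp (continuous_id.div_const a)).div_const a,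
    fun δ => ⟨div_nonneg (integral_nonneg fun w => hhn _) ha0.le, ?_, ?_⟩⟩
  · have h1 := (hasDerivAt_setIntegral_inner_le hv hhc hhs (δ / a)).comp δ
      ((hasDerivAt_id δ).div_const a)
    have h2 : lowerIntegral B Δ f =
        (fun s => ∫ z in {z | inner ℝ v z ≤ s}, h z) ∘ fun x => id x / a := by
      ext x; simp [hlow]
    rw [h2]
    convert! h1 using 1
    ring
  · set S := {x | x ∈ B ∧ Δ x = δ} ∩ Φ.source with hS
    have hSm : MeasurableSet S :=
      (measurableSet_setOf_mem_and_eq hB hΔ.continuousOn δ).inter Φ.open_source.measurableSet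
    set T := {z | inner ℝ v z = δ / a} ∩ Φ.target with hT
    have hvm : MeasurableSet {z : V | inner ℝ v z = δ / a} :=
      (isClosed_eq (by fun_prop) continuous_const).measurableSet
    have hTm : MeasurableSet T := hvm.inter Φ.open_target.measurableSet
    have hST : Φ '' S = T := by
      ext z
      constructor
      · rintro ⟨x, ⟨⟨-, hx1⟩, hx2⟩, rfl⟩
        exact ⟨by rw [mem_ofPred_eq, hΔa x hx2, hx1], Φ.map_source hx2⟩
      · rintro ⟨hz1, hz2⟩
        have hs := Φ.map_target hz2
        refine ⟨Φ.symm z, ⟨⟨hsB hs, ?_⟩, hs⟩, Φ.right_inv hz2⟩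
        rw [← hΦΔ _ hs, Φ.right_inv hz2, hz1, div_mul_cancel₀ _ ha0.ne']
    have hTS : Φ.symm '' T = S := by
      rw [← hST, image_image]
      refine (image_congr fun x hx => ?_).trans (image_id S)
      exact Φ.left_inv hx.2
    have hA : levelLIntegral B Δ f δ =
        ∫⁻ x in S, ENNReal.ofReal (f x / ‖gradient Δ x‖) ∂μHE[m] := by
      rw [levelLIntegral, hS, inter_comm, ← Measure.restrict_restrict Φ.open_source.measurableSet]
      refine (setLIntegral_eq_of_support_subset ?_).symm
      intro x hx
      by_contra hxs
      exact hx (by simp [hf00 x hxs])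
    have hJ : ENNReal.ofReal (sliceIntegral v h (δ / a)) =
        ∫⁻ z in T, ENNReal.ofReal (h z) ∂μHE[m] := by
      rw [← lintegral_inner_eq hv hhc hhs hhn, hT, inter_comm,
        ← Measure.restrict_restrict Φ.open_target.measurableSet]
      refine (setLIntegral_eq_of_support_subset ?_).symm
      intro z hz
      by_contra hzs
      exact hz (by simp [hh0 z hzs])
    have hκ' : (K : ℝ≥0∞) ^ (m + 2) ≤ κ := by exact_mod_cast hKκ
    have hJa : ENNReal.ofReal (sliceIntegral v h (δ / a) / a) =
        ENNReal.ofReal a⁻¹ * ∫⁻ z in T, ENNReal.ofReal (h z) ∂μHE[m] := by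
      rw [← hJ, ← ENNReal.ofReal_mul (by positivity), div_eq_inv_mul]
    have hKo : (K : ℝ≥0∞) = ENNReal.ofReal K := by simp
    rw [hJa, hA]
    constructor
    · calc ∫⁻ x in S, ENNReal.ofReal (f x / ‖gradient Δ x‖) ∂μHE[m]
          = ∫⁻ x in Φ.symm '' T, ENNReal.ofReal (f x / ‖gradient Δ x‖) ∂μHE[m] := by rw [hTS]
        _ ≤ (K : ℝ≥0∞) ^ m *
            ∫⁻ z in T, ENNReal.ofReal (f (Φ.symm z) / ‖gradient Δ (Φ.symm z)‖) ∂μHE[m] :=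
          (hL2.mono inter_subset_right).lintegral_image_euclideanHausdorffMeasure_le hTm m _
        _ ≤ (K : ℝ≥0∞) ^ m *
            ∫⁻ z in T, (K : ℝ≥0∞) ^ 2 * ENNReal.ofReal a⁻¹ * ENNReal.ofReal (h z) ∂μHE[m] := by
          refine mul_le_mul' le_rfl (setLIntegral_mono' hTm fun z hz => ?_)
          have hs := Φ.map_target hz.2
          rw [hKo, ← ENNReal.ofReal_pow hK0.le, ← ENNReal.ofReal_mul (by positivity),
            ← ENNReal.ofReal_mul (by positivity)]
          refine ENNReal.ofReal_le_ofReal ?_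
          have e1 : h z = f (Φ.symm z) / |(Φ' (Φ.symm z)).det| := by
            rw [← hhf _ hs, Φ.right_inv hz.2]
          obtain ⟨-, -, d2, -, d4⟩ := hΦ' _ hs
          have p1 := hdet0 _ hs
          have p2 := hgr0 _ hs
          rw [e1, div_eq_mul_inv, div_eq_mul_inv, mul_comm (_ * _) (_ * _), mul_assoc]
          refine mul_le_mul_of_nonneg_left ?_ (hf0 _)
          rw [inv_le_iff_one_le_mul₀ p2]
          field_simp
          nlinarith [mul_le_mul d2 d4 ha0.le hK0.le]
        _ = (K : ℝ≥0∞) ^ (m + 2) *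
            (ENNReal.ofReal a⁻¹ * ∫⁻ z in T, ENNReal.ofReal (h z) ∂μHE[m]) := by
          rw [lintegral_const_mul _ (by fun_prop)]
          ring
        _ ≤ _ := by gcongr
    · have hfin : (K : ℝ≥0∞) ^ 2 * ENNReal.ofReal a ≠ ⊤ := by finiteness
      calc ENNReal.ofReal a⁻¹ * ∫⁻ z in T, ENNReal.ofReal (h z) ∂μHE[m]
          = ENNReal.ofReal a⁻¹ * ∫⁻ z in Φ '' S, ENNReal.ofReal (h z) ∂μHE[m] := by rw [hST]
        _ ≤ ENNReal.ofReal a⁻¹ * ((K : ℝ≥0∞) ^ m *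
            ∫⁻ x in S, ENNReal.ofReal (h (Φ x)) ∂μHE[m]) := by
          gcongr
          exact (hL1.mono inter_subset_right).lintegral_image_euclideanHausdorffMeasure_le hSm m _
        _ ≤ ENNReal.ofReal a⁻¹ * ((K : ℝ≥0∞) ^ m *
            ∫⁻ x in S, (K : ℝ≥0∞) ^ 2 * ENNReal.ofReal a *
              ENNReal.ofReal (f x / ‖gradient Δ x‖) ∂μHE[m]) := by
          refine mul_le_mul' le_rfl (mul_le_mul' le_rfl (setLIntegral_mono' hSm fun x hx => ?_))
          rw [hKo, ← ENNReal.ofReal_pow hK0.le, ← ENNReal.ofReal_mul (by positivity),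
            ← ENNReal.ofReal_mul (by positivity)]
          refine ENNReal.ofReal_le_ofReal ?_
          obtain ⟨-, d1, -, d3, -⟩ := hΦ' _ hx.2
          have p1 := hdet0 _ hx.2
          have p2 := hgr0 _ hx.2
          rw [hhf x hx.2, div_eq_mul_inv, div_eq_mul_inv, mul_left_comm]
          refine mul_le_mul_of_nonneg_left ?_ (hf0 _)
          rw [inv_le_iff_one_le_mul₀ p1]
          field_simp
          nlinarith [mul_le_mul d3 d1 one_pos.le (by positivity)]
        _ = (K : ℝ≥0∞) ^ (m + 2) * (ENNReal.ofReal a⁻¹ * ENNReal.ofReal a) *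
            ∫⁻ x in S, ENNReal.ofReal (f x / ‖gradient Δ x‖) ∂μHE[m] := by
          rw [lintegral_const_mul' _ _ hfin]
          ring
        _ ≤ _ := by
          rw [← ENNReal.ofReal_mul (by positivity), inv_mul_cancel₀ ha0.ne', ENNReal.ofReal_one,
            mul_one]
          gcongr

end LevelIntegrals

/-! ### Partitions of unity and openness of regular values -/

lemma exists_partition_of_unity_of_isCompact {Y : Type*} [TopologicalSpace Y] [T2Space Y]
    [LocallyCompactSpace Y] {K : Set Y} (hK : IsCompact K) (U : Y → Set Y)
    (hU : ∀ x ∈ K, IsOpen (U x) ∧ x ∈ U x) :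
    ∃ (n : ℕ) (c : Fin n → Y) (ρ : Fin n → C(Y, ℝ)), (∀ i, c i ∈ K) ∧
      (∀ i, tsupport (ρ i) ⊆ U (c i)) ∧ (∀ x ∈ K, ∑ i, ρ i x = 1) ∧ ∀ i x, 0 ≤ ρ i x := by
  obtain ⟨t, ht, htU⟩ := hK.elim_nhds_subcover U fun x hx => (hU x hx).1.mem_nhds (hU x hx).2
  set e := t.equivFin
  obtain ⟨ρ, h1, h2, h3, -⟩ := exists_continuous_sum_one_of_isOpen_isCompact
    (s := fun i => U (e.symm i)) (fun i => (hU _ (ht _ (e.symm i).2)).1) hK fun x hx => by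
      obtain ⟨y, hy, hxy⟩ := mem_iUnion₂.1 (htU hx)
      exact mem_iUnion.2 ⟨e ⟨y, hy⟩, by simpa using hxy⟩
  refine ⟨t.card, fun i => e.symm i, ρ, fun i => ht _ (e.symm i).2, h1, fun x hx => ?_,
    fun i x => (h3 i x).1⟩
  simpa using h2 hx

/-- The critical points in `K` form a compact set, so the critical values are a compact, hence
closed, set. -/
lemma isOpen_setOf_regular {V : Type*} [NormedAddCommGroup V] [InnerProductSpace ℝ V]
    [FiniteDimensional ℝ V] {B : Set V} {Δ : V → ℝ} (hB : IsOpen B) (hΔ : ContDiffOn ℝ 1 Δ B) {K : Set V}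
    (hK : IsCompact K) (hKB : K ⊆ B) :
    IsOpen {δ : ℝ | ∀ x ∈ K, Δ x = δ → gradient Δ x ≠ 0} := by
  have h1 : IsCompact (K ∩ {x | ‖gradient Δ x‖ = 0}) := by
    obtain ⟨C, hC, h⟩ := continuousOn_iff_isClosed.1
      ((continuousOn_norm_gradient hB hΔ).mono hKB) {0} isClosed_singleton
    have : K ∩ {x | ‖gradient Δ x‖ = 0} = K ∩ C := by
      rw [inter_comm, inter_comm K C]; exact h
    rw [this]
    exact hK.inter_right hC
  have h2 := (h1.image_of_continuousOn (hΔ.continuousOn.mono (inter_subset_left.trans hKB))).isClosed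
  convert! h2.isOpen_compl using 1
  ext δ
  simp only [mem_ofPred_eq, mem_compl_iff, mem_image, mem_inter_iff, norm_eq_zero]
  constructor
  · rintro h ⟨x, ⟨hx, hx0⟩, hxδ⟩
    exact h x hx hxδ hx0
  · exact fun h x hx hxδ hx0 => h ⟨x, ⟨hx, hx0⟩, hxδ⟩

/-! ### The derivative at a regular value -/

section SignedLevelIntegrals

open Module

variable {V : Type*} [NormedAddCommGroup V] [InnerProductSpace ℝ V] [FiniteDimensional ℝ V]
  [MeasurableSpace V] [BorelSpace V] {B : Set V} {Δ : V → ℝ}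

/-- The signed integral of `f / ‖∂Δ‖` over the level set `{x ∈ B : Δ x = δ}`. -/
noncomputable def levelSetIntegral (B : Set V) (Δ f : V → ℝ) (δ : ℝ) : ℝ :=
  ∫ x in {x | x ∈ B ∧ Δ x = δ}, f x / ‖gradient Δ x‖ ∂μHE[finrank ℝ V - 1]

lemma aemeasurable_div_norm_gradient (hB : IsOpen B) (hΔ : ContDiffOn ℝ 1 Δ B) {f : V → ℝ}
    (hf : Continuous f) (δ : ℝ) :
    AEMeasurable (fun x => f x / ‖gradient Δ x‖)
      ((μHE[finrank ℝ V - 1] : Measure V).restrict {x | x ∈ B ∧ Δ x = δ}) :=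
  hf.aemeasurable.div (((continuousOn_norm_gradient hB hΔ).mono fun _ hx => hx.1).aemeasurable
    (measurableSet_setOf_mem_and_eq hB hΔ.continuousOn δ))

lemma levelLIntegral_sum (hB : IsOpen B) (hΔ : ContDiffOn ℝ 1 Δ B) {ι : Type*} (s : Finset ι)
    {f : ι → V → ℝ} (hf : ∀ i ∈ s, Continuous (f i)) (hf0 : ∀ i ∈ s, ∀ x, 0 ≤ f i x) (δ : ℝ) :
    levelLIntegral B Δ (fun x => ∑ i ∈ s, f i x) δ = ∑ i ∈ s, levelLIntegral B Δ (f i) δ := by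
  simp only [levelLIntegral]
  rw [← lintegral_finsetSum' _ fun i hi =>
    (aemeasurable_div_norm_gradient hB hΔ (hf i hi) δ).ennreal_ofReal]
  refine lintegral_congr fun x => ?_
  rw [Finset.sum_div, ENNReal.ofReal_sum_of_nonneg]
  exact fun i hi => div_nonneg (hf0 i hi x) (norm_nonneg _)

lemma lowerIntegral_sum {ι : Type*} (s : Finset ι) {f : ι → V → ℝ}
    (hf : ∀ i ∈ s, Integrable (f i)) (δ : ℝ) :
    lowerIntegral B Δ (fun x => ∑ i ∈ s, f i x) δ = ∑ i ∈ s, lowerIntegral B Δ (f i) δ :=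
  integral_finsetSum _ fun i hi => (hf i hi).integrableOn

/-- Away from the values that `Δ` takes on the support of `f`, both integrals are constant. -/
lemma lowerIntegral_eq_of_notMem_image (hB : IsOpen B) (hΔ : ContinuousOn Δ B) {f : V → ℝ}
    (hfc : HasCompactSupport f) (hfB : tsupport f ⊆ B) {δ₀ : ℝ} (h : δ₀ ∉ Δ '' tsupport f) :
    ∀ᶠ δ in 𝓝 δ₀, lowerIntegral B Δ f δ = lowerIntegral B Δ f δ₀ ∧
      levelLIntegral B Δ f δ = 0 := by
  classical
  have hC : IsCompact (Δ '' tsupport f) := hfc.isCompact.image_of_continuousOn (hΔ.mono hfB)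
  obtain ⟨e, he, hball⟩ := Metric.isOpen_iff.1 hC.isClosed.isOpen_compl δ₀ h
  filter_upwards [Metric.ball_mem_nhds δ₀ he] with δ hδ
  have hne : ∀ x, f x ≠ 0 → ¬ |Δ x - δ₀| < e := fun x hx hlt =>
    hball (Metric.mem_ball.2 hlt) ⟨x, subset_tsupport _ hx, rfl⟩
  rw [Metric.mem_ball, Real.dist_eq] at hδ
  constructor
  · rw [lowerIntegral, lowerIntegral,
      ← integral_indicator (measurableSet_setOf_mem_and_le hB hΔ δ),
      ← integral_indicator (measurableSet_setOf_mem_and_le hB hΔ δ₀)]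
    refine integral_congr_ae (Eventually.of_forall fun x => ?_)
    simp only [indicator_apply, mem_ofPred_eq]
    by_cases hx : f x = 0
    · simp only [hx, ite_self]
    · have h1 := hne x hx
      have h2 : Δ x ≤ δ ↔ Δ x ≤ δ₀ := by
        rw [abs_lt] at hδ
        rw [abs_lt, not_and_or, not_lt, not_lt] at h1
        constructor <;> intro h3 <;> rcases h1 with h1 | h1 <;> linarith
      simp only [h2]
  · rw [levelLIntegral, setLIntegral_congr_fun (g := fun _ => 0)
      (measurableSet_setOf_mem_and_eq hB hΔ δ), lintegral_zero]
    rintro x ⟨-, hx⟩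
    have : f x = 0 := by_contra fun h1 => hne x h1 (by rwa [hx])
    simp [this]

/-- A partition of unity over `tsupport f` reduces to pieces supported in charts, or away from the
level `δ₀`, where the derivative is zero. The factor `κ` survives summation because all terms are
nonnegative. The continuity of `J` is kept because it later yields that of the level integral. -/
lemma exists_hasDerivAt_lowerIntegral_of_nonneg (hB : IsOpen B) (hΔ : ContDiffOn ℝ 1 Δ B)
    {f : V → ℝ} (hf : Continuous f) (hfc : HasCompactSupport f) (hfB : tsupport f ⊆ B)
    (hf0 : ∀ x, 0 ≤ f x) {δ₀ : ℝ} (hreg : ∀ x ∈ tsupport f, Δ x = δ₀ → gradient Δ x ≠ 0)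
    {κ : NNReal} (hκ : 1 < κ) :
    ∃ J : ℝ → ℝ, ContinuousAt J δ₀ ∧ ∀ᶠ δ in 𝓝 δ₀, 0 ≤ J δ ∧
      HasDerivAt (lowerIntegral B Δ f) (J δ) δ ∧
      levelLIntegral B Δ f δ ≤ κ * ENNReal.ofReal (J δ) ∧
      ENNReal.ofReal (J δ) ≤ κ * levelLIntegral B Δ f δ := by
  have hloc : ∀ x ∈ tsupport f, ∃ U : Set V, IsOpen U ∧ x ∈ U ∧ ∀ g : V → ℝ, Continuous g →
      HasCompactSupport g → tsupport g ⊆ U → (∀ x, 0 ≤ g x) →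
      ∃ J : ℝ → ℝ, ContinuousAt J δ₀ ∧ ∀ᶠ δ in 𝓝 δ₀, 0 ≤ J δ ∧
      HasDerivAt (lowerIntegral B Δ g) (J δ) δ ∧
      levelLIntegral B Δ g δ ≤ κ * ENNReal.ofReal (J δ) ∧
      ENNReal.ofReal (J δ) ≤ κ * levelLIntegral B Δ g δ := by
    intro x hx
    by_cases hxδ : Δ x = δ₀
    · obtain ⟨U, hU, hxU, h⟩ :=
        exists_hasDerivAt_lowerIntegral_near hB hΔ (hfB hx) (hreg x hx hxδ) hκ
      refine ⟨U, hU, hxU, fun g hg hgc hgU hg0 => ?_⟩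
      obtain ⟨J, hJ, hJ'⟩ := h g hg hgc hgU hg0
      exact ⟨J, hJ.continuousAt, Eventually.of_forall hJ'⟩
    · refine ⟨B ∩ Δ ⁻¹' {δ₀}ᶜ, hΔ.continuousOn.isOpen_inter_preimage hB isOpen_compl_singleton,
        ⟨hfB hx, hxδ⟩, fun g hg hgc hgU hg0 => ⟨fun _ => 0, continuousAt_const, ?_⟩⟩
      have hn : δ₀ ∉ Δ '' tsupport g := by
        rintro ⟨y, hy, hyδ⟩
        exact (hgU hy).2 hyδ
      have h1 := lowerIntegral_eq_of_notMem_image hB hΔ.continuousOn hgc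
        (fun y hy => (hgU hy).1) hn
      filter_upwards [h1.eventually_nhds] with δ hδ
      refine ⟨le_rfl, ?_, ?_, ?_⟩
      · refine (hasDerivAt_const δ (lowerIntegral B Δ g δ₀)).congr_of_eventuallyEq ?_
        exact hδ.mono fun _ h => h.1
      · simp [hδ.self_of_nhds.2]
      · simp
  choose! U hU hxU hJU using hloc
  obtain ⟨n, c, ρ, hc, hρU, hρ1, hρ0⟩ :=
    exists_partition_of_unity_of_isCompact hfc.isCompact U fun x hx => ⟨hU x hx, hxU x hx⟩
  set g : Fin n → V → ℝ := fun i x => ρ i x * f x with hg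
  have hgc : ∀ i, Continuous (g i) := fun i => (ρ i).continuous.mul hf
  have hgs : ∀ i, HasCompactSupport (g i) := fun i => hfc.mul_left
  have hgU : ∀ i, tsupport (g i) ⊆ U (c i) := fun i =>
    (tsupport_mul_subset_left).trans (hρU i)
  have hg0 : ∀ i x, 0 ≤ g i x := fun i x => mul_nonneg (hρ0 i x) (hf0 x)
  have hsum : f = fun x => ∑ i, g i x := by
    ext x
    by_cases hx : x ∈ tsupport f
    · simp only [hg]
      rw [← Finset.sum_mul, hρ1 x hx, one_mul]
    · have : f x = 0 := image_eq_zero_of_notMem_tsupport hx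
      simp [hg, this]
  choose J hJc hJ using fun i => hJU (c i) (hc i) (g i) (hgc i) (hgs i) (hgU i) (hg0 i)
  refine ⟨fun δ => ∑ i, J i δ, tendsto_finsetSum _ fun i _ => hJc i, ?_⟩
  filter_upwards [eventually_all.2 hJ] with δ hδ
  have hlev : levelLIntegral B Δ f δ = ∑ i, levelLIntegral B Δ (g i) δ := by
    rw [hsum]
    exact levelLIntegral_sum hB hΔ _ (fun i _ => hgc i) (fun i _ => hg0 i) δ
  have hlow : lowerIntegral B Δ f = fun δ => ∑ i, lowerIntegral B Δ (g i) δ := by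
    ext δ
    rw [hsum]
    exact lowerIntegral_sum _ (fun i _ => (hgc i).integrable_of_hasCompactSupport (hgs i)) δ
  refine ⟨Finset.sum_nonneg fun i _ => (hδ i).1, ?_, ?_, ?_⟩
  · rw [hlow]
    exact HasDerivAt.fun_sum fun i _ => (hδ i).2.1
  · rw [hlev, ENNReal.ofReal_sum_of_nonneg fun i _ => (hδ i).1, Finset.mul_sum]
    exact Finset.sum_le_sum fun i _ => (hδ i).2.2.1
  · rw [hlev, ENNReal.ofReal_sum_of_nonneg fun i _ => (hδ i).1, Finset.mul_sum]
    exact Finset.sum_le_sum fun i _ => (hδ i).2.2.2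

/-- Let `κ` decrease to one; finiteness of `b` makes multiplication by `b` continuous. -/
lemma _root_.ENNReal.le_of_forall_one_lt_mul {a b : ℝ≥0∞} (hb : b ≠ ⊤)
    (h : ∀ κ : NNReal, 1 < κ → a ≤ κ * b) : a ≤ b := by
  have h1 : Tendsto (fun κ : NNReal => (κ : ℝ≥0∞) * b) (𝓝[>] 1) (𝓝 (((1 : NNReal) : ℝ≥0∞) * b)) :=
    ENNReal.Tendsto.mul_const
      (ENNReal.continuous_coe.continuousAt.tendsto.mono_left nhdsWithin_le_nhds) (Or.inr hb)
  rw [ENNReal.coe_one, one_mul] at h1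
  exact ge_of_tendsto h1 (eventually_mem_nhdsWithin.mono h)

/-- `J δ₀` is a derivative, so it is the same number for every `κ`, and letting `κ → 1` identifies
it with the level integral. The case `κ = 2` fixes this number. -/
lemma hasDerivAt_lowerIntegral_of_nonneg (hB : IsOpen B) (hΔ : ContDiffOn ℝ 1 Δ B)
    {f : V → ℝ} (hf : Continuous f) (hfc : HasCompactSupport f) (hfB : tsupport f ⊆ B)
    (hf0 : ∀ x, 0 ≤ f x) {δ₀ : ℝ} (hreg : ∀ x ∈ tsupport f, Δ x = δ₀ → gradient Δ x ≠ 0) :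
    levelLIntegral B Δ f δ₀ ≠ ⊤ ∧
      HasDerivAt (lowerIntegral B Δ f) (levelLIntegral B Δ f δ₀).toReal δ₀ := by
  obtain ⟨J₂, -, hJ₂⟩ := exists_hasDerivAt_lowerIntegral_of_nonneg hB hΔ hf hfc hfB hf0 hreg
    (κ := 2) one_lt_two
  have h2 := hJ₂.self_of_nhds
  have hκ : ∀ κ : NNReal, 1 < κ → levelLIntegral B Δ f δ₀ ≤ κ * ENNReal.ofReal (J₂ δ₀) ∧
      ENNReal.ofReal (J₂ δ₀) ≤ κ * levelLIntegral B Δ f δ₀ := by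
    intro κ hκ
    obtain ⟨J, -, hJ⟩ :=
      exists_hasDerivAt_lowerIntegral_of_nonneg hB hΔ hf hfc hfB hf0 hreg hκ
    have h := hJ.self_of_nhds
    rw [h2.2.1.unique h.2.1]
    exact h.2.2
  have h3 : levelLIntegral B Δ f δ₀ ≤ ENNReal.ofReal (J₂ δ₀) :=
    ENNReal.le_of_forall_one_lt_mul ENNReal.ofReal_ne_top fun κ h => (hκ κ h).1
  have h4 : levelLIntegral B Δ f δ₀ ≠ ⊤ := ne_top_of_le_ne_top ENNReal.ofReal_ne_top h3
  have h5 : levelLIntegral B Δ f δ₀ = ENNReal.ofReal (J₂ δ₀) :=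
    le_antisymm h3 (ENNReal.le_of_forall_one_lt_mul h4 fun κ h => (hκ κ h).2)
  refine ⟨h4, ?_⟩
  rw [h5, ENNReal.toReal_ofReal h2.1]
  exact h2.2.1

/-- Differentiation of the distribution of a nonnegative function along `Δ` at a regular value. -/
lemma integrableOn_and_hasDerivAt_of_nonneg (hB : IsOpen B) (hΔ : ContDiffOn ℝ 1 Δ B)
    {K : Set V} (hK : IsCompact K) (hKB : K ⊆ B) {f : V → ℝ} (hf : Continuous f)
    (hfK : tsupport f ⊆ K) (hf0 : ∀ x, 0 ≤ f x) {δ : ℝ}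
    (hreg : ∀ x ∈ K, Δ x = δ → gradient Δ x ≠ 0) :
    IntegrableOn (fun x => f x / ‖gradient Δ x‖) {x | x ∈ B ∧ Δ x = δ}
        (μHE[finrank ℝ V - 1] : Measure V) ∧
      HasDerivAt (lowerIntegral B Δ f) (levelSetIntegral B Δ f δ) δ ∧
      ContinuousAt (levelSetIntegral B Δ f) δ := by
  have hfc : HasCompactSupport f := hK.of_isClosed_subset (isClosed_tsupport f) hfK
  have hn : ∀ x, 0 ≤ f x / ‖gradient Δ x‖ := fun x => div_nonneg (hf0 x) (norm_nonneg _)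
  have main : ∀ {δ : ℝ}, (∀ x ∈ K, Δ x = δ → gradient Δ x ≠ 0) →
      IntegrableOn (fun x => f x / ‖gradient Δ x‖) {x | x ∈ B ∧ Δ x = δ}
        (μHE[finrank ℝ V - 1] : Measure V) ∧
      HasDerivAt (lowerIntegral B Δ f) (levelSetIntegral B Δ f δ) δ := by
    intro δ hδ
    obtain ⟨h1, h2⟩ := hasDerivAt_lowerIntegral_of_nonneg hB hΔ hf hfc (hfK.trans hKB) hf0
      fun x hx => hδ x (hfK hx)
    have hm := (aemeasurable_div_norm_gradient hB hΔ hf δ).aestronglyMeasurable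
    refine ⟨⟨hm, ?_⟩, ?_⟩
    · rw [hasFiniteIntegral_iff_ofReal (Eventually.of_forall hn)]
      exact h1.lt_top
    · rw [levelSetIntegral, integral_eq_lintegral_of_nonneg_ae (Eventually.of_forall hn) hm]
      exact h2
  refine ⟨(main hreg).1, (main hreg).2, ?_⟩
  -- At nearby values, which are again regular, both `J` and the level integral are the derivative,
  -- so they agree and the continuity of `J` at `δ` is inherited. Any `κ > 1` would do.
  obtain ⟨J, hJc, hJ⟩ := exists_hasDerivAt_lowerIntegral_of_nonneg hB hΔ hf hfc
    (hfK.trans hKB) hf0 (fun x hx => hreg x (hfK hx)) (κ := 2) one_lt_two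
  refine hJc.congr ?_
  filter_upwards [hJ, (isOpen_setOf_regular hB hΔ hK hKB).eventually_mem hreg] with δ' h1 h2
  exact h1.2.1.unique (main h2).2

/-- Differentiation of the distribution of `f` along `Δ` at a regular value. -/
theorem integrableOn_and_hasDerivAt_lowerIntegral (hB : IsOpen B) (hΔ : ContDiffOn ℝ 1 Δ B)
    {K : Set V} (hK : IsCompact K) (hKB : K ⊆ B) {f : V → ℝ} (hf : Continuous f)
    (hfK : tsupport f ⊆ K) {δ : ℝ} (hreg : ∀ x ∈ K, Δ x = δ → gradient Δ x ≠ 0) :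
    IntegrableOn (fun x => f x / ‖gradient Δ x‖) {x | x ∈ B ∧ Δ x = δ}
        (μHE[finrank ℝ V - 1] : Measure V) ∧
      HasDerivAt (lowerIntegral B Δ f) (levelSetIntegral B Δ f δ) δ ∧
      ContinuousAt (levelSetIntegral B Δ f) δ := by
  -- Reduction to positive and negative parts, which are continuous with support still inside `K`.
  have hs : ∀ g : ℝ → ℝ, g 0 = 0 → tsupport (fun x => g (f x)) ⊆ K := fun g hg =>
    (tsupport_comp_subset hg f).trans hfK
  have i1 := hs (fun y => max y 0) (by simp)
  have i2 := hs (fun y => max (-y) 0) (by simp)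
  have k1 : Continuous fun x => max (f x) 0 := by fun_prop
  have k2 : Continuous fun x => max (-f x) 0 := by fun_prop
  have c1 : HasCompactSupport fun x => max (f x) 0 :=
    hK.of_isClosed_subset (isClosed_tsupport _) i1
  have c2 : HasCompactSupport fun x => max (-f x) 0 :=
    hK.of_isClosed_subset (isClosed_tsupport _) i2
  have pos := fun {δ : ℝ} (h : ∀ x ∈ K, Δ x = δ → gradient Δ x ≠ 0) =>
    integrableOn_and_hasDerivAt_of_nonneg hB hΔ hK hKB k1 i1 (fun x => le_max_right _ _) h
  have neg := fun {δ : ℝ} (h : ∀ x ∈ K, Δ x = δ → gradient Δ x ≠ 0) =>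
    integrableOn_and_hasDerivAt_of_nonneg hB hΔ hK hKB k2 i2 (fun x => le_max_right _ _) h
  have hsub : ∀ y : ℝ, max y 0 - max (-y) 0 = y := fun y => by
    rcases le_total 0 y with h | h
    · rw [max_eq_left h, max_eq_right (by linarith), sub_zero]
    · rw [max_eq_right h, max_eq_left (by linarith)]; ring
  have hfun : (fun x => f x / ‖gradient Δ x‖) = fun x =>
      max (f x) 0 / ‖gradient Δ x‖ - max (-f x) 0 / ‖gradient Δ x‖ := by
    ext x; rw [← sub_div, hsub]
  have e1 : lowerIntegral B Δ f = fun δ => lowerIntegral B Δ (fun x => max (f x) 0) δ -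
      lowerIntegral B Δ (fun x => max (-f x) 0) δ := by
    ext δ
    rw [lowerIntegral, lowerIntegral, lowerIntegral, ← integral_sub
      (k1.integrable_of_hasCompactSupport c1).integrableOn
      (k2.integrable_of_hasCompactSupport c2).integrableOn]
    simp only [hsub]
  have e2 : ∀ {δ : ℝ}, (∀ x ∈ K, Δ x = δ → gradient Δ x ≠ 0) →
      levelSetIntegral B Δ f δ = levelSetIntegral B Δ (fun x => max (f x) 0) δ -
        levelSetIntegral B Δ (fun x => max (-f x) 0) δ := by
    intro δ h
    rw [levelSetIntegral, levelSetIntegral, levelSetIntegral,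
      ← integral_sub (pos h).1 (neg h).1, hfun]
  refine ⟨by rw [hfun]; exact (pos hreg).1.sub (neg hreg).1, ?_, ?_⟩
  · rw [e1, e2 hreg]
    exact (pos hreg).2.1.sub (neg hreg).2.1
  · refine ((pos hreg).2.2.sub (neg hreg).2.2).congr ?_
    filter_upwards [(isOpen_setOf_regular hB hΔ hK hKB).eventually_mem hreg] with δ' h
    exact (e2 h).symm

end SignedLevelIntegrals

/-! ### Uniform differentiability on compact sets -/

/-- A function with continuous derivative is differentiable uniformly on compact sets. -/
lemma exists_forall_abs_sub_le_of_isCompact {F f : ℝ → ℝ} {U D : Set ℝ} (hU : IsOpen U)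
    (hD : IsCompact D) (hDU : D ⊆ U) (hF : ∀ δ ∈ U, HasDerivAt F (f δ) δ)
    (hf : ContinuousOn f U) {η : ℝ} (hη : 0 < η) :
    ∃ r > 0, ∀ δ ∈ D, ∀ y, |y| ≤ r → |F (δ + y) - F δ - y * f δ| ≤ η * |y| := by
  obtain ⟨r₁, hr₁, h₁⟩ := hD.exists_cthickening_subset_open hU hDU
  have h2 := hD.uniformContinuousAt_of_continuousAt f
    (fun δ hδ => hf.continuousAt (hU.mem_nhds (hDU hδ))) (Metric.dist_mem_uniformity hη)
  obtain ⟨r₂, hr₂, h₂⟩ := Metric.mem_uniformity_dist.1 h2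
  refine ⟨min r₁ (r₂ / 2), lt_min hr₁ (half_pos hr₂), fun δ hδ y hy => ?_⟩
  have hball : ∀ z ∈ Metric.closedBall δ |y|, z ∈ U ∧ |f z - f δ| ≤ η := by
    intro z hz
    rw [Metric.mem_closedBall] at hz
    refine ⟨h₁ (Metric.mem_cthickening_of_dist_le z δ _ D hδ (hz.trans (hy.trans (min_le_left _ _)))),
      ?_⟩
    have h3 : dist δ z < r₂ := by
      rw [dist_comm]
      exact (hz.trans (hy.trans (min_le_right _ _))).trans_lt (half_lt_self hr₂)
    have h4 : dist (f δ) (f z) < η := h₂ h3 hδ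
    rw [dist_comm, Real.dist_eq] at h4
    exact h4.le
  -- Mean value inequality for `F` minus its linear part at `δ`, whose derivative `f z - f δ` is at
  -- most `η` on the ball.
  have h5 := (convex_closedBall δ |y|).norm_image_sub_le_of_norm_hasDerivWithin_le
    (f := fun z => F z - z * f δ) (f' := fun z => f z - 1 * f δ) (C := η) (x := δ) (y := δ + y)
    (fun z hz => ((hF z (hball z hz).1).sub ((hasDerivAt_id z).mul_const (f δ))).hasDerivWithinAt)
    (fun z hz => by simpa using (hball z hz).2) (Metric.mem_closedBall_self (abs_nonneg y))
    (by simp)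
  simp only [Real.norm_eq_abs, add_sub_cancel_left] at h5
  convert! h5 using 2
  ring

lemma continuous_mul_of_tsupport_subset {V : Type*} [TopologicalSpace V] {B : Set V} (hB : IsOpen B) {G f : V → ℝ} (hG : ContinuousOn G B)
    (hf : Continuous f) (hfB : tsupport f ⊆ B) : Continuous fun x => G x * f x :=
  (hG.mul hf.continuousOn).continuous_of_tsupport_subset hB
    ((tsupport_mul_subset_right).trans hfB)

/-- Splits an error budget `a` in half against a bound `b`; the added one keeps the denominator
positive when `b = 0`. -/
lemma div_two_mul_add_one_mul_le {a b : ℝ} (ha : 0 ≤ a) (hb : 0 ≤ b) :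
    a / (2 * (b + 1)) * b ≤ a / 2 := by
  have h : a / (2 * (b + 1)) * b = a / 2 * (b / (b + 1)) := by field_simp
  rw [h]
  refine mul_le_of_le_one_right (by positivity) ?_
  rw [div_le_one (by positivity)]
  linarith

/-! ### Perturbing `Δ` in a direction `G` -/

section Perturbation

open Module

variable {V : Type*} [NormedAddCommGroup V] [InnerProductSpace ℝ V] [FiniteDimensional ℝ V]
  [MeasurableSpace V] [BorelSpace V] {B : Set V} {Δ : V → ℝ}

/-- Inclusion of the sublevel sets is required only where `f` does not vanish, which lets it be
checked on one piece of a partition. -/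
lemma lowerIntegral_le_lowerIntegral (hB : IsOpen B) {Δ₁ Δ₂ : V → ℝ} (h₁ : ContinuousOn Δ₁ B)
    (h₂ : ContinuousOn Δ₂ B) {f : V → ℝ} (hf : Integrable f) (hf0 : ∀ x, 0 ≤ f x) {δ₁ δ₂ : ℝ}
    (h : ∀ x ∈ B, f x ≠ 0 → Δ₁ x ≤ δ₁ → Δ₂ x ≤ δ₂) :
    lowerIntegral B Δ₁ f δ₁ ≤ lowerIntegral B Δ₂ f δ₂ := by
  classical
  have m₁ := measurableSet_setOf_mem_and_le hB h₁ δ₁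
  have m₂ := measurableSet_setOf_mem_and_le hB h₂ δ₂
  rw [lowerIntegral, lowerIntegral, ← integral_indicator m₁, ← integral_indicator m₂]
  refine integral_mono (hf.indicator m₁) (hf.indicator m₂) fun x => ?_
  by_cases hx : f x = 0
  · simp [indicator_apply, hx]
  · refine indicator_apply_le' (fun hx1 => ?_) (fun _ => indicator_nonneg (fun x _ => hf0 x) x)
    rw [indicator_of_mem (show x ∈ {x | x ∈ B ∧ Δ₂ x ≤ δ₂} from ⟨hx1.1, h x hx1.1 hx hx1.2⟩)]

lemma levelSetIntegral_const_mul (c : ℝ) (f : V → ℝ) (δ : ℝ) :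
    levelSetIntegral B Δ (fun x => c * f x) δ = c * levelSetIntegral B Δ f δ := by
  simp only [levelSetIntegral, mul_div_assoc]
  exact integral_const_mul c _

lemma levelSetIntegral_mono (hB : IsOpen B) (hΔ : ContinuousOn Δ B) {f g : V → ℝ} {δ : ℝ}
    (hf : IntegrableOn (fun x => f x / ‖gradient Δ x‖) {x | x ∈ B ∧ Δ x = δ}
      (μHE[finrank ℝ V - 1] : Measure V))
    (hg : IntegrableOn (fun x => g x / ‖gradient Δ x‖) {x | x ∈ B ∧ Δ x = δ}
      (μHE[finrank ℝ V - 1] : Measure V)) (h : ∀ x ∈ B, f x ≤ g x) :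
    levelSetIntegral B Δ f δ ≤ levelSetIntegral B Δ g δ :=
  setIntegral_mono_on hf hg (measurableSet_setOf_mem_and_eq hB hΔ δ) fun x hx =>
    div_le_div_of_nonneg_right (h x hx.1) (norm_nonneg _)

lemma levelSetIntegral_sum {ι : Type*} (s : Finset ι) {f : ι → V → ℝ} {δ : ℝ}
    (hf : ∀ i ∈ s, IntegrableOn (fun x => f i x / ‖gradient Δ x‖) {x | x ∈ B ∧ Δ x = δ}
      (μHE[finrank ℝ V - 1] : Measure V)) :
    levelSetIntegral B Δ (fun x => ∑ i ∈ s, f i x) δ = ∑ i ∈ s, levelSetIntegral B Δ (f i) δ := by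
  simp only [levelSetIntegral, Finset.sum_div]
  exact integral_finsetSum _ hf

/-- Perturbing `Δ` in the direction `G` changes the distribution of `f` along `Δ` at the rate
`-∫ G f / ‖∂Δ‖`, uniformly on compact sets of regular values. -/
theorem eventually_abs_lowerIntegral_sub_le (hB : IsOpen B) (hΔ : ContDiffOn ℝ 1 Δ B)
    {K : Set V} (hK : IsCompact K) (hKB : K ⊆ B) {f : V → ℝ} (hf : Continuous f)
    (hfK : tsupport f ⊆ K) (hf0 : ∀ x, 0 ≤ f x) {D : Set ℝ} (hD : IsCompact D)
    (hreg : ∀ δ ∈ D, ∀ x ∈ K, Δ x = δ → gradient Δ x ≠ 0)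
    {t : ℕ → ℝ} (ht : Tendsto t atTop (𝓝 0)) {G : V → ℝ} {Gn : ℕ → V → ℝ}
    (hG : ContinuousOn G B) (hGc : ∀ n, ContinuousOn (Gn n) B)
    (hGn : ∀ η > 0, ∀ᶠ n in atTop, ∀ x ∈ K, |Gn n x - G x| ≤ η) {η : ℝ} (hη : 0 < η) :
    ∀ᶠ n in atTop, ∀ δ ∈ D, |lowerIntegral B (fun x => Δ x + t n * Gn n x) f δ -
      lowerIntegral B Δ f δ + t n * levelSetIntegral B Δ (fun x => G x * f x) δ| ≤ η * |t n| := by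
  have hfc : HasCompactSupport f := hK.of_isClosed_subset (isClosed_tsupport f) hfK
  set W := {δ : ℝ | ∀ x ∈ K, Δ x = δ → gradient Δ x ≠ 0} with hW
  have hWo : IsOpen W := isOpen_setOf_regular hB hΔ hK hKB
  have hDW : D ⊆ W := hreg
  have hIc : ContinuousOn (levelSetIntegral B Δ f) D := fun δ hδ =>
    (integrableOn_and_hasDerivAt_lowerIntegral hB hΔ hK hKB hf hfK (hreg δ hδ)).2.2.continuousWithinAt
  obtain ⟨M₀, hM₀⟩ := hD.exists_bound_of_continuousOn hIc
  set M := max M₀ 0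
  have hM : ∀ δ ∈ D, levelSetIntegral B Δ f δ ≤ M := fun δ hδ =>
    (le_abs_self _).trans ((hM₀ δ hδ).trans (le_max_left _ _))
  have hM0 : 0 ≤ M := le_max_right _ _
  -- The oscillation of `G` enters three times, twice through the squeeze and once when `G (c i)` is
  -- replaced by `G` in the level integral; so `3 * η₁ * M ≤ η / 2`.
  set η₁ := η / (6 * (M + 1)) with hη₁
  have hη₁0 : 0 < η₁ := by positivity
  obtain ⟨N, c, ρ, hc, hρU, hρ1, hρ0⟩ := exists_partition_of_unity_of_isCompact hK
    (fun x => B ∩ G ⁻¹' Metric.ball (G x) η₁) fun x hx =>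
      ⟨hG.isOpen_inter_preimage hB Metric.isOpen_ball, hKB hx, Metric.mem_ball_self hη₁0⟩
  set g : Fin N → V → ℝ := fun i x => ρ i x * f x with hg
  have hgc : ∀ i, Continuous (g i) := fun i => (ρ i).continuous.mul hf
  have hgs : ∀ i, HasCompactSupport (g i) := fun i => hfc.mul_left
  have hgi : ∀ i, Integrable (g i) := fun i => (hgc i).integrable_of_hasCompactSupport (hgs i)
  have hgK : ∀ i, tsupport (g i) ⊆ K := fun i => (tsupport_mul_subset_right).trans hfK
  have hg0 : ∀ i x, 0 ≤ g i x := fun i x => mul_nonneg (hρ0 i x) (hf0 x)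
  have hgG : ∀ i x, g i x ≠ 0 → x ∈ K ∧ |G x - G (c i)| ≤ η₁ := by
    intro i x hx
    refine ⟨hgK i (subset_tsupport _ hx), ?_⟩
    have h1 : ρ i x ≠ 0 := fun h => hx (by simp [hg, h])
    have h2 := (hρU i (subset_tsupport _ h1)).2
    rw [mem_preimage, Metric.mem_ball, Real.dist_eq] at h2
    exact h2.le
  have hsum : ∀ x, f x = ∑ i, g i x := by
    intro x
    by_cases hx : x ∈ K
    · simp only [hg]
      rw [← Finset.sum_mul, hρ1 x hx, one_mul]
    · have : f x = 0 := image_eq_zero_of_notMem_tsupport fun h => hx (hfK h)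
      simp [hg, this]
  set C := ∑ i, (|G (c i)| + 2 * η₁) with hC
  have hC0 : 0 ≤ C := Finset.sum_nonneg fun i _ => by positivity
  -- `C` adds up the sizes, per unit of `|t n|`, of the level shifts on the pieces, so the
  -- differentiability errors total at most `η₂ * C ≤ η / 2`.
  set η₂ := η / (2 * (C + 1)) with hη₂
  have hη₂0 : 0 < η₂ := div_pos hη (by linarith)
  have hder : ∀ i, ∀ δ ∈ W, _ := fun i δ hδ =>
    integrableOn_and_hasDerivAt_lowerIntegral hB hΔ hK hKB (hgc i) (hgK i) (δ := δ) hδ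
  choose r hr hrD using fun i => exists_forall_abs_sub_le_of_isCompact hWo hD hDW
    (fun δ hδ => (hder i δ hδ).2.1) (fun δ hδ => (hder i δ hδ).2.2.continuousWithinAt) hη₂0
  have htr : ∀ᶠ n in atTop, ∀ i, |t n| * (|G (c i)| + 2 * η₁) ≤ r i := by
    refine eventually_all.2 fun i => ?_
    have h1 : Tendsto (fun n => |t n| * (|G (c i)| + 2 * η₁)) atTop (𝓝 0) := by
      have h := ht.abs.mul_const (|G (c i)| + 2 * η₁)
      rwa [abs_zero, zero_mul] at h
    exact (h1.eventually_lt_const (hr i)).mono fun n h => h.le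
  filter_upwards [htr, hGn η₁ hη₁0] with n hn hGη δ hδ
  set Δn : V → ℝ := fun x => Δ x + t n * Gn n x with hΔn
  have hΔnc : ContinuousOn Δn B := hΔ.continuousOn.add (continuousOn_const.mul (hGc n))
  set I : Fin N → ℝ := fun i => levelSetIntegral B Δ (g i) δ with hI
  have hI0 : ∀ i, 0 ≤ I i := fun i =>
    integral_nonneg fun x => div_nonneg (hg0 i x) (norm_nonneg _)
  -- each piece is squeezed between two values of the unperturbed distribution
  have key : ∀ i, |lowerIntegral B Δn (g i) δ - lowerIntegral B Δ (g i) δ + t n * (G (c i) * I i)| ≤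
      |t n| * (2 * η₁ * I i + η₂ * (|G (c i)| + 2 * η₁)) := by
    intro i
    -- One `η₁` for `Gn n` against `G`, one for `G` against its value at the centre of the piece.
    have hclose : ∀ x, g i x ≠ 0 → |t n * Gn n x - t n * G (c i)| ≤ |t n| * (2 * η₁) := by
      intro x hx
      obtain ⟨hxK, h1⟩ := hgG i x hx
      have h2 := hGη x hxK
      rw [← mul_sub, abs_mul]
      refine mul_le_mul_of_nonneg_left ?_ (abs_nonneg _)
      have := abs_add_le (Gn n x - G x) (G x - G (c i))
      rw [sub_add_sub_cancel] at this
      linarith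
    have up : lowerIntegral B Δn (g i) δ ≤
        lowerIntegral B Δ (g i) (δ + (-(t n * G (c i)) + |t n| * (2 * η₁))) := by
      refine lowerIntegral_le_lowerIntegral hB hΔnc hΔ.continuousOn (hgi i) (hg0 i) ?_
      intro x _ hx hxδ
      have h1 := (abs_le.1 (hclose x hx)).1
      simp only [hΔn] at hxδ
      linarith
    have lo : lowerIntegral B Δ (g i) (δ + (-(t n * G (c i)) - |t n| * (2 * η₁))) ≤
        lowerIntegral B Δn (g i) δ := by
      refine lowerIntegral_le_lowerIntegral hB hΔ.continuousOn hΔnc (hgi i) (hg0 i) ?_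
      intro x _ hx hxδ
      have h1 := (abs_le.1 (hclose x hx)).2
      simp only [hΔn]
      linarith
    have hb : |t n * G (c i)| = |t n| * |G (c i)| := abs_mul _ _
    have hb0 : 0 ≤ |t n| * (2 * η₁) := by positivity
    have y1 : |-(t n * G (c i)) + |t n| * (2 * η₁)| ≤ |t n| * (|G (c i)| + 2 * η₁) := by
      refine (abs_add_le _ _).trans ?_
      rw [abs_neg, hb, abs_of_nonneg hb0, mul_add]
    have y2 : |-(t n * G (c i)) - |t n| * (2 * η₁)| ≤ |t n| * (|G (c i)| + 2 * η₁) := by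
      refine (abs_sub _ _).trans ?_
      rw [abs_neg, hb, abs_of_nonneg hb0, mul_add]
    have z1 := (hrD i δ hδ _ (y1.trans (hn i))).trans (mul_le_mul_of_nonneg_left y1 hη₂0.le)
    have z2 := (hrD i δ hδ _ (y2.trans (hn i))).trans (mul_le_mul_of_nonneg_left y2 hη₂0.le)
    rw [abs_le] at z1 z2 ⊢
    change _ ≤ _ - _ - _ * I i ∧ _ - _ - _ * I i ≤ _ at z1
    change _ ≤ _ - _ - _ * I i ∧ _ - _ - _ * I i ≤ _ at z2
    constructor <;> nlinarith [z1.1, z1.2, z2.1, z2.2, up, lo]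
  have e1 : lowerIntegral B Δn f δ = ∑ i, lowerIntegral B Δn (g i) δ := by
    rw [show f = fun x => ∑ i, g i x from funext hsum]
    exact lowerIntegral_sum _ (fun i _ => hgi i) δ
  have e2 : lowerIntegral B Δ f δ = ∑ i, lowerIntegral B Δ (g i) δ := by
    rw [show f = fun x => ∑ i, g i x from funext hsum]
    exact lowerIntegral_sum _ (fun i _ => hgi i) δ
  have e3 : levelSetIntegral B Δ f δ = ∑ i, I i := by
    rw [show f = fun x => ∑ i, g i x from funext hsum]
    exact levelSetIntegral_sum _ fun i _ => (hder i δ (hDW hδ)).1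
  have hGi : ∀ i, IntegrableOn (fun x => G x * g i x / ‖gradient Δ x‖) {x | x ∈ B ∧ Δ x = δ}
      (μHE[finrank ℝ V - 1] : Measure V) := fun i =>
    (integrableOn_and_hasDerivAt_lowerIntegral hB hΔ hK hKB
      (continuous_mul_of_tsupport_subset hB hG (hgc i) ((hgK i).trans hKB))
      ((tsupport_mul_subset_right).trans (hgK i)) (hreg δ hδ)).1
  have e4 : levelSetIntegral B Δ (fun x => G x * f x) δ =
      ∑ i, levelSetIntegral B Δ (fun x => G x * g i x) δ := by
    rw [← levelSetIntegral_sum _ fun i _ => hGi i]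
    simp only [hsum, Finset.mul_sum]
  have hci : ∀ i (a : ℝ), IntegrableOn (fun x => a * g i x / ‖gradient Δ x‖)
      {x | x ∈ B ∧ Δ x = δ} (μHE[finrank ℝ V - 1] : Measure V) := fun i a => by
    simp only [mul_div_assoc]
    exact (hder i δ (hDW hδ)).1.const_mul a
  have e5 : ∀ i, |levelSetIntegral B Δ (fun x => G x * g i x) δ - G (c i) * I i| ≤ η₁ * I i := by
    intro i
    have hpt : ∀ x, (G (c i) - η₁) * g i x ≤ G x * g i x ∧
        G x * g i x ≤ (G (c i) + η₁) * g i x := by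
      intro x
      by_cases hx : g i x = 0
      · simp [hx]
      · obtain ⟨h1, h2⟩ := abs_le.1 (hgG i x hx).2
        exact ⟨mul_le_mul_of_nonneg_right (by linarith) (hg0 i x),
          mul_le_mul_of_nonneg_right (by linarith) (hg0 i x)⟩
    have h1 := levelSetIntegral_mono hB hΔ.continuousOn (hci i _) (hGi i) fun x _ => (hpt x).1
    have h2 := levelSetIntegral_mono hB hΔ.continuousOn (hGi i) (hci i _) fun x _ => (hpt x).2
    rw [levelSetIntegral_const_mul] at h1 h2
    rw [abs_le]
    constructor <;> linarith
  rw [e1, e2, e4, Finset.mul_sum, ← Finset.sum_sub_distrib, ← Finset.sum_add_distrib]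
  calc |∑ i, (lowerIntegral B Δn (g i) δ - lowerIntegral B Δ (g i) δ +
          t n * levelSetIntegral B Δ (fun x => G x * g i x) δ)|
      ≤ ∑ i, |lowerIntegral B Δn (g i) δ - lowerIntegral B Δ (g i) δ +
          t n * levelSetIntegral B Δ (fun x => G x * g i x) δ| := Finset.abs_sum_le_sum_abs _ _
    _ ≤ ∑ i, |t n| * (3 * η₁ * I i + η₂ * (|G (c i)| + 2 * η₁)) := by
        refine Finset.sum_le_sum fun i _ => ?_
        have h1 := key i
        have h2 : |t n * (levelSetIntegral B Δ (fun x => G x * g i x) δ - G (c i) * I i)| ≤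
            |t n| * (η₁ * I i) := by
          rw [abs_mul]
          exact mul_le_mul_of_nonneg_left (e5 i) (abs_nonneg _)
        have h3 := abs_add_le (lowerIntegral B Δn (g i) δ - lowerIntegral B Δ (g i) δ +
          t n * (G (c i) * I i))
          (t n * (levelSetIntegral B Δ (fun x => G x * g i x) δ - G (c i) * I i))
        calc _ = |lowerIntegral B Δn (g i) δ - lowerIntegral B Δ (g i) δ +
              t n * (G (c i) * I i) +
              t n * (levelSetIntegral B Δ (fun x => G x * g i x) δ - G (c i) * I i)| := by
              congr 1; ring
          _ ≤ _ := by linarith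
    _ = |t n| * (3 * η₁ * levelSetIntegral B Δ f δ + η₂ * C) := by
        rw [← Finset.mul_sum, Finset.sum_add_distrib, ← Finset.mul_sum, ← Finset.mul_sum, e3]
    _ ≤ |t n| * η := by
        refine mul_le_mul_of_nonneg_left ?_ (abs_nonneg _)
        have h1 : 3 * η₁ * levelSetIntegral B Δ f δ ≤ η / 2 := by
          have := mul_le_mul_of_nonneg_left (hM δ hδ) (by positivity : 0 ≤ 3 * η₁)
          refine this.trans ?_
          have h3 := div_two_mul_add_one_mul_le hη.le hM0
          have h4 : 3 * η₁ * M = η / (2 * (M + 1)) * M := by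
            rw [hη₁, show 6 * (M + 1) = 3 * (2 * (M + 1)) by ring, ← div_div]
            ring
          rwa [h4]
        have h2 : η₂ * C ≤ η / 2 := div_two_mul_add_one_mul_le hη.le hC0
        linarith
    _ = η * |t n| := mul_comm _ _

end Perturbation

/-! ### Expansion of left inverses -/

lemma eventually_abs_mul_le {t : ℕ → ℝ} (ht : Tendsto t atTop (𝓝 0)) (a : ℝ) {b : ℝ} (hb : 0 < b) :
    ∀ᶠ n in atTop, |t n| * a < b := by
  have h := ht.abs.mul_const a
  rw [abs_zero, zero_mul] at h
  exact h.eventually_lt_const hb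

/-- If the functions `Fn n` expand as `F + t n • A + o(t n)` near a compact set where `F` has a
positive derivative `f`, then their left inverses at `F q` expand as `q - t n * (A q / f q)`. -/
theorem eventually_sInf_expansion {F f A : ℝ → ℝ} {Fn : ℕ → ℝ → ℝ} {t : ℕ → ℝ}
    {D E U 𝒱 : Set ℝ} {r ε : ℝ} (hD : IsCompact D) (hE : IsCompact E) (hr : 0 < r)
    (hDE : ∀ q ∈ D, Metric.closedBall q r ⊆ E) (hU : IsOpen U) (hEU : E ⊆ U) (hE𝒱 : E ⊆ 𝒱)
    (hF : ∀ δ ∈ U, HasDerivAt F (f δ) δ) (hf : ContinuousOn f U) (hA : ContinuousOn A E)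
    (hmono : Monotone F) (ht : Tendsto t atTop (𝓝 0)) (ht0 : ∀ n, t n ≠ 0)
    (hunif : ∀ η > 0, ∀ᶠ n in atTop, ∀ δ ∈ E, |Fn n δ - F δ - t n * A δ| ≤ η * |t n|)
    {M C : ℝ} (hfar : ∀ᶠ n in atTop, ∀ δ ∈ 𝒱, Fn n δ ≤ F (δ + |t n| * M) + |t n| * C)
    (hε : 0 < ε) {η : ℝ} (hη : 0 < η) :
    ∀ᶠ n in atTop, ∀ q ∈ D, ε < f q → {δ | δ ∈ 𝒱 ∧ F q ≤ Fn n δ}.Nonempty ∧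
      BddBelow {δ | δ ∈ 𝒱 ∧ F q ≤ Fn n δ} ∧
      |sInf {δ | δ ∈ 𝒱 ∧ F q ≤ Fn n δ} - q + t n * (A q / f q)| ≤ η * |t n| := by
  have hDE' : D ⊆ E := fun q hq => hDE q hq (Metric.mem_closedBall_self hr.le)
  obtain ⟨a₀, ha₀⟩ := hE.exists_bound_of_continuousOn hA
  set a := max a₀ 0
  have ha0 : 0 ≤ a := le_max_right _ _
  have ha : ∀ q ∈ E, |A q| ≤ a := fun q hq => (ha₀ q hq).trans (le_max_left _ _)
  set b := a / ε with hb
  have hb0 : 0 ≤ b := by positivity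
  -- The first bound leaves at least half of the slope `ε`; the second makes the linearisation error
  -- over the predicted shift, at most `|t n| * b`, negligible.
  obtain ⟨η₂, hη₂0, hη₂ε, hη₂b⟩ : ∃ η₂ > 0, η₂ ≤ ε / 2 ∧ η₂ * b ≤ ε * η / 8 := by
    refine ⟨min (ε / 2) (ε * η / 4 / (2 * (b + 1))), by positivity, min_le_left _ _, ?_⟩
    refine (mul_le_mul_of_nonneg_right (min_le_right _ _) hb0).trans ?_
    refine (div_two_mul_add_one_mul_le (by positivity) hb0).trans (by linarith)
  set η₃ := ε * η / 16 with hη₃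
  have hη₃0 : 0 < η₃ := by positivity
  obtain ⟨r₂, hr₂, hFr⟩ :=
    exists_forall_abs_sub_le_of_isCompact hU hD (hDE'.trans hEU) hF hf hη₂0
  obtain ⟨r₃, hr₃, hAr⟩ := Metric.uniformContinuousOn_iff.1
    (hE.uniformContinuousOn_of_continuous hA) η₃ hη₃0
  set r₁ := min r (min r₂ (r₃ / 2)) with hr₁
  have hr₁0 : 0 < r₁ := by positivity
  have h1r : r₁ ≤ r := min_le_left _ _
  have h1r2 : r₁ ≤ r₂ := (min_le_right _ _).trans (min_le_left _ _)
  have h1r3 : r₁ < r₃ := ((min_le_right _ _).trans (min_le_right _ _)).trans_lt (half_lt_self hr₃)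
  filter_upwards [hunif η₃ hη₃0, hfar, eventually_abs_mul_le ht (b + η) hr₁0,
    eventually_abs_mul_le ht M (half_pos hr₁0),
    eventually_abs_mul_le ht C (show 0 < r₁ * ε / 4 by positivity)]
    with n hn hfn hs1 hs2 hs3 q hq hfq
  have hfq0 : 0 < f q := hε.trans hfq
  have htn : 0 < |t n| := abs_pos.2 (ht0 n)
  have hqE := hDE' hq
  set c := A q / f q with hc
  have hcb : |c| ≤ b := by
    rw [hc, hb, abs_div, abs_of_pos hfq0]
    exact div_le_div₀ ha0 (ha q hqE) hε hfq.le
  have hfc : f q * c = A q := mul_div_cancel₀ _ hfq0.ne'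
  have htc : |t n * c| ≤ |t n| * b := by
    rw [abs_mul]; exact mul_le_mul_of_nonneg_left hcb htn.le
  have htη : 0 < |t n| * η := by positivity
  have htb : 0 ≤ |t n| * b := by positivity
  have hs1' : |t n| * b + |t n| * η < r₁ := by rwa [← mul_add]
  -- the expansion of `Fn n` at points near `q`
  have near : ∀ s, |-(t n * c) - s| ≤ r₁ → q + (-(t n * c) - s) ∈ E ∧
      |Fn n (q + (-(t n * c) - s)) - F q + f q * s| ≤ η₂ * |s| + |t n| * (ε * η / 4) := by
    intro s hs
    set y := -(t n * c) - s with hy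
    have hqy : q + y ∈ E := hDE q hq (by
      rw [Metric.mem_closedBall, Real.dist_eq, add_sub_cancel_left]; exact hs.trans h1r)
    refine ⟨hqy, ?_⟩
    have e1 := hn (q + y) hqy
    have e2 := hFr q hq y (hs.trans h1r2)
    have e3 : |A (q + y) - A q| ≤ η₃ := by
      have := hAr (q + y) hqy q hqE (by
        rw [Real.dist_eq, add_sub_cancel_left]; exact hs.trans_lt h1r3)
      rw [Real.dist_eq] at this
      exact this.le
    have e4 : |t n * (A (q + y) - A q)| ≤ |t n| * η₃ := by
      rw [abs_mul]; exact mul_le_mul_of_nonneg_left e3 htn.le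
    have e5 : |y| ≤ |t n| * b + |s| := by
      refine (abs_sub _ _).trans ?_
      rw [abs_neg]
      linarith
    have e6 : η₂ * |y| ≤ |t n| * (ε * η / 8) + η₂ * |s| := by
      have h1 := mul_le_mul_of_nonneg_left e5 hη₂0.le
      have h2 := mul_le_mul_of_nonneg_left hη₂b htn.le
      nlinarith
    -- At the predicted shift `-t n * c` the first-order terms cancel because `f q * c = A q`, which
    -- leaves three small errors.
    have e7 : Fn n (q + y) - F q + f q * s = (Fn n (q + y) - F (q + y) - t n * A (q + y)) +
        (F (q + y) - F q - y * f q) + t n * (A (q + y) - A q) := by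
      rw [hy]
      linear_combination -t n * hfc
    rw [e7]
    refine (abs_add_three _ _ _).trans ?_
    have e8 : η₃ * |t n| = |t n| * (ε * η / 16) := by rw [hη₃]; ring
    have e9 : |t n| * η₃ = |t n| * (ε * η / 16) := by rw [hη₃]
    linarith
  have hlow : ∀ δ ∈ {δ | δ ∈ 𝒱 ∧ F q ≤ Fn n δ}, q - t n * c - |t n| * η ≤ δ := by
    rintro δ ⟨hδ𝒱, hδ⟩
    by_contra! hlt
    refine absurd hδ (not_le.2 ?_)
    -- Points of `𝒱` far below `q` may lie outside `E`, where the expansion is unavailable. There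
    -- `hfar` and monotonicity give a value at most `F (q - r₁ / 2) + |t n| * C`, which is below `F
    -- q`. Near `q` the slope wins.
    rcases lt_or_ge δ (q - r₁) with hfarδ | hnear
    · have h1 := hfn δ hδ𝒱
      have h2 : F (δ + |t n| * M) ≤ F (q + -(r₁ / 2)) := hmono (by linarith)
      have h3 := (abs_le.1 (hFr q hq (-(r₁ / 2)) (by
        rw [abs_neg, abs_of_pos (half_pos hr₁0)]; linarith))).2
      rw [abs_neg, abs_of_pos (half_pos hr₁0)] at h3
      have h4 : η₂ * (r₁ / 2) ≤ ε / 2 * (r₁ / 2) :=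
        mul_le_mul_of_nonneg_right hη₂ε (half_pos hr₁0).le
      have h5 : ε * (r₁ / 2) ≤ f q * (r₁ / 2) :=
        mul_le_mul_of_nonneg_right hfq.le (half_pos hr₁0).le
      linarith
    · set s := q - t n * c - δ with hs
      have hs0 : |t n| * η < s := by linarith
      have hδs : q + (-(t n * c) - s) = δ := by rw [hs]; ring
      have hy : |-(t n * c) - s| ≤ r₁ := by
        rw [show -(t n * c) - s = δ - q by linarith, abs_le]
        exact ⟨by linarith, by linarith [neg_abs_le (t n * c)]⟩
      have h1 := (abs_le.1 (near s hy).2).2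
      rw [hδs, abs_of_pos (htη.trans hs0)] at h1
      have h2 : ε * s ≤ f q * s := mul_le_mul_of_nonneg_right hfq.le (htη.trans hs0).le
      have h3 : η₂ * s ≤ ε / 2 * s := mul_le_mul_of_nonneg_right hη₂ε (htη.trans hs0).le
      have h4 : ε / 2 * (|t n| * η) < ε / 2 * s := mul_lt_mul_of_pos_left hs0 (half_pos hε)
      have h5 : 0 < |t n| * (ε * η) := by positivity
      linarith
  -- The near expansion with `s = -|t n| * η`: the gain of at least `ε * η * |t n|` exceeds the
  -- errors, at most three quarters of it.
  have hmem : q - t n * c + |t n| * η ∈ {δ | δ ∈ 𝒱 ∧ F q ≤ Fn n δ} := by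
    have hs : |-(t n * c) - -(|t n| * η)| ≤ r₁ := by
      refine (abs_sub _ _).trans ?_
      rw [abs_neg, abs_neg, abs_of_pos htη]
      linarith
    have h0 : q + (-(t n * c) - -(|t n| * η)) = q - t n * c + |t n| * η := by ring
    obtain ⟨h1, h2⟩ := near _ hs
    rw [h0] at h1 h2
    refine ⟨hE𝒱 h1, ?_⟩
    have h3 := (abs_le.1 h2).1
    rw [abs_neg, abs_of_pos htη] at h3
    have h4 : ε * (|t n| * η) ≤ f q * (|t n| * η) := mul_le_mul_of_nonneg_right hfq.le htη.le
    have h5 : η₂ * (|t n| * η) ≤ ε / 2 * (|t n| * η) := mul_le_mul_of_nonneg_right hη₂ε htη.le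
    have h6 : 0 < |t n| * (ε * η) := by positivity
    linarith
  have hbdd : BddBelow {δ | δ ∈ 𝒱 ∧ F q ≤ Fn n δ} := ⟨_, hlow⟩
  refine ⟨⟨_, hmem⟩, hbdd, ?_⟩
  have h1 := csInf_le hbdd hmem
  have h2 := le_csInf ⟨_, hmem⟩ hlow
  rw [abs_le]
  constructor <;> linarith

/-! ### From functions and measures on `B` to the ambient space -/

section Bridge

variable {d : ℕ} {X B : Set (EuclideanSpace ℝ (Fin d))} {Δ : EuclideanSpace ℝ (Fin d) → ℝ}

/-- The extension by zero of a function on `B`. -/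
noncomputable def zeroExtend {Y : Type*} {B : Set Y} (g : B → ℝ) : Y → ℝ :=
  Function.extend Subtype.val g 0

@[simp]
lemma zeroExtend_coe {Y : Type*} {B : Set Y} (g : B → ℝ) (x : B) : zeroExtend g x = g x :=
  Subtype.val_injective.extend_apply g 0 x

lemma zeroExtend_of_notMem {Y : Type*} {B : Set Y} (g : B → ℝ) {x : Y} (hx : x ∉ B) :
    zeroExtend g x = 0 :=
  Function.extend_apply' (f := (Subtype.val : B → Y)) g (0 : Y → ℝ) x fun ⟨y, hy⟩ => hx (hy ▸ y.2)

lemma continuousOn_zeroExtend {Y : Type*} [TopologicalSpace Y] {B : Set Y} {g : B → ℝ}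
    (hg : Continuous g) : ContinuousOn (zeroExtend g) B := by
  rw [continuousOn_iff_continuous_domRestrict]
  convert hg using 1
  ext x
  simp

lemma tsupport_zeroExtend_subset {Y : Type*} [TopologicalSpace Y] {X B : Set Y} {g : B → ℝ}
    (h0 : ∀ x : B, x.1 ∉ X → g x = 0) : tsupport (zeroExtend g) ⊆ closure X := by
  refine closure_mono fun x hx => by_contra fun hxX => hx ?_
  by_cases hxB : x ∈ B
  · exact (zeroExtend_coe g ⟨x, hxB⟩).trans (h0 ⟨x, hxB⟩ hxX)
  · exact zeroExtend_of_notMem g hxB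

lemma continuous_zeroExtend {Y : Type*} [TopologicalSpace Y] {X B : Set Y} (hB : IsOpen B)
    (hXB : closure X ⊆ B) {g : B → ℝ} (hg : Continuous g)
    (h0 : ∀ x : B, x.1 ∉ X → g x = 0) : Continuous (zeroExtend g) :=
  (continuousOn_zeroExtend hg).continuous_of_tsupport_subset hB
    ((tsupport_zeroExtend_subset h0).trans hXB)

lemma zeroExtend_nonneg {Y : Type*} {B : Set Y} {g : B → ℝ} (h0 : ∀ x, 0 ≤ g x) (x : Y) :
    0 ≤ zeroExtend g x := by
  by_cases hx : x ∈ B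
  · exact (h0 ⟨x, hx⟩).trans_eq (zeroExtend_coe g ⟨x, hx⟩).symm
  · exact (zeroExtend_of_notMem g hx).ge

lemma lowerIntegral_congr {Δ₁ Δ₂ f : EuclideanSpace ℝ (Fin d) → ℝ} (h : ∀ x ∈ B, Δ₁ x = Δ₂ x)
    (δ : ℝ) : lowerIntegral B Δ₁ f δ = lowerIntegral B Δ₂ f δ := by
  have : {x | x ∈ B ∧ Δ₁ x ≤ δ} = {x | x ∈ B ∧ Δ₂ x ≤ δ} := by
    ext x
    exact and_congr_right fun hx => by rw [h x hx]
  rw [lowerIntegral, lowerIntegral, this]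

/-- Push forward along the inclusion. A general `φ` is allowed because both `Δ` and its
perturbations are inserted. -/
lemma measureReal_setOf_le_eq_lowerIntegral (hB : IsOpen B) {μ : Measure B} {p : B → ℝ}
    (hp : Continuous p) (hp_nonneg : ∀ x, 0 ≤ p x)
    (hμ : μ = (Measure.comap Subtype.val volume).withDensity fun x => ENNReal.ofReal (p x))
    {φ : B → ℝ} (hφ : Continuous φ) (δ : ℝ) :
    μ.real {x | φ x ≤ δ} = lowerIntegral B (zeroExtend φ) (zeroExtend p) δ := by
  have hm : MeasurableSet {x | φ x ≤ δ} := (isClosed_le hφ continuous_const).measurableSet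
  have hS := measurableSet_setOf_mem_and_le hB (continuousOn_zeroExtend hφ) δ
  have himg : Subtype.val '' {x | φ x ≤ δ} = {x | x ∈ B ∧ zeroExtend φ x ≤ δ} := by
    ext x
    constructor
    · rintro ⟨y, hy, rfl⟩
      exact ⟨y.2, by rwa [zeroExtend_coe]⟩
    · rintro ⟨hx, hxδ⟩
      exact ⟨⟨x, hx⟩, (zeroExtend_coe φ ⟨x, hx⟩).symm.trans_le hxδ, rfl⟩
  have he := MeasurableEmbedding.subtype_coe hB.measurableSet
  have hpre : {x : B | φ x ≤ δ} = Subtype.val ⁻¹' {x | x ∈ B ∧ zeroExtend φ x ≤ δ} := by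
    rw [← himg, preimage_image_eq _ Subtype.val_injective]
  have h1 : μ {x | φ x ≤ δ} =
      ∫⁻ x in {x | x ∈ B ∧ zeroExtend φ x ≤ δ}, ENNReal.ofReal (zeroExtend p x) := by
    rw [hμ, withDensity_apply _ hm]
    have h2 : ∫⁻ x in {x | φ x ≤ δ}, ENNReal.ofReal (p x) ∂(Measure.comap Subtype.val volume) =
        ∫⁻ x in {x | φ x ≤ δ}, ENNReal.ofReal (zeroExtend p x.1)
          ∂(Measure.comap Subtype.val volume) := by
      simp only [zeroExtend_coe]
    rw [h2, hpre, ← he.lintegral_map (fun x => ENNReal.ofReal (zeroExtend p x)),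
      ← he.restrict_map, he.map_comap,
      Subtype.range_coe, Measure.restrict_restrict hS, inter_eq_left.2 fun x hx => hx.1]
  rw [Measure.real, h1, lowerIntegral, integral_eq_lintegral_of_nonneg_ae
    (Eventually.of_forall fun x => zeroExtend_nonneg hp_nonneg x)]
  exact (((continuousOn_zeroExtend hp).mono fun x hx => hx.1).aemeasurable hS).aestronglyMeasurable

lemma cdf_eq_lowerIntegral (hB : IsOpen B) (hΔ : ContinuousOn Δ B) {μ : Measure B} {p : B → ℝ}
    (hp : Continuous p) (hp_nonneg : ∀ x, 0 ≤ p x)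
    (hμ : μ = (Measure.comap Subtype.val volume).withDensity fun x => ENNReal.ofReal (p x)) :
    cdf μ Δ = lowerIntegral B Δ (zeroExtend p) := by
  ext δ
  have h := measureReal_setOf_le_eq_lowerIntegral hB hp hp_nonneg hμ
    (continuousOn_iff_continuous_domRestrict.1 hΔ) δ
  rw [lowerIntegral_congr (Δ₂ := Δ)] at h
  · exact h
  · exact fun x hx => zeroExtend_coe _ ⟨x, hx⟩

lemma map_surfaceVol : Measure.map Subtype.val (surfaceVol B) =
    (μHE[Module.finrank ℝ (EuclideanSpace ℝ (Fin d)) - 1] :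
      Measure (EuclideanSpace ℝ (Fin d))).restrict B := by
  rw [surfaceVol, isometry_subtype_coe.map_euclideanHausdorffMeasure, Subtype.range_coe,
    finrank_euclideanSpace_fin]

lemma zeroExtend_mul_div (G p : B → ℝ) (x : B) :
    zeroExtend G x * zeroExtend p x / ‖gradient Δ x.1‖ = G x * p x / ‖gradient Δ x.1‖ := by
  simp

lemma measurableSet_coe_preimage_level (hΔ : ContinuousOn Δ B) (δ : ℝ) :
    MeasurableSet {x : B | Δ x = δ} :=
  (isClosed_eq (continuousOn_iff_continuous_domRestrict.1 hΔ) continuous_const).measurableSet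

/-- The density vanishes off `X`, so the part of the level set in `B` outside `X` contributes
nothing; the inclusion of `B` is an isometry. -/
lemma levelIntegral_eq_levelSetIntegral (hB : IsOpen B) (hΔ : ContinuousOn Δ B) {p : B → ℝ}
    (hp_zero : ∀ x : B, x.1 ∉ X → p x = 0) (G : B → ℝ) (δ : ℝ) :
    levelIntegral X Δ p G δ =
      levelSetIntegral B Δ (fun x => zeroExtend G x * zeroExtend p x) δ := by
  have he := MeasurableEmbedding.subtype_coe hB.measurableSet
  have h1 : levelIntegral X Δ p G δ =
      ∫ x in {x : B | Δ x = δ}, G x * p x / ‖gradient Δ x.1‖ ∂(surfaceVol B) := by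
    refine (setIntegral_eq_of_subset_of_forall_sdiff_eq_zero
      (measurableSet_coe_preimage_level hΔ δ) (fun x hx => hx.2) fun x hx => ?_).symm
    have hxX : x.1 ∉ X := fun h => hx.2 ⟨h, hx.1⟩
    simp [hp_zero x hxX]
  have hpre : {x : B | Δ x = δ} = Subtype.val ⁻¹' {x | Δ x = δ} := rfl
  have h2 : {x | x ∈ B ∧ Δ x = δ} = {x | Δ x = δ} ∩ B := by
    ext x; exact and_comm
  have h3 := he.setIntegral_map (μ := surfaceVol B)
    (fun x => zeroExtend G x * zeroExtend p x / ‖gradient Δ x‖) {x | x ∈ B ∧ Δ x = δ}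
  have h4 : (Subtype.val ⁻¹' {x | x ∈ B ∧ Δ x = δ} : Set B) = {x : B | Δ x = δ} := by
    ext x; exact and_iff_right x.2
  rw [h4, map_surfaceVol, Measure.restrict_restrict
    (measurableSet_setOf_mem_and_eq hB hΔ δ), inter_eq_left.2 fun x hx => hx.1] at h3
  rw [h1, levelSetIntegral, h3]
  simp only [zeroExtend_mul_div]

/-- Everything the geometry gives at a regular value `δ`, for a weight `G`. -/
lemma level_facts (hXc : IsCompact (closure X)) (hB : IsOpen B) (hXB : closure X ⊆ B)
    (hΔ : ContDiffOn ℝ 1 Δ B) {p : B → ℝ} (hp : Continuous p)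
    (hp_zero : ∀ x : B, x.1 ∉ X → p x = 0) {δ : ℝ} (hδ : IsRegularValueOn Δ (closure X) δ)
    {G : B → ℝ} (hG : Continuous G) :
    IntegrableOn (fun x : B => G x * p x / ‖gradient Δ x.1‖) {x : B | Δ x = δ} (surfaceVol B) ∧
      ContinuousAt (levelIntegral X Δ p G) δ := by
  have hpc := continuous_zeroExtend hB hXB hp hp_zero
  have hps := tsupport_zeroExtend_subset hp_zero
  obtain ⟨h1, -, h2⟩ := integrableOn_and_hasDerivAt_lowerIntegral hB hΔ hXc hXB
    (continuous_mul_of_tsupport_subset hB (continuousOn_zeroExtend hG) hpc (hps.trans hXB))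
    ((tsupport_mul_subset_right).trans hps) hδ
  have he := MeasurableEmbedding.subtype_coe hB.measurableSet
  refine ⟨?_, ?_⟩
  · have h3 : IntegrableOn (fun x => zeroExtend G x * zeroExtend p x / ‖gradient Δ x‖)
        {x | x ∈ B ∧ Δ x = δ} (Measure.map Subtype.val (surfaceVol B)) := by
      rw [map_surfaceVol]
      exact h1.mono_measure Measure.restrict_le_self
    rw [he.integrableOn_map_iff] at h3
    have h4 : (Subtype.val ⁻¹' {x | x ∈ B ∧ Δ x = δ} : Set B) = {x : B | Δ x = δ} := by
      ext x; exact and_iff_right x.2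
    rw [h4] at h3
    refine h3.congr (Eventually.of_forall fun x => ?_)
    exact zeroExtend_mul_div G p x
  · rw [show levelIntegral X Δ p G = _ from
      funext (levelIntegral_eq_levelSetIntegral hB hΔ.continuousOn hp_zero G)]
    exact h2

lemma density_eq_levelSetIntegral (hB : IsOpen B) (hΔ : ContinuousOn Δ B) {p : B → ℝ}
    (hp_zero : ∀ x : B, x.1 ∉ X → p x = 0) (δ : ℝ) :
    density X Δ p δ = levelSetIntegral B Δ (zeroExtend p) δ := by
  rw [density, levelIntegral_eq_levelSetIntegral hB hΔ hp_zero]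
  congr 1
  ext x
  by_cases hx : x ∈ B
  · rw [zeroExtend_coe _ ⟨x, hx⟩, one_mul]
  · rw [zeroExtend_of_notMem p hx, mul_zero]

lemma hasDerivAt_cdf (hXc : IsCompact (closure X)) (hB : IsOpen B) (hXB : closure X ⊆ B)
    (hΔ : ContDiffOn ℝ 1 Δ B) {μ : Measure B} {p : B → ℝ} (hp : Continuous p)
    (hp_nonneg : ∀ x, 0 ≤ p x) (hp_zero : ∀ x : B, x.1 ∉ X → p x = 0)
    (hμ : μ = (Measure.comap Subtype.val volume).withDensity fun x => ENNReal.ofReal (p x))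
    {δ : ℝ} (hδ : IsRegularValueOn Δ (closure X) δ) :
    HasDerivAt (cdf μ Δ) (density X Δ p δ) δ := by
  rw [cdf_eq_lowerIntegral hB hΔ.continuousOn hp hp_nonneg hμ,
    density_eq_levelSetIntegral hB hΔ.continuousOn hp_zero]
  exact (integrableOn_and_hasDerivAt_lowerIntegral hB hΔ hXc hXB
    (continuous_zeroExtend hB hXB hp hp_zero) (tsupport_zeroExtend_subset hp_zero) hδ).2.1

lemma ae_mem_of_density {μ : Measure B} {p : B → ℝ} (hp : Continuous p)
    (hp_zero : ∀ x : B, x.1 ∉ X → p x = 0)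
    (hμ : μ = (Measure.comap Subtype.val volume).withDensity fun x => ENNReal.ofReal (p x)) :
    ∀ᵐ x ∂μ, x.1 ∈ X := by
  rw [hμ, ae_withDensity_iff (by fun_prop)]
  refine Eventually.of_forall fun x hx => by_contra fun hxX => hx ?_
  rw [hp_zero x hxX, ENNReal.ofReal_zero]

lemma monotone_cdf (μ : Measure B) [IsProbabilityMeasure μ] : Monotone (cdf μ Δ) :=
  fun _ _ h => measureReal_mono fun _ hx => le_trans hx h

/-- A Lipschitz bound in `G` for the sup norm with constant `density X Δ p δ`, which is locally
bounded in `δ`; joint continuity of the derivative depends on it. -/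
lemma abs_levelIntegral_sub_le (hXc : IsCompact (closure X)) (hB : IsOpen B)
    (hXB : closure X ⊆ B) (hΔ : ContDiffOn ℝ 1 Δ B) {p : B → ℝ} (hp : Continuous p)
    (hp_nonneg : ∀ x, 0 ≤ p x) (hp_zero : ∀ x : B, x.1 ∉ X → p x = 0) {δ : ℝ}
    (hδ : IsRegularValueOn Δ (closure X) δ) {G G' : B → ℝ} (hG : Continuous G)
    (hG' : Continuous G') {η : ℝ} (h : ∀ x, |G x - G' x| ≤ η) :
    |levelIntegral X Δ p G δ - levelIntegral X Δ p G' δ| ≤ η * density X Δ p δ := by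
  have hsub : {x : B | x.1 ∈ levelSet X Δ δ} ⊆ {x : B | Δ x = δ} := fun x hx => hx.2
  have i1 := (level_facts hXc hB hXB hΔ hp hp_zero hδ hG).1.mono_set hsub
  have i2 := (level_facts hXc hB hXB hΔ hp hp_zero hδ hG').1.mono_set hsub
  have i3 := (level_facts hXc hB hXB hΔ hp hp_zero hδ (continuous_const (y := (1 : ℝ)))).1.mono_set
    hsub
  rw [density, levelIntegral, levelIntegral, levelIntegral, ← integral_sub i1 i2,
    ← integral_const_mul, ← Real.norm_eq_abs]
  refine norm_integral_le_of_norm_le (i3.const_mul η) (Eventually.of_forall fun x => ?_)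
  rw [← sub_div, ← sub_mul, norm_div, norm_mul, Real.norm_eq_abs, Real.norm_of_nonneg (hp_nonneg x),
    norm_norm, one_mul, ← mul_div_assoc]
  exact div_le_div_of_nonneg_right (mul_le_mul_of_nonneg_right (h x) (hp_nonneg x)) (norm_nonneg _)

end Bridge

/-! ### Estimates in `𝔽` and `ℍ` -/

section Spaces

variable {d : ℕ} {B : Set (EuclideanSpace ℝ (Fin d))}

lemma eventually_toFn_sub_lt (g₀ : contSpace B) {η : ℝ} (hη : 0 < η) :
    ∀ᶠ g in 𝓝 g₀, ∀ x, |toFn g x - toFn g₀ x| < η := by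
  have h : Tendsto (fun g : contSpace B => (g : B →ᵤ ℝ)) (𝓝 g₀) (𝓝 (g₀ : B →ᵤ ℝ)) :=
    continuous_subtype_val.tendsto g₀
  rw [UniformFun.tendsto_iff_tendstoUniformly, Metric.tendstoUniformly_iff] at h
  filter_upwards [h η hη] with g hg x
  have := hg x
  rw [dist_comm, Real.dist_eq] at this
  exact this

lemma eventually_evalOp_sub_lt {μ : Measure B} {𝒢 : Set (B → ℝ)} (H₀ : opSpace μ 𝒢) {η : ℝ}
    (hη : 0 < η) : ∀ᶠ H in 𝓝 H₀, ∀ g, |evalOp H g - evalOp H₀ g| < η := by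
  have h : Tendsto (fun H : opSpace μ 𝒢 => (H : 𝒢 →ᵤ ℝ)) (𝓝 H₀) (𝓝 (H₀ : 𝒢 →ᵤ ℝ)) :=
    continuous_subtype_val.tendsto H₀
  rw [UniformFun.tendsto_iff_tendstoUniformly, Metric.tendstoUniformly_iff] at h
  filter_upwards [h η hη] with H hH g
  by_cases hg : g ∈ 𝒢
  · have := hH ⟨g, hg⟩
    rw [dist_comm, Real.dist_eq] at this
    simp only [evalOp, dif_pos hg]
    exact this
  · simpa only [evalOp, dif_neg hg, sub_zero, abs_zero] using hη

lemma exists_abs_evalOp_le {μ : Measure B} {𝒢 : Set (B → ℝ)} (H : opSpace μ 𝒢) :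
    ∃ C, ∀ g, |evalOp H g| ≤ C := by
  obtain ⟨C, hC⟩ := H.2.1
  refine ⟨max C 0, fun g => ?_⟩
  by_cases hg : g ∈ 𝒢
  · simpa only [evalOp, dif_pos hg] using (hC ⟨g, hg⟩).trans (le_max_left _ _)
  · simp [evalOp, hg]

@[simp]
lemma evalOp_add {μ : Measure B} {𝒢 : Set (B → ℝ)} (H H' : opSpace μ 𝒢) (g : B → ℝ) :
    evalOp (H + H') g = evalOp H g + evalOp H' g := by
  by_cases hg : g ∈ 𝒢
  · simp [evalOp, hg]
  · simp [evalOp, hg]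

@[simp]
lemma evalOp_smul {μ : Measure B} {𝒢 : Set (B → ℝ)} (c : ℝ) (H : opSpace μ 𝒢) (g : B → ℝ) :
    evalOp (c • H) g = c * evalOp H g := by
  by_cases hg : g ∈ 𝒢
  · simp [evalOp, hg]
  · simp [evalOp, hg]

lemma measurable_of_mem_indClass {ℱ : Set (contSpace B)} {𝒱 : Set ℝ} {g : B → ℝ}
    (hg : g ∈ indClass ℱ 𝒱) : Measurable g := by
  obtain ⟨f, -, δ, -, rfl⟩ := hg
  exact measurable_one.indicator (isClosed_le f.2 continuous_const).measurableSet

/-- Elements of `ℍ` are uniformly continuous for the measure of the set where two indicators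
differ. -/
lemma exists_forall_evalOp_sub_lt {μ : Measure B} {ℱ : Set (contSpace B)}
    {𝒱 : Set ℝ} (H : opSpace μ (indClass ℱ 𝒱)) {e : ℝ} (he : 0 < e) :
    ∃ κ > 0, ∀ g₁ ∈ indClass ℱ 𝒱, ∀ g₂ ∈ indClass ℱ 𝒱,
      μ {x | g₁ x ≠ g₂ x} < ENNReal.ofReal κ → |evalOp H g₁ - evalOp H g₂| < e := by
  obtain ⟨r, hr, h⟩ := H.2.2.2 e he
  -- The `L²` norm of an indicator is the square root of the measure of its set.
  refine ⟨r ^ 2, by positivity, fun g₁ h₁ g₂ h₂ hlt => ?_⟩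
  have key := h ⟨g₁, h₁⟩ ⟨g₂, h₂⟩
  simp only [evalOp, dif_pos h₁, dif_pos h₂]
  refine key ?_
  set T := {x | g₁ x ≠ g₂ x} with hT
  have hTm : MeasurableSet T :=
    (measurableSet_eq_fun (measurable_of_mem_indClass h₁) (measurable_of_mem_indClass h₂)).compl
  have hle : eLpNorm (g₁ - g₂) 2 μ ≤ eLpNorm (T.indicator fun _ => (1 : ℝ)) 2 μ := by
    refine eLpNorm_mono fun x => ?_
    by_cases hx : g₁ x = g₂ x
    · simp [hx]
    · rw [indicator_of_mem (show x ∈ T from hx), norm_one, Pi.sub_apply, Real.norm_eq_abs]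
      have hb : ∀ g ∈ indClass ℱ 𝒱, 0 ≤ g x ∧ g x ≤ 1 := by
        rintro g ⟨f, -, δ, -, rfl⟩
        exact ⟨indicator_nonneg (fun _ _ => zero_le_one) x,
          indicator_le_self' (fun _ _ => zero_le_one) x⟩
      obtain ⟨a1, a2⟩ := hb g₁ h₁
      obtain ⟨b1, b2⟩ := hb g₂ h₂
      rw [abs_le]
      constructor <;> linarith
  refine hle.trans_lt ?_
  rw [eLpNorm_indicator_const hTm two_ne_zero ENNReal.ofNat_ne_top, enorm_one, one_mul]
  have h2 : ENNReal.ofReal r = (ENNReal.ofReal (r ^ 2)) ^ (1 / (2 : ℝ≥0∞).toReal) := by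
    rw [ENNReal.ofReal_rpow_of_pos (by positivity), ← Real.rpow_natCast, ← Real.rpow_mul hr.le]
    norm_num
  rw [h2]
  exact ENNReal.rpow_lt_rpow hlt (by norm_num)

end Spaces

/-! ### The distribution operator -/

/-- The standing assumptions on the domain, the function `Δ` and the distribution `μ`. -/
structure IsSetting {d : ℕ} (X B : Set (EuclideanSpace ℝ (Fin d)))
    (Δ : EuclideanSpace ℝ (Fin d) → ℝ) (μ : Measure B) (p : B → ℝ) : Prop where
  isCompact : IsCompact (closure X)
  isOpen : IsOpen B
  subset : closure X ⊆ B
  contDiffOn : ContDiffOn ℝ 1 Δ B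
  continuous : Continuous p
  nonneg : ∀ x, 0 ≤ p x
  zero : ∀ x : B, x.1 ∉ X → p x = 0
  eq_withDensity : μ = (Measure.comap Subtype.val volume).withDensity fun x => ENNReal.ofReal (p x)

variable {d : ℕ} {X B : Set (EuclideanSpace ℝ (Fin d))} {Δ : EuclideanSpace ℝ (Fin d) → ℝ}
  {μ : Measure B} {p : B → ℝ}

namespace IsSetting

lemma hasDerivAt_cdf (S : IsSetting X B Δ μ p) {δ : ℝ} (hδ : IsRegularValueOn Δ (closure X) δ) :
    HasDerivAt (cdf μ Δ) (density X Δ p δ) δ :=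
  SortedEffects.hasDerivAt_cdf S.isCompact S.isOpen S.subset S.contDiffOn S.continuous S.nonneg
    S.zero S.eq_withDensity hδ

lemma integrableOn (S : IsSetting X B Δ μ p) {δ : ℝ} (hδ : IsRegularValueOn Δ (closure X) δ)
    {G : B → ℝ} (hG : Continuous G) :
    IntegrableOn (fun x : B => G x * p x / ‖gradient Δ x.1‖) {x : B | x.1 ∈ levelSet X Δ δ}
      (surfaceVol B) :=
  (level_facts S.isCompact S.isOpen S.subset S.contDiffOn S.continuous S.zero hδ hG).1.mono_set
    fun _ hx => hx.2

lemma continuousAt_levelIntegral (S : IsSetting X B Δ μ p) {δ : ℝ}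
    (hδ : IsRegularValueOn Δ (closure X) δ) {G : B → ℝ} (hG : Continuous G) :
    ContinuousAt (levelIntegral X Δ p G) δ :=
  (level_facts S.isCompact S.isOpen S.subset S.contDiffOn S.continuous S.zero hδ hG).2

lemma continuousAt_density (S : IsSetting X B Δ μ p) {δ : ℝ}
    (hδ : IsRegularValueOn Δ (closure X) δ) : ContinuousAt (density X Δ p) δ :=
  S.continuousAt_levelIntegral hδ continuous_const

lemma isOpen_regular (S : IsSetting X B Δ μ p) :
    IsOpen {δ | IsRegularValueOn Δ (closure X) δ} :=
  isOpen_setOf_regular S.isOpen S.contDiffOn S.isCompact S.subset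

lemma continuous_domRestrict (S : IsSetting X B Δ μ p) : Continuous (B.domRestrict Δ) :=
  continuousOn_iff_continuous_domRestrict.1 S.contDiffOn.continuousOn

lemma ae_mem (S : IsSetting X B Δ μ p) : ∀ᵐ x ∂μ, x.1 ∈ closure X :=
  (ae_mem_of_density S.continuous S.zero S.eq_withDensity).mono fun _ hx => subset_closure hx

/-- Elements of `𝔽` may be unbounded on `B`; a bound on the compact set `closure X`, which carries
`μ`, suffices. -/
lemma exists_bound (S : IsSetting X B Δ μ p) {G : B → ℝ} (hG : Continuous G) :
    ∃ M, 0 ≤ M ∧ ∀ x : B, x.1 ∈ closure X → |G x| ≤ M := by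
  obtain ⟨M, hM⟩ := S.isCompact.exists_bound_of_continuousOn
    ((continuousOn_zeroExtend hG).mono S.subset)
  refine ⟨max M 0, le_max_right _ _, fun x hx => ?_⟩
  have := hM x hx
  rw [zeroExtend_coe] at this
  exact this.trans (le_max_left _ _)

lemma exists_eventually_bound (S : IsSetting X B Δ μ p) {G : contSpace B} {Gn : ℕ → contSpace B}
    (hG : Tendsto Gn atTop (𝓝 G)) :
    ∃ M, 0 ≤ M ∧ ∀ᶠ n in atTop, ∀ x : B, x.1 ∈ closure X → |toFn (Gn n) x| ≤ M := by
  obtain ⟨M, hM0, hM⟩ := S.exists_bound G.2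
  refine ⟨M + 1, by positivity, ?_⟩
  filter_upwards [hG.eventually (eventually_toFn_sub_lt G one_pos)] with n hn x hx
  have h1 := abs_add_le (toFn (Gn n) x - toFn G x) (toFn G x)
  rw [sub_add_cancel] at h1
  linarith [hn x, hM x hx]

/-- The perturbed distribution function, up to `o(t n)`. -/
lemma eventually_measureReal_sub_le (S : IsSetting X B Δ μ p) {D : Set ℝ} (hD : IsCompact D)
    (hreg : ∀ δ ∈ D, IsRegularValueOn Δ (closure X) δ) {t : ℕ → ℝ} (ht : Tendsto t atTop (𝓝 0))
    {G : contSpace B} {Gn : ℕ → contSpace B} (hG : Tendsto Gn atTop (𝓝 G)) {η : ℝ} (hη : 0 < η) :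
    ∀ᶠ n in atTop, ∀ δ ∈ D, |μ.real {x : B | Δ x + t n * toFn (Gn n) x ≤ δ} - cdf μ Δ δ +
      t n * levelIntegral X Δ p (toFn G) δ| ≤ η * |t n| := by
  have key := eventually_abs_lowerIntegral_sub_le S.isOpen S.contDiffOn S.isCompact S.subset
    (continuous_zeroExtend S.isOpen S.subset S.continuous S.zero)
    (tsupport_zeroExtend_subset S.zero) (zeroExtend_nonneg S.nonneg) hD hreg ht
    (G := zeroExtend (toFn G)) (Gn := fun n => zeroExtend (toFn (Gn n)))
    (continuousOn_zeroExtend G.2) (fun n => continuousOn_zeroExtend (Gn n).2)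
    (fun η hη => (hG.eventually (eventually_toFn_sub_lt G hη)).mono fun n hn x hx => by
      have hxB := S.subset hx
      have := hn ⟨x, hxB⟩
      rw [← zeroExtend_coe (toFn G), ← zeroExtend_coe (toFn (Gn n))] at this
      exact this.le) hη
  filter_upwards [key] with n hn δ hδ
  have hφ : Continuous fun x : B => Δ x + t n * toFn (Gn n) x :=
    S.continuous_domRestrict.add (continuous_const.mul (Gn n).2)
  rw [measureReal_setOf_le_eq_lowerIntegral S.isOpen S.continuous S.nonneg S.eq_withDensity hφ,
    cdf_eq_lowerIntegral S.isOpen S.contDiffOn.continuousOn S.continuous S.nonneg S.eq_withDensity,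
    levelIntegral_eq_levelSetIntegral S.isOpen S.contDiffOn.continuousOn S.zero]
  rw [lowerIntegral_congr (Δ₂ := fun x => Δ x + t n * zeroExtend (toFn (Gn n)) x)]
  · exact hn δ hδ
  · intro x hx
    rw [zeroExtend_coe _ ⟨x, hx⟩, zeroExtend_coe _ ⟨x, hx⟩]

/-- The measure of the set where two indicators differ, one of them of `Δ`. -/
lemma measure_ind_ne_le [IsProbabilityMeasure μ] (S : IsSetting X B Δ μ p) {φ : B → ℝ}
    {δ δ' ρ : ℝ} (hρ : 0 < ρ) (h : ∀ᵐ x ∂μ, |(φ x - δ') - (Δ x - δ)| ≤ ρ) :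
    μ {x | ind φ δ' x ≠ ind (B.domRestrict Δ) δ x} ≤
      ENNReal.ofReal (cdf μ Δ (δ + ρ) - cdf μ Δ (δ - 2 * ρ)) := by
  classical
  have hm : ∀ δ, MeasurableSet {x : B | Δ x ≤ δ} := fun δ =>
    (isClosed_le S.continuous_domRestrict continuous_const).measurableSet
  have hsub : {x : B | Δ x ≤ δ - 2 * ρ} ⊆ {x : B | Δ x ≤ δ + ρ} := fun x hx =>
    le_trans (show Δ x ≤ δ - 2 * ρ from hx) (by linarith)
  -- Where the indicators differ, `Δ x` is almost surely within `ρ` of `δ`; the factor two in the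
  -- lower endpoint is only slack.
  rw [cdf, cdf, ← measureReal_sdiff hsub (hm _), Measure.real,
    ENNReal.ofReal_toReal (measure_ne_top _ _)]
  refine measure_mono_ae ?_
  filter_upwards [h] with x hx hne
  have hne' : ¬ (φ x ≤ δ' ↔ Δ x ≤ δ) := by
    intro hiff
    apply hne
    simp [ind, indicator_apply, domRestrict_apply, hiff]
  obtain ⟨h1, h2⟩ := abs_le.1 hx
  refine ⟨?_, ?_⟩
  · by_contra hcon
    rw [mem_ofPred_eq, not_le] at hcon
    exact hne' ⟨fun h3 => by linarith, fun h3 => by linarith⟩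
  · intro hcon
    rw [mem_ofPred_eq] at hcon
    exact hne' ⟨fun h3 => by linarith, fun h3 => by linarith⟩

/-- Elements of `ℍ` vary little when the indicator of `Δ` is perturbed, uniformly on compact sets
of regular values. -/
lemma exists_evalOp_modulus [IsProbabilityMeasure μ] (S : IsSetting X B Δ μ p)
    {ℱ : Set (contSpace B)} (hΔℱ : restr Δ S.contDiffOn.continuousOn ∈ ℱ) {𝒱 D : Set ℝ}
    (hD : IsCompact D) (hreg : ∀ δ ∈ D, IsRegularValueOn Δ (closure X) δ) (hD𝒱 : D ⊆ 𝒱)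
    (H : opSpace μ (indClass ℱ 𝒱)) {e : ℝ} (he : 0 < e) :
    ∃ ρ > 0, ∀ δ ∈ D, ∀ f ∈ ℱ, ∀ δ' ∈ 𝒱, (∀ᵐ x ∂μ, |(toFn f x - δ') - (Δ x - δ)| ≤ ρ) →
      |evalOp H (ind (toFn f) δ') - evalOp H (ind (B.domRestrict Δ) δ)| < e := by
  obtain ⟨κ, hκ, h⟩ := exists_forall_evalOp_sub_lt H he
  have hu := hD.uniformContinuousAt_of_continuousAt (cdf μ Δ)
    (fun δ hδ => (S.hasDerivAt_cdf (hreg δ hδ)).continuousAt)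
    (Metric.dist_mem_uniformity (half_pos hκ))
  obtain ⟨r, hr, hrr⟩ := Metric.mem_uniformity_dist.1 hu
  -- The two evaluation points of the distribution function are then at distance at most `2 * r / 3
  -- < r` from `δ`.
  refine ⟨r / 3, by positivity, fun δ hδ f hf δ' hδ' hae => ?_⟩
  refine h _ ⟨f, hf, δ', hδ', rfl⟩ _ ⟨_, hΔℱ, δ, hD𝒱 hδ, rfl⟩ ?_
  refine (S.measure_ind_ne_le (by positivity) hae).trans_lt ?_
  rw [ENNReal.ofReal_lt_ofReal_iff hκ]
  have h1 : dist (cdf μ Δ δ) (cdf μ Δ (δ + r / 3)) < κ / 2 :=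
    hrr (by rw [Real.dist_eq, sub_add_cancel_left, abs_neg, abs_of_pos (by positivity)]; linarith) hδ
  have h2 : dist (cdf μ Δ δ) (cdf μ Δ (δ - 2 * (r / 3))) < κ / 2 :=
    hrr (by rw [Real.dist_eq, sub_sub_cancel, abs_of_pos (by positivity)]; linarith) hδ
  rw [Real.dist_eq, abs_lt] at h1 h2
  linarith [h1.1, h2.2]

lemma cdfOp_base [IsProbabilityMeasure μ] (S : IsSetting X B Δ μ p)
    {ℱ : Set (contSpace B)} (hΔℱ : restr Δ S.contDiffOn.continuousOn ∈ ℱ) {𝒱 : Set ℝ} {δ : ℝ}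
    (hδ : δ ∈ 𝒱) :
    cdfOp δ ((restr Δ S.contDiffOn.continuousOn, measureOp μ ℱ 𝒱) : DSpace μ ℱ 𝒱) = cdf μ Δ δ := by
  have hm : MeasurableSet {x : B | Δ x ≤ δ} :=
    (isClosed_le S.continuous_domRestrict continuous_const).measurableSet
  have hmem : ind (toFn (restr Δ S.contDiffOn.continuousOn)) δ ∈ indClass ℱ 𝒱 :=
    ⟨_, hΔℱ, δ, hδ, rfl⟩
  simp only [cdfOp, evalOp, dif_pos hmem]
  change ∫ x, {x : B | Δ x ≤ δ}.indicator 1 x ∂μ = _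
  rw [integral_indicator_one hm, cdf]

/-- Linearity in the operator. The domain condition puts the perturbed indicator in `𝒢`, so `evalOp`
does not take its default value. -/
lemma cdfOp_add_smul [IsProbabilityMeasure μ] (S : IsSetting X B Δ μ p)
    {ℱ : Set (contSpace B)} {𝒱 : Set ℝ} {δ : ℝ} (hδ : δ ∈ 𝒱) {t : ℝ} {h : DSpace μ ℱ 𝒱}
    (hmem : ((restr Δ S.contDiffOn.continuousOn, measureOp μ ℱ 𝒱) : DSpace μ ℱ 𝒱) + t • h ∈
      domain μ ℱ 𝒱) :
    cdfOp δ (((restr Δ S.contDiffOn.continuousOn, measureOp μ ℱ 𝒱) : DSpace μ ℱ 𝒱) + t • h) =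
      μ.real {x : B | Δ x + t * toFn h.1 x ≤ δ} +
        t * evalOp h.2 (ind (toFn (restr Δ S.contDiffOn.continuousOn + t • h.1)) δ) := by
  have hmem' : ind (toFn (restr Δ S.contDiffOn.continuousOn + t • h.1)) δ ∈ indClass ℱ 𝒱 :=
    ⟨_, hmem, δ, hδ, rfl⟩
  have hm : MeasurableSet {x : B | Δ x + t * toFn h.1 x ≤ δ} :=
    (isClosed_le (S.continuous_domRestrict.add (continuous_const.mul h.1.2))
      continuous_const).measurableSet
  have h1 : evalOp (measureOp μ ℱ 𝒱) (ind (toFn (restr Δ S.contDiffOn.continuousOn + t • h.1)) δ) =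
      μ.real {x : B | Δ x + t * toFn h.1 x ≤ δ} := by
    simp only [evalOp, dif_pos hmem']
    change ∫ x, {x : B | Δ x + t * toFn h.1 x ≤ δ}.indicator 1 x ∂μ = _
    rw [integral_indicator_one hm]
  rw [← h1]
  simp only [cdfOp, Prod.snd_add, Prod.fst_add, Prod.smul_snd, Prod.smul_fst, evalOp_add,
    evalOp_smul]

/-- The expansion of the distribution operator, uniformly on compact sets of regular values. -/
theorem eventually_cdfOp_sub_le [IsProbabilityMeasure μ] (S : IsSetting X B Δ μ p)
    {ℱ : Set (contSpace B)} (hΔℱ : restr Δ S.contDiffOn.continuousOn ∈ ℱ) {𝒱 D : Set ℝ}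
    (hD : IsCompact D) (hreg : ∀ δ ∈ D, IsRegularValueOn Δ (closure X) δ) (hD𝒱 : D ⊆ 𝒱)
    {t : ℕ → ℝ} {h : ℕ → DSpace μ ℱ 𝒱} {h₀ : DSpace μ ℱ 𝒱}
    (hseq : IsTangentSeq (domain μ ℱ 𝒱) (tangentSpace μ ℱ 𝒱)
      (restr Δ S.contDiffOn.continuousOn, measureOp μ ℱ 𝒱) t h h₀) {η : ℝ} (hη : 0 < η) :
    ∀ᶠ n in atTop, ∀ δ ∈ D,
      |cdfOp δ (((restr Δ S.contDiffOn.continuousOn, measureOp μ ℱ 𝒱) : DSpace μ ℱ 𝒱) +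
        t n • h n) - cdf μ Δ δ - t n * cdfDeriv X Δ p δ h₀| ≤ η * |t n| := by
  have hG : Tendsto (fun n => (h n).1) atTop (𝓝 h₀.1) :=
    (continuous_fst.tendsto h₀).comp hseq.tendsto_dir
  have hH : Tendsto (fun n => (h n).2) atTop (𝓝 h₀.2) :=
    (continuous_snd.tendsto h₀).comp hseq.tendsto_dir
  obtain ⟨M, hM0, hM⟩ := S.exists_eventually_bound hG
  obtain ⟨ρ, hρ, hmod⟩ := S.exists_evalOp_modulus hΔℱ hD hreg hD𝒱 h₀.2
    (show 0 < η / 4 by positivity)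
  filter_upwards [S.eventually_measureReal_sub_le hD hreg hseq.tendsto_zero hG (half_pos hη), hM,
    eventually_abs_mul_le hseq.tendsto_zero M hρ,
    hH.eventually (eventually_evalOp_sub_lt h₀.2 (show 0 < η / 4 by positivity))]
    with n h1 h2 h3 h4 δ hδ
  have h5 := h1 δ hδ
  set g := ind (toFn (restr Δ S.contDiffOn.continuousOn + t n • (h n).1)) δ with hg
  have h6 : |evalOp h₀.2 g - evalOp h₀.2 (ind (B.domRestrict Δ) δ)| < η / 4 := by
    refine hmod δ hδ _ (hseq.mem_domain n) δ (hD𝒱 hδ) ?_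
    filter_upwards [S.ae_mem] with x hx
    have hval : toFn (restr Δ S.contDiffOn.continuousOn + t n • (h n).1) x =
        Δ x + t n * toFn (h n).1 x := rfl
    change |toFn (restr Δ S.contDiffOn.continuousOn + t n • (h n).1) x - δ - (Δ x - δ)| ≤ ρ
    rw [hval, show Δ x + t n * toFn (h n).1 x - δ - (Δ x - δ) = t n * toFn (h n).1 x by ring,
      abs_mul]
    exact (mul_le_mul_of_nonneg_left (h2 x hx) (abs_nonneg _)).trans h3.le
  have h7 : |t n * (evalOp (h n).2 g - evalOp h₀.2 (ind (B.domRestrict Δ) δ))| ≤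
      |t n| * (η / 2) := by
    rw [abs_mul]
    refine mul_le_mul_of_nonneg_left ?_ (abs_nonneg _)
    have := abs_add_le (evalOp (h n).2 g - evalOp h₀.2 g)
      (evalOp h₀.2 g - evalOp h₀.2 (ind (B.domRestrict Δ) δ))
    rw [sub_add_sub_cancel] at this
    linarith [h4 g]
  rw [S.cdfOp_add_smul (hD𝒱 hδ) (hseq.mem_domain n), cdfDeriv, ← hg]
  calc _ = |(μ.real {x : B | Δ x + t n * toFn (h n).1 x ≤ δ} - cdf μ Δ δ +
        t n * levelIntegral X Δ p (toFn h₀.1) δ) +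
        t n * (evalOp (h n).2 g - evalOp h₀.2 (ind (B.domRestrict Δ) δ))| := by
        congr 1; ring
    _ ≤ _ := (abs_add_le _ _).trans (by linarith)

/-- On `closure X` the perturbation of `Δ` is at most `|t n| * M`, and the operator part is bounded
on `𝒢`. No regularity of `δ` is needed, so this controls the parts of `𝒱` that the expansion does
not reach. -/
lemma exists_eventually_cdfOp_le [IsProbabilityMeasure μ] (S : IsSetting X B Δ μ p)
    {ℱ : Set (contSpace B)} {𝒱 : Set ℝ}
    {t : ℕ → ℝ} {h : ℕ → DSpace μ ℱ 𝒱} {h₀ : DSpace μ ℱ 𝒱}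
    (hseq : IsTangentSeq (domain μ ℱ 𝒱) (tangentSpace μ ℱ 𝒱)
      (restr Δ S.contDiffOn.continuousOn, measureOp μ ℱ 𝒱) t h h₀) :
    ∃ M C : ℝ, ∀ᶠ n in atTop, ∀ δ ∈ 𝒱,
      cdfOp δ (((restr Δ S.contDiffOn.continuousOn, measureOp μ ℱ 𝒱) : DSpace μ ℱ 𝒱) +
        t n • h n) ≤ cdf μ Δ (δ + |t n| * M) + |t n| * C := by
  have hG : Tendsto (fun n => (h n).1) atTop (𝓝 h₀.1) :=
    (continuous_fst.tendsto h₀).comp hseq.tendsto_dir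
  have hH : Tendsto (fun n => (h n).2) atTop (𝓝 h₀.2) :=
    (continuous_snd.tendsto h₀).comp hseq.tendsto_dir
  obtain ⟨M, hM0, hM⟩ := S.exists_eventually_bound hG
  obtain ⟨C, hC⟩ := exists_abs_evalOp_le h₀.2
  refine ⟨M, C + 1, ?_⟩
  filter_upwards [hM, hH.eventually (eventually_evalOp_sub_lt h₀.2 one_pos)] with n h1 h2 δ hδ
  rw [S.cdfOp_add_smul hδ (hseq.mem_domain n)]
  set g := ind (toFn (restr Δ S.contDiffOn.continuousOn + t n • (h n).1)) δ
  refine add_le_add ?_ ?_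
  · refine ENNReal.toReal_mono (measure_ne_top _ _) (measure_mono_ae ?_)
    filter_upwards [S.ae_mem] with x hx hxδ
    have h3 : |t n * toFn (h n).1 x| ≤ |t n| * M := by
      rw [abs_mul]; exact mul_le_mul_of_nonneg_left (h1 x hx) (abs_nonneg _)
    change Δ x ≤ δ + |t n| * M
    have h4 : Δ x + t n * toFn (h n).1 x ≤ δ := hxδ
    linarith [neg_abs_le (t n * toFn (h n).1 x)]
  · refine (le_abs_self _).trans ?_
    rw [abs_mul]
    refine mul_le_mul_of_nonneg_left ?_ (abs_nonneg _)
    have h3 := abs_add_le (evalOp (h n).2 g - evalOp h₀.2 g) (evalOp h₀.2 g)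
    rw [sub_add_cancel] at h3
    linarith [h2 g, hC g]

/-- Each term is compared in two moves: first the direction changes at fixed `δ`, with a locally
uniform bound, then `δ` changes with the direction fixed at `h₀`. -/
lemma continuousOn_cdfDeriv [IsProbabilityMeasure μ] (S : IsSetting X B Δ μ p)
    {ℱ : Set (contSpace B)} (hΔℱ : restr Δ S.contDiffOn.continuousOn ∈ ℱ) {𝒱 D : Set ℝ}
    (hD : IsCompact D) (hreg : ∀ δ ∈ D, IsRegularValueOn Δ (closure X) δ) (hD𝒱 : D ⊆ 𝒱) :
    ContinuousOn (fun q : ℝ × DSpace μ ℱ 𝒱 => cdfDeriv X Δ p q.1 q.2) (D ×ˢ univ) := by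
  rintro ⟨δ₀, h₀⟩ ⟨hδ₀ : δ₀ ∈ D, -⟩
  have hfst : Tendsto (Prod.fst : ℝ × DSpace μ ℱ 𝒱 → ℝ) (𝓝[D ×ˢ univ] (δ₀, h₀)) (𝓝 δ₀) :=
    continuous_fst.continuousWithinAt
  have hG : Tendsto (fun q : ℝ × DSpace μ ℱ 𝒱 => q.2.1) (𝓝[D ×ˢ univ] (δ₀, h₀)) (𝓝 h₀.1) :=
    (continuous_fst.comp continuous_snd).continuousWithinAt
  have hH : Tendsto (fun q : ℝ × DSpace μ ℱ 𝒱 => q.2.2) (𝓝[D ×ˢ univ] (δ₀, h₀)) (𝓝 h₀.2) :=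
    (continuous_snd.comp continuous_snd).continuousWithinAt
  refine ContinuousWithinAt.add (ContinuousWithinAt.neg ?_) ?_
  · refine Metric.tendsto_nhds.2 fun e he => ?_
    set c := density X Δ p δ₀
    have hc := (S.continuousAt_density (hreg δ₀ hδ₀)).tendsto.comp hfst
    set η := e / (2 * (|c| + 1)) with hη
    have hη0 : 0 < η := by positivity
    have hI := (S.continuousAt_levelIntegral (hreg δ₀ hδ₀) h₀.1.2).tendsto.comp hfst
    filter_upwards [hc.eventually_lt_const (lt_add_one c), hG.eventually (eventually_toFn_sub_lt _ hη0),
      (Metric.tendsto_nhds.1 hI) (e / 2) (half_pos he), self_mem_nhdsWithin] with q h1 h2 h3 h4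
    have h5 := abs_levelIntegral_sub_le S.isCompact S.isOpen S.subset S.contDiffOn S.continuous
      S.nonneg S.zero (hreg q.1 h4.1) q.2.1.2 h₀.1.2 fun x => (h2 x).le
    rw [Real.dist_eq] at h3 ⊢
    simp only [Function.comp_apply] at h1 h3
    have h6 : η * density X Δ p q.1 ≤ η * (|c| + 1) :=
      mul_le_mul_of_nonneg_left (by linarith [le_abs_self c]) hη0.le
    have h7 : η * (|c| + 1) = e / 2 := by
      rw [hη]; field_simp
    have h8 := abs_add_le (levelIntegral X Δ p (toFn q.2.1) q.1 - levelIntegral X Δ p (toFn h₀.1) q.1)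
      (levelIntegral X Δ p (toFn h₀.1) q.1 - levelIntegral X Δ p (toFn h₀.1) δ₀)
    rw [sub_add_sub_cancel] at h8
    linarith
  · refine Metric.tendsto_nhds.2 fun e he => ?_
    obtain ⟨ρ, hρ, hmod⟩ := S.exists_evalOp_modulus hΔℱ hD hreg hD𝒱 h₀.2 (half_pos he)
    filter_upwards [hH.eventually (eventually_evalOp_sub_lt h₀.2 (half_pos he)),
      (Metric.tendsto_nhds.1 hfst) ρ hρ, self_mem_nhdsWithin] with q h1 h2 h3
    rw [Real.dist_eq] at h2 ⊢
    have h4 : |evalOp h₀.2 (ind (B.domRestrict Δ) q.1) -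
        evalOp h₀.2 (ind (B.domRestrict Δ) δ₀)| < e / 2 := by
      refine hmod δ₀ hδ₀ _ hΔℱ q.1 (hD𝒱 h3.1) (Eventually.of_forall fun x => ?_)
      have hval : toFn (restr Δ S.contDiffOn.continuousOn) x = Δ x := rfl
      change |toFn (restr Δ S.contDiffOn.continuousOn) x - q.1 - (Δ x - δ₀)| ≤ ρ
      rw [hval, show Δ x - q.1 - (Δ x - δ₀) = -(q.1 - δ₀) by ring, abs_neg]
      exact h2.le
    have h5 := h1 (ind (B.domRestrict Δ) q.1)
    have h6 := abs_add_le (evalOp q.2.2 (ind (B.domRestrict Δ) q.1) -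
      evalOp h₀.2 (ind (B.domRestrict Δ) q.1)) (evalOp h₀.2 (ind (B.domRestrict Δ) q.1) -
      evalOp h₀.2 (ind (B.domRestrict Δ) δ₀))
    rw [sub_add_sub_cancel] at h6
    linarith

lemma cdfDeriv_add (S : IsSetting X B Δ μ p) {ℱ : Set (contSpace B)} {𝒱 : Set ℝ} {δ : ℝ}
    (hδ : IsRegularValueOn Δ (closure X) δ) (h h' : DSpace μ ℱ 𝒱) :
    cdfDeriv X Δ p δ (h + h') = cdfDeriv X Δ p δ h + cdfDeriv X Δ p δ h' := by
  have h1 : levelIntegral X Δ p (toFn (h + h').1) δ =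
      levelIntegral X Δ p (toFn h.1) δ + levelIntegral X Δ p (toFn h'.1) δ := by
    rw [levelIntegral, levelIntegral, levelIntegral,
      ← integral_add (S.integrableOn hδ h.1.2) (S.integrableOn hδ h'.1.2)]
    refine integral_congr_ae (Eventually.of_forall fun x => ?_)
    change (toFn h.1 x + toFn h'.1 x) * p x / _ = _
    rw [add_mul, add_div]
  rw [cdfDeriv, h1, Prod.snd_add, evalOp_add, cdfDeriv, cdfDeriv]
  ring

lemma cdfDeriv_smul {ℱ : Set (contSpace B)} {𝒱 : Set ℝ} (δ c : ℝ) (h : DSpace μ ℱ 𝒱) :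
    cdfDeriv X Δ p δ (c • h) = c * cdfDeriv X Δ p δ h := by
  have h1 : levelIntegral X Δ p (toFn (c • h).1) δ = c * levelIntegral X Δ p (toFn h.1) δ := by
    rw [levelIntegral, levelIntegral, ← integral_const_mul]
    refine integral_congr_ae (Eventually.of_forall fun x => ?_)
    change (c * toFn h.1 x) * p x / _ = _
    rw [mul_assoc, mul_div_assoc]
  rw [cdfDeriv, h1, Prod.smul_snd, evalOp_smul, cdfDeriv]
  ring

/-- The derivative of the distribution operator as a continuous linear functional. -/
lemma exists_clm_cdfDeriv [IsProbabilityMeasure μ] (S : IsSetting X B Δ μ p)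
    {ℱ : Set (contSpace B)} (hΔℱ : restr Δ S.contDiffOn.continuousOn ∈ ℱ) {𝒱 : Set ℝ} {δ : ℝ}
    (hδ : IsRegularValueOn Δ (closure X) δ) (hδ𝒱 : δ ∈ 𝒱) (D₀ : Submodule ℝ (DSpace μ ℱ 𝒱)) :
    ∃ L : D₀ →L[ℝ] ℝ, ∀ h : D₀, L h = cdfDeriv X Δ p δ (h : DSpace μ ℱ 𝒱) := by
  refine ⟨⟨⟨⟨fun h => cdfDeriv X Δ p δ (h : DSpace μ ℱ 𝒱), fun h h' => ?_⟩, fun c h => ?_⟩, ?_⟩, fun h => rfl⟩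
  · exact S.cdfDeriv_add hδ _ _
  · exact cdfDeriv_smul δ c _
  -- Continuity in the direction is joint continuity over the compact set `{δ}`.
  · have h1 := S.continuousOn_cdfDeriv hΔℱ isCompact_singleton (D := {δ})
      (by rintro _ rfl; exact hδ) (singleton_subset_iff.2 hδ𝒱)
    exact h1.comp_continuous (continuous_const.prodMk continuous_subtype_val)
      fun h => ⟨rfl, mem_univ _⟩

theorem hasHadamardDeriv_cdfOp [IsProbabilityMeasure μ] (S : IsSetting X B Δ μ p)
    {ℱ : Set (contSpace B)} (hΔℱ : restr Δ S.contDiffOn.continuousOn ∈ ℱ) {𝒱 D : Set ℝ}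
    (hD : IsCompact D) (hreg : ∀ δ ∈ D, IsRegularValueOn Δ (closure X) δ) (hD𝒱 : D ⊆ 𝒱) :
    HasHadamardDerivUniformlyOn cdfOp (cdfDeriv X Δ p) D
      (domain μ ℱ 𝒱) (tangentSpace μ ℱ 𝒱)
      (restr Δ S.contDiffOn.continuousOn, measureOp μ ℱ 𝒱) := by
  refine ⟨hΔℱ, fun δ hδ => S.exists_clm_cdfDeriv hΔℱ (hreg δ hδ) (hD𝒱 hδ) _,
    (S.continuousOn_cdfDeriv hΔℱ hD hreg hD𝒱).mono (prod_mono_right (subset_univ _)),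
    fun t h h₀ hseq => Metric.tendstoUniformlyOn_iff.2 fun e he => ?_⟩
  filter_upwards [S.eventually_cdfOp_sub_le hΔℱ hD hreg hD𝒱 hseq (half_pos he)] with n hn δ hδ
  have h1 := hn δ hδ
  have ht := hseq.ne_zero n
  rw [← S.cdfOp_base hΔℱ (hD𝒱 hδ)] at h1
  rw [dist_comm, Real.dist_eq]
  have h2 : ∀ a b c : ℝ, (a - b) / t n - c = (a - b - t n * c) / t n := fun a b c => by
    field_simp
  rw [h2, abs_div, div_lt_iff₀ (abs_pos.2 ht)]
  refine h1.trans_lt ?_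
  have := abs_pos.2 ht
  nlinarith

end IsSetting

/-! ### The sorting operator -/

lemma exists_lt_of_hasDerivAt_pos {F : ℝ → ℝ} {c q : ℝ} (hF : HasDerivAt F c q) (hc : 0 < c)
    {r : ℝ} (hr : 0 < r) : (∃ y, q < y ∧ y < q + r ∧ F q < F y) ∧
      ∃ y, q - r < y ∧ y < q ∧ F y < F q := by
  have h := hF.tendsto_slope.eventually_const_lt hc
  constructor
  · have h1 : ∀ᶠ y in 𝓝[>] q, 0 < slope F q y :=
      h.filter_mono (nhdsWithin_mono _ fun y (hy : q < y) => hy.ne')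
    obtain ⟨y, hy, hy1, hy2⟩ := (h1.and (Ioo_mem_nhdsGT (lt_add_of_pos_right q hr))).exists
    refine ⟨y, hy1, hy2, ?_⟩
    rw [slope_def_field, div_pos_iff_of_pos_right (by linarith)] at hy
    linarith
  · have h1 : ∀ᶠ y in 𝓝[<] q, 0 < slope F q y :=
      h.filter_mono (nhdsWithin_mono _ fun y (hy : y < q) => hy.ne)
    obtain ⟨y, hy, hy1, hy2⟩ := (h1.and (Ioo_mem_nhdsLT (sub_lt_self q hr))).exists
    refine ⟨y, hy1, hy2, ?_⟩
    rw [slope_def_field, div_pos_iff] at hy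
    rcases hy with hy | hy <;> linarith [hy.1, hy.2]

/-- A continuous function attains the level `u` at its left inverse. -/
lemma eq_of_continuousAt_sInf {F : ℝ → ℝ} {u : ℝ} (hne : {δ | u ≤ F δ}.Nonempty)
    (hbdd : BddBelow {δ | u ≤ F δ}) (hF : ContinuousAt F (sInf {δ | u ≤ F δ})) :
    F (sInf {δ | u ≤ F δ}) = u := by
  set q := sInf {δ | u ≤ F δ} with hq
  refine le_antisymm ?_ ?_
  · refine le_of_tendsto (hF.tendsto.mono_left nhdsWithin_le_nhds : Tendsto F (𝓝[<] q) _) ?_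
    filter_upwards [self_mem_nhdsWithin] with y hy
    have h : y ∉ {δ | u ≤ F δ} := notMem_of_lt_csInf hy hbdd
    exact (not_le.1 h).le
  · by_contra! hlt
    obtain ⟨r, hr, hball⟩ := Metric.eventually_nhds_iff.1 (hF.eventually_lt_const hlt)
    obtain ⟨δ, hδ, hδr⟩ := exists_lt_of_csInf_lt hne (lt_add_of_pos_right q hr)
    refine absurd hδ (not_le.2 (hball ?_))
    rw [Real.dist_eq, abs_of_nonneg (sub_nonneg.2 (csInf_le hbdd hδ))]
    linarith

variable {d : ℕ} {X B : Set (EuclideanSpace ℝ (Fin d))} {Δ : EuclideanSpace ℝ (Fin d) → ℝ}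
  {μ : Measure B} {p : B → ℝ}

namespace IsSetting

/-- `Δ` is bounded on `closure X`, which carries all the mass, so the distribution function reaches
one. -/
lemma exists_le_cdf [IsProbabilityMeasure μ] (S : IsSetting X B Δ μ p) {u : ℝ} (hu : u ≤ 1) :
    {δ | u ≤ cdf μ Δ δ}.Nonempty := by
  obtain ⟨M, -, hM⟩ := S.exists_bound S.continuous_domRestrict
  refine ⟨M, hu.trans ?_⟩
  rw [← probReal_univ (μ := μ)]
  refine ENNReal.toReal_mono (measure_ne_top _ _) (measure_mono_ae ?_)
  filter_upwards [S.ae_mem] with x hx _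
  exact (le_abs_self _).trans (hM x hx)

lemma cdf_sorted [IsProbabilityMeasure μ] (S : IsSetting X B Δ μ p) {D : Set ℝ}
    (hreg : ∀ δ ∈ D, IsRegularValueOn Δ (closure X) δ) {ε u : ℝ}
    (hu : u ∈ quantileIndices X Δ μ p D ε) : cdf μ Δ (sorted μ Δ u) = u :=
  eq_of_continuousAt_sInf (S.exists_le_cdf hu.1.2) hu.2.1
    (S.hasDerivAt_cdf (hreg _ hu.2.2.1)).continuousAt

/-- A positive derivative makes the distribution function take values strictly above and below `u`
close to the quantile; monotonicity confines the quantiles of nearby levels between these points. -/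
lemma continuousOn_sorted [IsProbabilityMeasure μ] (S : IsSetting X B Δ μ p) {D : Set ℝ}
    (hreg : ∀ δ ∈ D, IsRegularValueOn Δ (closure X) δ) {ε : ℝ} (hε : 0 < ε) :
    ContinuousOn (sorted μ Δ) (quantileIndices X Δ μ p D ε) := by
  intro u hu
  refine Metric.tendsto_nhds.2 fun r hr => ?_
  have hmono := monotone_cdf (Δ := Δ) μ
  obtain ⟨⟨y, hy1, hy2, hy3⟩, z, hz1, hz2, hz3⟩ := exists_lt_of_hasDerivAt_pos
    (S.hasDerivAt_cdf (hreg _ hu.2.2.1)) (hε.trans hu.2.2.2) hr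
  rw [S.cdf_sorted hreg hu] at hy3 hz3
  filter_upwards [mem_nhdsWithin_of_mem_nhds (Ioo_mem_nhds hz3 hy3), self_mem_nhdsWithin]
    with u' hu' hmem
  have h1 := S.cdf_sorted hreg hmem
  have h2 : sorted μ Δ u' < y := hmono.reflect_lt (by rw [h1]; exact hu'.2)
  have h3 : z < sorted μ Δ u' := hmono.reflect_lt (by rw [h1]; exact hu'.1)
  rw [Real.dist_eq, abs_lt]
  constructor <;> linarith

/-- The infimum over `ℝ` is attained at a point of `D ⊆ 𝒱`, so restricting to `𝒱` does not change
it. -/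
lemma sortOp_base [IsProbabilityMeasure μ] (S : IsSetting X B Δ μ p)
    {ℱ : Set (contSpace B)} (hΔℱ : restr Δ S.contDiffOn.continuousOn ∈ ℱ) {𝒱 D : Set ℝ}
    (hreg : ∀ δ ∈ D, IsRegularValueOn Δ (closure X) δ) (hD𝒱 : D ⊆ 𝒱) {ε u : ℝ}
    (hu : u ∈ quantileIndices X Δ μ p D ε) :
    sortOp u ((restr Δ S.contDiffOn.continuousOn, measureOp μ ℱ 𝒱) : DSpace μ ℱ 𝒱) =
      sorted μ Δ u := by
  refine IsLeast.csInf_eq ⟨⟨hD𝒱 hu.2.2.1, ?_⟩, fun δ hδ => ?_⟩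
  · rw [S.cdfOp_base hΔℱ (hD𝒱 hu.2.2.1), S.cdf_sorted hreg hu]
  · have h1 := hδ.2
    rw [S.cdfOp_base hΔℱ hδ.1] at h1
    exact csInf_le hu.2.1 h1

/-- The expansion of the sorting operator, uniformly in the quantile index. -/
theorem eventually_sortOp_sub_le [IsProbabilityMeasure μ] (S : IsSetting X B Δ μ p)
    {ℱ : Set (contSpace B)} (hΔℱ : restr Δ S.contDiffOn.continuousOn ∈ ℱ) {𝒱 D : Set ℝ}
    (hD : IsCompact D) (hreg : ∀ δ ∈ D, IsRegularValueOn Δ (closure X) δ)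
    (hD𝒱 : D ⊆ interior 𝒱) {ε : ℝ} (hε : 0 < ε)
    {t : ℕ → ℝ} {h : ℕ → DSpace μ ℱ 𝒱} {h₀ : DSpace μ ℱ 𝒱}
    (hseq : IsTangentSeq (domain μ ℱ 𝒱) (tangentSpace μ ℱ 𝒱)
      (restr Δ S.contDiffOn.continuousOn, measureOp μ ℱ 𝒱) t h h₀) {η : ℝ} (hη : 0 < η) :
    ∀ᶠ n in atTop, ∀ u ∈ quantileIndices X Δ μ p D ε,
      (upperSet u (((restr Δ S.contDiffOn.continuousOn, measureOp μ ℱ 𝒱) : DSpace μ ℱ 𝒱) +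
        t n • h n)).Nonempty ∧
      BddBelow (upperSet u
        (((restr Δ S.contDiffOn.continuousOn, measureOp μ ℱ 𝒱) : DSpace μ ℱ 𝒱) + t n • h n)) ∧
      |sortOp u (((restr Δ S.contDiffOn.continuousOn, measureOp μ ℱ 𝒱) : DSpace μ ℱ 𝒱) +
        t n • h n) - sorted μ Δ u - t n * sortDeriv X Δ p u h₀| ≤ η * |t n| := by
  have hWo : IsOpen (interior 𝒱 ∩ {δ | IsRegularValueOn Δ (closure X) δ}) :=
    isOpen_interior.inter S.isOpen_regular
  -- Perturbed quantiles leave `D`, so the expansion is taken on a compact thickening that still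
  -- consists of regular values in `𝒱`. This is where `D ⊆ interior 𝒱` enters.
  obtain ⟨r, hr, hrW⟩ := hD.exists_cthickening_subset_open hWo fun δ hδ => ⟨hD𝒱 hδ, hreg δ hδ⟩
  have hE : IsCompact (Metric.cthickening r D) := hD.cthickening
  have hE𝒱 : Metric.cthickening r D ⊆ 𝒱 := fun δ hδ => interior_subset (hrW hδ).1
  have hEreg : ∀ δ ∈ Metric.cthickening r D, IsRegularValueOn Δ (closure X) δ :=
    fun δ hδ => (hrW hδ).2
  have hA : ContinuousOn (fun δ => cdfDeriv X Δ p δ h₀) (Metric.cthickening r D) :=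
    (S.continuousOn_cdfDeriv hΔℱ hE hEreg hE𝒱).comp
      (Continuous.prodMk continuous_id continuous_const).continuousOn fun δ hδ => ⟨hδ, mem_univ _⟩
  obtain ⟨M, C, hfar⟩ := S.exists_eventually_cdfOp_le hseq
  have key := eventually_sInf_expansion hD hE hr
    (fun q hq => Metric.closedBall_subset_cthickening hq r) S.isOpen_regular hEreg hE𝒱
    (fun δ hδ => S.hasDerivAt_cdf hδ) (fun δ hδ => (S.continuousAt_density hδ).continuousWithinAt)
    hA (monotone_cdf μ) hseq.tendsto_zero hseq.ne_zero
    (fun η hη => S.eventually_cdfOp_sub_le hΔℱ hE hEreg hE𝒱 hseq hη) hfar hε hη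
  filter_upwards [key] with n hn u hu
  have h1 := hn (sorted μ Δ u) hu.2.2.1 hu.2.2.2
  -- The inversion is stated for levels of the form `F q`; with `q` the quantile of `u` this level
  -- is `u`.
  rw [S.cdf_sorted hreg hu] at h1
  refine ⟨h1.1, h1.2.1, ?_⟩
  rw [sortDeriv, mul_neg, sub_neg_eq_add]
  exact h1.2.2

theorem hasHadamardDeriv_sortOp [IsProbabilityMeasure μ] (S : IsSetting X B Δ μ p)
    {ℱ : Set (contSpace B)} (hΔℱ : restr Δ S.contDiffOn.continuousOn ∈ ℱ) {𝒱 D : Set ℝ}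
    (hD : IsCompact D) (hreg : ∀ δ ∈ D, IsRegularValueOn Δ (closure X) δ)
    (hD𝒱 : D ⊆ interior 𝒱) {ε : ℝ} (hε : 0 < ε) :
    HasHadamardDerivUniformlyOn sortOp (sortDeriv X Δ p) (quantileIndices X Δ μ p D ε)
      (domain μ ℱ 𝒱) (tangentSpace μ ℱ 𝒱)
      (restr Δ S.contDiffOn.continuousOn, measureOp μ ℱ 𝒱) := by
  have hD𝒱' : D ⊆ 𝒱 := hD𝒱.trans interior_subset
  refine ⟨hΔℱ, fun u hu => ?_, ?_, fun t h h₀ hseq =>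
    Metric.tendstoUniformlyOn_iff.2 fun e he => ?_⟩
  · obtain ⟨L, hL⟩ := S.exists_clm_cdfDeriv hΔℱ (hreg _ hu.2.2.1) (hD𝒱' hu.2.2.1)
      (tangentSpace μ ℱ 𝒱)
    refine ⟨(-(density X Δ p (sorted μ Δ u))⁻¹) • L, fun h => ?_⟩
    change -(density X Δ p (sorted μ Δ u))⁻¹ * L h = _
    rw [hL, sortDeriv, div_eq_inv_mul, neg_mul]
  · have h1 : ContinuousOn (fun q : ℝ × DSpace μ ℱ 𝒱 => sorted μ Δ q.1)
        (quantileIndices X Δ μ p D ε ×ˢ (tangentSpace μ ℱ 𝒱 : Set (DSpace μ ℱ 𝒱))) :=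
      (S.continuousOn_sorted hreg hε).comp continuousOn_fst fun q hq => hq.1
    have h2 : ContinuousOn (density X Δ p) D := fun δ hδ =>
      (S.continuousAt_density (hreg δ hδ)).continuousWithinAt
    refine ContinuousOn.neg (ContinuousOn.div ?_ (h2.comp h1 fun q hq => hq.1.2.2.1) fun q hq =>
      (hε.trans hq.1.2.2.2).ne')
    exact (S.continuousOn_cdfDeriv hΔℱ hD hreg hD𝒱').comp (h1.prodMk continuousOn_snd)
      fun q hq => ⟨hq.1.2.2.1, mem_univ _⟩
  · filter_upwards [S.eventually_sortOp_sub_le hΔℱ hD hreg hD𝒱 hε hseq (half_pos he)]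
      with n hn u hu
    have h1 := (hn u hu).2.2
    have ht := hseq.ne_zero n
    rw [← S.sortOp_base hΔℱ hreg hD𝒱' hu] at h1
    rw [dist_comm, Real.dist_eq]
    have h2 : ∀ a b c : ℝ, (a - b) / t n - c = (a - b - t n * c) / t n := fun a b c => by
      field_simp
    rw [h2, abs_div, div_lt_iff₀ (abs_pos.2 ht)]
    refine h1.trans_lt ?_
    have := abs_pos.2 ht
    nlinarith

end IsSetting

end SortedEffects

/-! ### The main theorem -/

open SortedEffects in
theorem mainTheorem1 {d : ℕ} (hd : 0 < d)
    -- the domain of interest `X` and its neighbourhood `B`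
    (X B : Set (EuclideanSpace ℝ (Fin d)))
    (hX : IsOpen X) (hXc : IsCompact (closure X)) (hB : IsOpen B) (hXB : closure X ⊆ B)
    -- the function `Δ`
    (Δ : EuclideanSpace ℝ (Fin d) → ℝ) (hΔ : ContDiffOn ℝ 1 Δ B)
    -- the distribution `μ` and its Lebesgue density `p = μ'`
    (μ : Measure B) [IsProbabilityMeasure μ] (p : B → ℝ) (hp : Continuous p)
    (hp_nonneg : ∀ x, 0 ≤ p x) (hp_zero : ∀ x : B, x.1 ∉ X → p x = 0)
    (hμ : μ = (Measure.comap Subtype.val volume).withDensity fun x => ENNReal.ofReal (p x))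
    -- closures of regular level sets have finitely many path components
    (hbranch : ∀ δ, IsRegularValueOn Δ (closure X) δ →
      Finite (ZerothHomotopy (closure (levelSet X Δ δ))))
    -- the classes `ℱ ∋ Δ` and `𝒱` that index `𝒢`
    (ℱ : Set (contSpace B)) (hΔℱ : restr Δ hΔ.continuousOn ∈ ℱ) (𝒱 : Set ℝ)
    -- a compact set of regular values
    (𝒟 : Set ℝ) (h𝒟 : IsCompact 𝒟) (h𝒟reg : ∀ δ ∈ 𝒟, IsRegularValueOn Δ (closure X) δ)
    (h𝒟𝒱 : 𝒟 ⊆ 𝒱) :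
    -- the integrals are well defined, and `density` is the derivative of the distribution function
    (∀ δ ∈ 𝒟,
      (∀ G ∈ unifContSpace B,
        IntegrableOn (fun x : B => toFn G x * p x / ‖gradient Δ x.1‖)
          {x : B | x.1 ∈ levelSet X Δ δ} (surfaceVol B)) ∧
      HasDerivAt (cdf μ Δ) (density X Δ p δ) δ) ∧
    -- (a)
    HasHadamardDerivUniformlyOn cdfOp (cdfDeriv X Δ p) 𝒟
      (domain μ ℱ 𝒱) (tangentSpace μ ℱ 𝒱) (restr Δ hΔ.continuousOn, measureOp μ ℱ 𝒱) ∧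
    -- (b)
    (𝒟 ⊆ interior 𝒱 → ∀ ε : ℝ, 0 < ε →
      -- the sorting operator is well defined at and near `(Δ, μ)`
      (∀ u ∈ quantileIndices X Δ μ p 𝒟 ε,
        sortOp u ((restr Δ hΔ.continuousOn, measureOp μ ℱ 𝒱) : DSpace μ ℱ 𝒱) = sorted μ Δ u) ∧
      (∀ (t : ℕ → ℝ) (h : ℕ → DSpace μ ℱ 𝒱) (h₀ : DSpace μ ℱ 𝒱),
        IsTangentSeq (domain μ ℱ 𝒱) (tangentSpace μ ℱ 𝒱)
          (restr Δ hΔ.continuousOn, measureOp μ ℱ 𝒱) t h h₀ →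
        ∀ᶠ n in atTop, ∀ u ∈ quantileIndices X Δ μ p 𝒟 ε,
          (upperSet u ((restr Δ hΔ.continuousOn, measureOp μ ℱ 𝒱) + t n • h n)).Nonempty ∧
          BddBelow (upperSet u ((restr Δ hΔ.continuousOn, measureOp μ ℱ 𝒱) + t n • h n))) ∧
      -- its derivative
      HasHadamardDerivUniformlyOn sortOp (sortDeriv X Δ p) (quantileIndices X Δ μ p 𝒟 ε)
        (domain μ ℱ 𝒱) (tangentSpace μ ℱ 𝒱)
        (restr Δ hΔ.continuousOn, measureOp μ ℱ 𝒱)) := by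
  have S : IsSetting X B Δ μ p := ⟨hXc, hB, hXB, hΔ, hp, hp_nonneg, hp_zero, hμ⟩
  refine ⟨fun δ hδ => ⟨fun G _ => S.integrableOn (h𝒟reg δ hδ) G.2,
    S.hasDerivAt_cdf (h𝒟reg δ hδ)⟩, S.hasHadamardDeriv_cdfOp hΔℱ h𝒟 h𝒟reg h𝒟𝒱,
    fun hint ε hε => ⟨fun u hu => S.sortOp_base hΔℱ h𝒟reg h𝒟𝒱 hu, fun t h h₀ hseq => ?_,
      S.hasHadamardDeriv_sortOp hΔℱ h𝒟 h𝒟reg hint hε⟩⟩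
  filter_upwards [S.eventually_sortOp_sub_le hΔℱ h𝒟 h𝒟reg hint hε hseq one_pos] with n hn u hu
  exact ⟨(hn u hu).1, (hn u hu).2.1⟩
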